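/- Let $d,r\ge 1$ be integers. For $n\ge 1$ divisible by $2r$, consider the following continuous-time Markov process with vertex set $[n]=\{1,\dots,n\}$. Its state consists of $d$ labelled partitions of $[n]$ into sets of size $2r$ (the hyperedges of labels $1,\dots,d$) and of queue lengths $Q^{(v)}\in\{0,1,2,\dots\}$, $v\in[n]$. The neighbourhood of a vertex is the set consisting of that vertex and of all vertices sharing a hyperedge (of any label) with it. At each vertex $v$: at rate $1$, a task is served, i.e. $Q^{(v)}$ decreases by $1$ if it is positive; at rate $\lambda>0$, a task arrives and joins a uniformly chosen queue among the shortest queues in the neighbourhood of $v$; and, for each label $i\in[d]$, at rate $\kappa\ge 0$ a uniform vertex $w\in[n]$ is chosen and $v$ and $w$ swap their memberships in the partition of label $i$. All these events are independent. For $d=1$ this is the supermarket model on the dynamic equal partition. By a stationary law we mean an invariant probability law of this process; if $\kappa=0$, so that the partitions never move, we require in addition that the $d$-tuple of partitions is uniformly distributed (for $\kappa>0$ this is automatic). There is $\lambda_0=\lambda_0(d,r)>0$ such that for every $\lambda\in(0,\lambda_0]$ there is a constant $C=C(d,r,\lambda)$ with the following property for every $\kappa\in[0,\infty)$. For every $n\geq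 1$ divisible by $2r$ there is a unique stationary law; the stationary law $\pi_\kappa^{(n)}$ of a single queue (the same for all vertices) converges pointwise, as $n\to\infty$ through multiples of $2r$, to a probability law $\eta_\kappa$ on $\{0,1,2,\dots\}$; and for all $n\ge1$ divisible by $2r$, all $x\in\{0,\dots,n\}$ and all distinct vertices $v_1,\dots,v_x\in[n]$, at stationarity $$ \mathrm{d}_{\mathrm{TV}}\left(\mathcal L\left(Q^{(v_1)},\dots,Q^{(v_x)}\right),\ \eta_\kappa^{\otimes x}\right)\le C\,\frac{x^2}{n}, $$ where $\mathrm{d}_{\mathrm{TV}}(\mu,\nu)=\sup_A|\mu(A)-\nu(A)|$. In particular, this holds with one constant $C$ for every choice $\kappa=\kappa(n)\in[0,\infty)$. -/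

import Mathlib

open MeasureTheory

noncomputable section

namespace Supermarket

/-- A partition of the vertex set `Fin n` into classes (hyperedges) of size exactly `k`. -/
structure EqualPartition (n k : ℕ) where
  /-- `rel u v` says that `u` and `v` lie in the same hyperedge. -/
  rel : Setoid (Fin n)
  card_class : ∀ v : Fin n, Nat.card {u : Fin n // rel v u} = k

/-- The vertices `v` and `w` swap their partition membership. -/
def EqualPartition.swap {n k : ℕ} (P : EqualPartition n k) (v w : Fin n) :
    EqualPartition n k where
  rel := Setoid.comap (Equiv.swap v w) P.rel
  card_class := fun u =>
    (Nat.card_congr ((Equiv.swap v w).subtypeEquiv fun _ => Iff.rfl)).trans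
      (P.card_class (Equiv.swap v w u))

/-- A state of the system: for each label `i : Fin d` an equal partition of the `n` vertices into
hyperedges of size `k` (so every vertex is in one hyperedge of each label), and a queue length at
each vertex. -/
@[ext]
structure State (d k n : ℕ) where
  graph : Fin d → EqualPartition n k
  queue : Fin n → ℕ

/-- The state space is countable; every set of states is an event. -/
instance (d k n : ℕ) : MeasurableSpace (State d k n) := ⊤

variable {d k n : ℕ}

open Classical in
/-- The neighbourhood of `v`: the vertex `v` and all vertices sharing a hyperedge with it. -/
def State.nbhd (s : State d k n) (v : Fin n) : Finset (Fin n) :=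
  Finset.univ.filter fun w => w = v ∨ ∃ i : Fin d, (s.graph i).rel v w

open Classical in
/-- The vertices of the neighbourhood of `v` whose queue is shortest within this neighbourhood. -/
def State.shortest (s : State d k n) (v : Fin n) : Finset (Fin n) :=
  (s.nbhd v).filter fun w => ∀ u ∈ s.nbhd v, s.queue w ≤ s.queue u

/-- A service at `v`: the queue at `v` loses one task; nothing happens if it is empty. -/
def State.serve (s : State d k n) (v : Fin n) : State d k n where
  graph := s.graph
  queue := Function.update s.queue v (s.queue v - 1)

/-- A task joins the queue at `w`. -/
def State.join (s : State d k n) (w : Fin n) : State d k n where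
  graph := s.graph
  queue := Function.update s.queue w (s.queue w + 1)

/-- The half-edges of label `i` at `v` and `w` are swapped. -/
def State.move (s : State d k n) (i : Fin d) (v w : Fin n) : State d k n where
  graph := Function.update s.graph i ((s.graph i).swap v w)
  queue := s.queue

/-- The generator of the supermarket model on the dynamic hypergraph. At every vertex `v` there are
services at rate `1`; arrivals at rate `lam`, each arriving task joining a uniform queue among the
shortest ones of the neighbourhood of `v`; and for every label `i` the half-edge of label `i`
at `v` at rate `kap` picks a uniform vertex `w` and swaps with the half-edge of label `i` at `w`. -/
def gen (lam kap : ℝ) (f : State d k n → ℝ) (s : State d k n) : ℝ :=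
  (∑ v : Fin n, (f (s.serve v) - f s))
    + (∑ v : Fin n, lam * (((s.shortest v).card : ℝ)⁻¹ *
        ∑ w ∈ s.shortest v, (f (s.join w) - f s)))
    + ∑ v : Fin n, ∑ i : Fin d, kap * ((n : ℝ)⁻¹ * ∑ w : Fin n, (f (s.move i v w) - f s))

/-- The transition semigroup `exp (t * gen)` of the Markov process: for bounded `f`, this is the
expectation of `f` at time `t` from initial state `s`. All jump rates are bounded, so for bounded
`f` the series converges absolutely. -/
def semigroup (lam kap t : ℝ) (f : State d k n → ℝ) (s : State d k n) : ℝ :=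
  ∑' j : ℕ, t ^ j / (j.factorial : ℝ) * ((gen lam kap)^[j] f) s

/-- `μ` is a stationary law of the Markov process of hypergraph and queue lengths. If `kap = 0` the
hypergraph never moves, and its law is then taken to be uniform, as it is automatically at
stationarity when `kap > 0`. -/
structure IsStationaryLaw (lam kap : ℝ) (μ : Measure (State d k n)) : Prop where
  isProbabilityMeasure : IsProbabilityMeasure μ
  invariant : ∀ t : ℝ, 0 ≤ t → ∀ f : State d k n → ℝ, (∃ B : ℝ, ∀ s, |f s| ≤ B) →
    ∫ s, semigroup lam kap t f s ∂μ = ∫ s, f s ∂μ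
  uniform_of_static : kap = 0 → ∀ G G' : Fin d → EqualPartition n k,
    μ {s | s.graph = G} = μ {s | s.graph = G'}

/-- Total variation distance of two probability measures: the supremum over all events `A`
of `|μ(A) - ν(A)|`. -/
def tvDist {α : Type*} [MeasurableSpace α] (μ ν : Measure α) : ℝ :=
  ⨆ A : {A : Set α // MeasurableSet A}, |μ.real A.1 - ν.real A.1|

end Supermarket

end

open MeasureTheory

noncomputable section

namespace Supermarket

variable {d k n : ℕ}

/-! ### The state space and the generator -/

/-! The plan is to show that any two queues are independent up to an error of order 1/n, uniformly
in `kap`, and then to upgrade pairs to x-tuples by exchangeability.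

Existence and a priori bounds. Conditionally on the partitions, the tail bound P(Q ≥ j | G) ≤
8^(-|j|) is preserved by a step of the uniformized chain when `lam` is small
(`IsGoodMean.comp_stepL`): services lower the tail, few vertices can send a task to a given queue,
and swaps only mix partitions that obey the same bound. Cesàro means started from empty queues and
uniform partitions therefore have a limit point that is tight, stationary and exchangeable
(`exists_stationary`). Uniqueness (`stationary_unique`) holds because the set where one stationary
law exceeds another is closed under transitions, and services lead every state to empty queues.

The hierarchy. Represent each partition by a uniform permutation of the vertices into n slots, the
hyperedges being intervals of slots. Let V(j, K) be the probability of Q ≥ j given a finite set K of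
revealed (label, vertex, slot) triples. Stationarity yields, up to O(1/n), a closed linear system
(`abs_residual_tailProb_le`). A service takes V(j, K) to V(j + e_b, K). A swap forgets a revealed
triple, at rate 2·`kap` each. An arrival at b is expressed through V(·, K_b), where K_b adds enough
fresh triples to reveal the neighbourhoods of all neighbours of b; revealing fresh triples changes
averages only by O(1/n). Apart from these errors, n does not occur in the system.

Contraction. With the weight 4^(-|j|) 2^|K| the system determines V up to O(1/n)
(`abs_sub_le_of_approxSolves`). Forgetting a triple halves the weight, so the terms with `kap`
contract by themselves, whatever the size of `kap`; this is the source of the uniformity in `kap`.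
Small `lam` pays for the arrivals.

Products. Colour the vertices by parity and reveal only monochromatic hyperedges. The equations then
decouple, and the product of a solution over the two colours is again a solution
(`residual_prodFunctional`). Comparison with V itself shows that two queues are nearly independent;
comparison across system sizes shows that the one-point tails form a Cauchy sequence
(`abs_tailProb_sub_prod_le`).

From pairs to x-tuples. The empirical measure of the queues has fluctuations of variance O(1/n)
around the limit law. By exchangeability, x distinct queues are a sample from it without
replacement; passing to replacement costs x²/n. Sampling x points from a random measure instead of
its near-mean costs x times the bias plus x² times the variance (`abs_integral_iterInt_sub_le`),
again O(x²/n). -/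

theorem EqualPartition.ext_rel {P P' : EqualPartition n k} (h : P.rel = P'.rel) : P = P' := by
  cases P; cases P'; cases h; rfl

instance : Finite (EqualPartition n k) := by
  refine Finite.of_injective (fun P : EqualPartition n k => fun u v => P.rel u v) ?_
  intro P P' h
  refine EqualPartition.ext_rel (Setoid.ext fun u v => ?_)
  exact iff_of_eq (congrFun (congrFun h u) v)

instance : Fintype (EqualPartition n k) := Fintype.ofFinite _

instance : Countable (State d k n) := by
  refine Function.Injective.countable (f := fun s : State d k n => (s.graph, s.queue)) ?_
  intro s s' h
  simp only [Prod.mk.injEq] at h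
  exact State.ext h.1 h.2

instance : DiscreteMeasurableSpace (State d k n) := ⟨fun _ => trivial⟩

/-- The total jump rate. -/
def rate (d n : ℕ) (lam kap : ℝ) : ℝ := n + lam * n + kap * (d * n)

theorem rate_nonneg {lam kap : ℝ} (hl : 0 ≤ lam) (hk : 0 ≤ kap) : 0 ≤ rate d n lam kap := by
  unfold rate; positivity

theorem gen_add (lam kap : ℝ) (f g : State d k n → ℝ) (s : State d k n) :
    gen lam kap (fun s => f s + g s) s = gen lam kap f s + gen lam kap g s := by
  have h1 : ∀ s' : State d k n, f s' + g s' - (f s + g s) = (f s' - f s) + (g s' - g s) :=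
    fun _ => by ring
  simp only [gen, h1, Finset.sum_add_distrib, mul_add]
  ring

theorem gen_smul (lam kap c : ℝ) (f : State d k n → ℝ) (s : State d k n) :
    gen lam kap (fun s => c * f s) s = c * gen lam kap f s := by
  have h1 : ∀ s' : State d k n, c * f s' - c * f s = c * (f s' - f s) := fun _ => by ring
  simp only [gen, h1, mul_add, Finset.mul_sum]
  congr 1
  · congr 1
    refine Finset.sum_congr rfl fun v _ => Finset.sum_congr rfl fun w _ => ?_
    ring
  · refine Finset.sum_congr rfl fun v _ => Finset.sum_congr rfl fun w _ =>
      Finset.sum_congr rfl fun _ _ => ?_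
    ring

theorem gen_const (lam kap c : ℝ) (s : State d k n) :
    gen lam kap (fun _ : State d k n => c) s = 0 := by
  simp [gen]

theorem gen_sub (lam kap : ℝ) (f g : State d k n → ℝ) (s : State d k n) :
    gen lam kap (fun s => f s - g s) s = gen lam kap f s - gen lam kap g s := by
  have h := gen_add lam kap f (fun s => (-1) * g s) s
  rw [gen_smul] at h
  have h2 : (fun s => f s - g s) = fun s => f s + (-1) * g s := by funext s; ring
  rw [h2, h]; ring

/-- An inequality rather than an identity, so that m = 0, where the inverse is 0, needs no separate
treatment later. -/
theorem inv_card_mul_le {x : ℝ} (hx : 0 ≤ x) (m : ℕ) : (m : ℝ)⁻¹ * (m * x) ≤ x := by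
  rcases Nat.eq_zero_or_pos m with h | h
  · simp [h, hx]
  · have : (m : ℝ) ≠ 0 := by positivity
    rw [← mul_assoc, inv_mul_cancel₀ this, one_mul]

/-- For f ≥ 0 the only negative part of the generator is the loss of f(s) at the total jump rate.
This minimum principle gives the boundedness of the generator, the positivity of the uniformized
step and the sign argument behind uniqueness. -/
theorem neg_rate_mul_le_gen {lam kap : ℝ} (hl : 0 ≤ lam) (hk : 0 ≤ kap) {f : State d k n → ℝ}
    (hf : ∀ s, 0 ≤ f s) (s : State d k n) : -(rate d n lam kap * f s) ≤ gen lam kap f s := by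
  have h1 : -(n * f s) ≤ ∑ v : Fin n, (f (s.serve v) - f s) := by
    have : ∑ _v : Fin n, (-f s) ≤ ∑ v : Fin n, (f (s.serve v) - f s) :=
      Finset.sum_le_sum fun v _ => by linarith [hf (s.serve v)]
    simpa using this
  have h2 : -(lam * n * f s) ≤ ∑ v : Fin n, lam * (((s.shortest v).card : ℝ)⁻¹ *
        ∑ w ∈ s.shortest v, (f (s.join w) - f s)) := by
    have : ∑ _v : Fin n, (-(lam * f s)) ≤ ∑ v : Fin n, lam * (((s.shortest v).card : ℝ)⁻¹ *
        ∑ w ∈ s.shortest v, (f (s.join w) - f s)) := by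
      refine Finset.sum_le_sum fun v _ => ?_
      have h3 : ∑ _w ∈ s.shortest v, (-f s) ≤ ∑ w ∈ s.shortest v, (f (s.join w) - f s) :=
        Finset.sum_le_sum fun w _ => by linarith [hf (s.join w)]
      have h4 := mul_le_mul_of_nonneg_left h3
        (inv_nonneg.2 (Nat.cast_nonneg (α := ℝ) (s.shortest v).card))
      simp only [Finset.sum_const, nsmul_eq_mul] at h4
      have h5 := inv_card_mul_le (hf s) (s.shortest v).card
      have h6 : -f s ≤ ((s.shortest v).card : ℝ)⁻¹ *
        ∑ w ∈ s.shortest v, (f (s.join w) - f s) := by linarith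
      have := mul_le_mul_of_nonneg_left h6 hl
      linarith
    simp only [Finset.sum_const, Finset.card_univ, Fintype.card_fin, nsmul_eq_mul] at this
    linarith
  have h3 : -(kap * (d * n) * f s) ≤ ∑ v : Fin n, ∑ i : Fin d, kap * ((n : ℝ)⁻¹ *
      ∑ w : Fin n, (f (s.move i v w) - f s)) := by
    have : ∑ _v : Fin n, ∑ _i : Fin d, (-(kap * f s)) ≤ ∑ v : Fin n, ∑ i : Fin d,
        kap * ((n : ℝ)⁻¹ * ∑ w : Fin n, (f (s.move i v w) - f s)) := by
      refine Finset.sum_le_sum fun v _ => Finset.sum_le_sum fun i _ => ?_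
      have h3 : ∑ _w : Fin n, (-f s) ≤ ∑ w : Fin n, (f (s.move i v w) - f s) :=
        Finset.sum_le_sum fun w _ => by linarith [hf (s.move i v w)]
      have h4 := mul_le_mul_of_nonneg_left h3 (inv_nonneg.2 (Nat.cast_nonneg (α := ℝ) n))
      simp only [Finset.sum_const, nsmul_eq_mul, Finset.card_univ, Fintype.card_fin] at h4
      have h5 := inv_card_mul_le (hf s) n
      have h6 : -f s ≤ (n : ℝ)⁻¹ * ∑ w : Fin n, (f (s.move i v w) - f s) := by linarith
      have := mul_le_mul_of_nonneg_left h6 hk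
      linarith
    simp only [Finset.sum_const, Finset.card_univ, Fintype.card_fin, nsmul_eq_mul] at this
    linarith
  unfold rate gen
  linarith

/-- Apply the minimum principle to B - f and B + f; the generator kills the constant. -/
theorem abs_gen_le {lam kap : ℝ} (hl : 0 ≤ lam) (hk : 0 ≤ kap) {f : State d k n → ℝ} {B : ℝ}
    (hf : ∀ s, |f s| ≤ B) (s : State d k n) :
    |gen lam kap f s| ≤ 2 * rate d n lam kap * B := by
  have h1 := neg_rate_mul_le_gen hl hk (f := fun s => B - f s)
    (fun s => by linarith [(abs_le.1 (hf s)).2]) s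
  have h2 := neg_rate_mul_le_gen hl hk (f := fun s => B + f s)
    (fun s => by linarith [(abs_le.1 (hf s)).1]) s
  rw [gen_sub, gen_const] at h1
  rw [gen_add, gen_const] at h2
  have hr := rate_nonneg (d := d) (n := n) hl hk
  have h3 := mul_le_mul_of_nonneg_left (abs_le.1 (hf s)).1 hr
  have h4 := mul_le_mul_of_nonneg_left (abs_le.1 (hf s)).2 hr
  rw [abs_le]
  constructor <;> nlinarith

theorem abs_iterate_gen_le {lam kap : ℝ} (hl : 0 ≤ lam) (hk : 0 ≤ kap) {f : State d k n → ℝ}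
    {B : ℝ} (hf : ∀ s, |f s| ≤ B) (j : ℕ) (s : State d k n) :
    |((gen lam kap)^[j] f) s| ≤ (2 * rate d n lam kap) ^ j * B := by
  induction j generalizing s with
  | zero => simpa using hf s
  | succ j ih =>
    rw [Function.iterate_succ_apply', pow_succ', mul_assoc]
    exact abs_gen_le hl hk ih s

theorem integrable_of_abs_le {μ : Measure (State d k n)} [IsFiniteMeasure μ]
    {f : State d k n → ℝ} {B : ℝ} (hf : ∀ s, |f s| ≤ B) : Integrable f μ :=
  Integrable.of_bound (Measurable.of_discrete).aestronglyMeasurable B (.of_forall hf)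

theorem abs_integral_le_of_abs_le {α : Type*} [MeasurableSpace α] {μ : Measure α}
    [IsProbabilityMeasure μ]
    {f : α → ℝ} {B : ℝ} (hf : ∀ s, |f s| ≤ B) : |∫ s, f s ∂μ| ≤ B := by
  have := norm_integral_le_of_norm_le_const (μ := μ) (f := f) (C := B) (.of_forall hf)
  simpa using this

/-- The integrated semigroup is the exponential series of the integrated powers of the
generator. -/
theorem hasSum_integral_semigroup {lam kap : ℝ} (hl : 0 ≤ lam) (hk : 0 ≤ kap)
    (μ : Measure (State d k n)) [IsProbabilityMeasure μ] {f : State d k n → ℝ} {B : ℝ}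
    (hf : ∀ s, |f s| ≤ B) (t : ℝ) :
    HasSum (fun j : ℕ => t ^ j / (j.factorial : ℝ) * ∫ s, ((gen lam kap)^[j] f) s ∂μ)
      (∫ s, semigroup lam kap t f s ∂μ) := by
  have hb : ∀ j s, ‖t ^ j / (j.factorial : ℝ) * ((gen lam kap)^[j] f) s‖ ≤
      (|t| * (2 * rate d n lam kap)) ^ j / j.factorial * B := by
    intro j s
    rw [Real.norm_eq_abs, abs_mul, abs_div, abs_pow, mul_pow, Nat.abs_cast]
    have := mul_le_mul_of_nonneg_left (abs_iterate_gen_le hl hk hf j s)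
      (show 0 ≤ |t| ^ j / (j.factorial : ℝ) by positivity)
    refine this.trans_eq ?_
    ring
  have hs : Summable fun j : ℕ => (|t| * (2 * rate d n lam kap)) ^ j / j.factorial * B :=
    (Real.summable_pow_div_factorial _).mul_right B
  have := hasSum_integral_of_summable_integral_norm (μ := μ)
    (F := fun (j : ℕ) s => t ^ j / (j.factorial : ℝ) * ((gen lam kap)^[j] f) s)
    (fun j => integrable_of_abs_le (hb j))
    (Summable.of_nonneg_of_le (fun j => integral_nonneg fun s => norm_nonneg _)
      (fun j => by
        have := abs_integral_le_of_abs_le (μ := μ)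
          (f := fun s => ‖t ^ j / (j.factorial : ℝ) * ((gen lam kap)^[j] f) s‖)
          (fun s => by rw [abs_norm]; exact hb j s)
        exact (le_abs_self _).trans this) hs)
  simpa only [integral_const_mul, semigroup] using this

/-- Every power of the generator beyond the zeroth is the generator of a bounded function, so only
the zeroth term of the exponential series survives integration. -/
theorem integral_semigroup_eq {lam kap : ℝ} (hl : 0 ≤ lam) (hk : 0 ≤ kap)
    (μ : Measure (State d k n)) [IsProbabilityMeasure μ]
    (h : ∀ f : State d k n → ℝ, (∃ B : ℝ, ∀ s, |f s| ≤ B) → ∫ s, gen lam kap f s ∂μ = 0)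
    {f : State d k n → ℝ} (hf : ∃ B : ℝ, ∀ s, |f s| ≤ B) (t : ℝ) :
    ∫ s, semigroup lam kap t f s ∂μ = ∫ s, f s ∂μ := by
  obtain ⟨B, hB⟩ := hf
  refine (hasSum_integral_semigroup hl hk μ hB t).unique ?_
  have := hasSum_single (f := fun j : ℕ => t ^ j / (j.factorial : ℝ) *
    ∫ s, ((gen lam kap)^[j] f) s ∂μ) 0 (by
      intro j hj
      obtain ⟨j, rfl⟩ := Nat.exists_eq_succ_of_ne_zero hj
      have : ∫ s, ((gen lam kap)^[j + 1] f) s ∂μ = 0 := by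
        simp only [Function.iterate_succ_apply']
        exact h _ ⟨_, abs_iterate_gen_le hl hk hB j⟩
      simp only [Nat.succ_eq_add_one, this, mul_zero])
  simpa using this

/-- Invariance under the semigroup implies that the generator integrates to zero. -/
theorem integral_gen_eq_zero {lam kap : ℝ} (hl : 0 ≤ lam) (hk : 0 ≤ kap)
    (μ : Measure (State d k n)) [IsProbabilityMeasure μ] {f : State d k n → ℝ}
    (hf : ∃ B : ℝ, ∀ s, |f s| ≤ B)
    (h : ∀ t : ℝ, 0 ≤ t → ∫ s, semigroup lam kap t f s ∂μ = ∫ s, f s ∂μ) :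
    ∫ s, gen lam kap f s ∂μ = 0 := by
  obtain ⟨B, hB⟩ := hf
  set a : ℕ → ℝ := fun j => ∫ s, ((gen lam kap)^[j] f) s ∂μ with ha
  set L := 2 * rate d n lam kap
  have hL : 0 ≤ L := mul_nonneg zero_le_two (rate_nonneg hl hk)
  have haB : ∀ j, |a j| ≤ L ^ j * B := fun j =>
    abs_integral_le_of_abs_le (abs_iterate_gen_le hl hk hB j)
  have hsum : Summable fun j : ℕ => L ^ j / j.factorial * B :=
    (Real.summable_pow_div_factorial L).mul_right B
  have hsum2 := (summable_nat_add_iff 2).2 hsum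
  set M := ∑' j : ℕ, L ^ (j + 2) / (j + 2).factorial * B
  -- Invariance cancels the term of order zero, so the linear term t·a₁ equals minus the rest of the
  -- series, which is at most t²·M for t ≤ 1. Dividing by t and letting t tend to 0 gives a₁ = 0.
  have key : ∀ t : ℝ, 0 < t → t ≤ 1 → |a 1| ≤ t * M := by
    intro t ht ht1
    have h1 := hasSum_integral_semigroup hl hk μ hB t
    rw [h t ht.le] at h1
    have h2 := (hasSum_nat_add_iff' 2).2 h1
    simp only [Finset.sum_range_succ, Finset.sum_range_zero] at h2
    have h3 : (∫ s, f s ∂μ) - (0 + t ^ 0 / ((Nat.factorial 0 : ℕ) : ℝ) *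
        ∫ s, ((gen lam kap)^[0] f) s ∂μ + t ^ 1 / ((Nat.factorial 1 : ℕ) : ℝ) *
        ∫ s, ((gen lam kap)^[1] f) s ∂μ) = -(t * a 1) := by
      simp [ha]
    rw [h3] at h2
    have h4 : ∀ j : ℕ, ‖t ^ (j + 2) / ((j + 2).factorial : ℝ) *
        ∫ s, ((gen lam kap)^[j + 2] f) s ∂μ‖ ≤
        t ^ 2 * (L ^ (j + 2) / (j + 2).factorial * B) := by
      intro j
      rw [Real.norm_eq_abs, abs_mul, abs_div, abs_pow, Nat.abs_cast, abs_of_pos ht]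
      have h5 : t ^ (j + 2) ≤ t ^ 2 := pow_le_pow_of_le_one ht.le ht1 (by omega)
      have h6 := haB (j + 2)
      calc t ^ (j + 2) / ((j + 2).factorial : ℝ) * |a (j + 2)|
          ≤ t ^ 2 / ((j + 2).factorial : ℝ) * (L ^ (j + 2) * B) := by gcongr
        _ = _ := by ring
    have h7 := tsum_of_norm_bounded (hsum2.hasSum.mul_left (t ^ 2)) h4
    rw [h2.tsum_eq, Real.norm_eq_abs, abs_neg, abs_mul, abs_of_pos ht] at h7
    have h8 : t * |a 1| ≤ t * (t * M) := by
      calc t * |a 1| ≤ t ^ 2 * M := h7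
        _ = _ := by ring
    exact le_of_mul_le_mul_left h8 ht
  have hlim : Filter.Tendsto (fun t : ℝ => t * M) (nhdsWithin 0 (Set.Ioi 0)) (nhds 0) := by
    have : Filter.Tendsto (fun t : ℝ => t * M) (nhds 0) (nhds (0 * M)) :=
      (continuous_id.mul continuous_const).tendsto 0
    rw [zero_mul] at this
    exact this.mono_left nhdsWithin_le_nhds
  have h0 : |a 1| ≤ 0 := by
    refine ge_of_tendsto hlim ?_
    filter_upwards [Ioo_mem_nhdsGT (zero_lt_one (α := ℝ))] with t ht
    exact key t ht.1 ht.2.le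
  have := abs_nonpos_iff.1 h0
  simpa [ha] using this

/-! ### The generator on events prescribing the graph and lower bounds on the queues -/

/-- The indicator of `j ≤ Q`, where `j` is a vector of lower bounds. -/
def ind (j Q : Fin n → ℕ) : ℝ := open Classical in if j ≤ Q then 1 else 0

theorem ind_nonneg (j Q : Fin n → ℕ) : 0 ≤ ind j Q := by unfold ind; split_ifs <;> norm_num

theorem ind_le_one (j Q : Fin n → ℕ) : ind j Q ≤ 1 := by unfold ind; split_ifs <;> norm_num

theorem ind_zero (Q : Fin n → ℕ) : ind 0 Q = 1 := by simp [ind]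

theorem ind_congr {j j' Q Q' : Fin n → ℕ} (h : j ≤ Q ↔ j' ≤ Q') : ind j Q = ind j' Q' := by
  unfold ind
  by_cases h1 : j ≤ Q
  · rw [if_pos h1, if_pos (h.1 h1)]
  · rw [if_neg h1, if_neg (fun h2 => h1 (h.2 h2))]

/-- A service at v destroys the event exactly when the bound at v is positive and attained with
equality. The change is thus a difference of two indicators of the same kind, which is what keeps
the hierarchy closed. -/
theorem ind_serve (j Q : Fin n → ℕ) (v : Fin n) :
    ind j (Function.update Q v (Q v - 1)) - ind j Q =
      if j v = 0 then 0 else ind (j + Pi.single v 1) Q - ind j Q := by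
  split_ifs with h0
  · rw [sub_eq_zero]
    refine ind_congr (forall_congr' fun u => ?_)
    by_cases hu : u = v
    · subst hu; simp [h0]
    · simp [Function.update_of_ne hu]
  · congr 1
    refine ind_congr (forall_congr' fun u => ?_)
    by_cases hu : u = v
    · subst hu; simp only [Function.update_self, Pi.add_apply, Pi.single_eq_same]; omega
    · simp [hu]

theorem ind_join_of_eq_zero {j : Fin n → ℕ} (Q : Fin n → ℕ) {w : Fin n} (h : j w = 0) :
    ind j (Function.update Q w (Q w + 1)) = ind j Q := by
  have : j ≤ Function.update Q w (Q w + 1) ↔ j ≤ Q := by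
    simp only [Pi.le_def]
    refine forall_congr' fun u => ?_
    by_cases hu : u = w
    · subst hu; simp [h]
    · simp [Function.update_of_ne hu]
  exact ind_congr this

theorem ind_mono (j : Fin n → ℕ) {Q Q' : Fin n → ℕ} (h : Q ≤ Q') : ind j Q ≤ ind j Q' := by
  unfold ind
  split_ifs with h1 h2
  · exact le_rfl
  · exact absurd (h1.trans h) h2
  · norm_num
  · norm_num

/-- One arrival can repair a deficit of at most one at w. Together with `arr_le` this is where the
tail bound loses one power of 8. -/
theorem ind_join_le (j Q : Fin n → ℕ) (w : Fin n) :
    ind j (Function.update Q w (Q w + 1)) ≤ ind (j - Pi.single w 1) Q := by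
  have h : j ≤ Function.update Q w (Q w + 1) → j - Pi.single w 1 ≤ Q := by
    intro h u
    have := h u
    by_cases hu : u = w
    · subst hu
      simp only [Function.update_self] at this
      simp only [Pi.sub_apply, Pi.single_eq_same]; omega
    · simp only [Function.update_of_ne hu] at this
      simp [hu, this]
  unfold ind
  split_ifs with h1 h2
  · exact le_rfl
  · exact absurd (h h1) h2
  · norm_num
  · norm_num

theorem le_update_succ (Q : Fin n → ℕ) (w : Fin n) : Q ≤ Function.update Q w (Q w + 1) := by
  intro u
  by_cases hu : u = w
  · subst hu; simp
  · simp [Function.update_of_ne hu]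

/-- The change of `ind j` caused by the arrivals that join the queue at `w`. -/
def arr (G : Fin d → EqualPartition n k) (j : Fin n → ℕ) (w : Fin n) (Q : Fin n → ℕ) : ℝ :=
  open Classical in
  ∑ v : Fin n, if w ∈ (State.mk G Q).shortest v then
    (((State.mk G Q).shortest v).card : ℝ)⁻¹ * (ind j (Function.update Q w (Q w + 1)) - ind j Q)
    else 0

theorem arr_of_eq_zero (G : Fin d → EqualPartition n k) {j : Fin n → ℕ} {w : Fin n}
    (h : j w = 0) (Q : Fin n → ℕ) : arr G j w Q = 0 := by
  simp [arr, ind_join_of_eq_zero Q h]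

theorem arr_nonneg (G : Fin d → EqualPartition n k) (j : Fin n → ℕ) (w : Fin n)
    (Q : Fin n → ℕ) : 0 ≤ arr G j w Q := by
  refine Finset.sum_nonneg fun v _ => ?_
  split_ifs
  · have := ind_mono j (le_update_succ Q w)
    exact mul_nonneg (by positivity) (by linarith)
  · exact le_rfl

theorem mem_nbhd_iff (s : State d k n) (v w : Fin n) :
    w ∈ s.nbhd v ↔ w = v ∨ ∃ i : Fin d, (s.graph i).rel v w := by
  simp [State.nbhd]

theorem mem_nbhd_comm (s : State d k n) (v w : Fin n) : w ∈ s.nbhd v ↔ v ∈ s.nbhd w := by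
  rw [mem_nbhd_iff, mem_nbhd_iff]
  constructor
  · rintro (h | ⟨i, h⟩)
    · exact Or.inl h.symm
    · exact Or.inr ⟨i, (s.graph i).rel.symm h⟩
  · rintro (h | ⟨i, h⟩)
    · exact Or.inl h.symm
    · exact Or.inr ⟨i, (s.graph i).rel.symm h⟩

theorem card_nbhd_le (s : State d k n) (v : Fin n) : (s.nbhd v).card ≤ 1 + d * k := by
  classical
  have hsub : s.nbhd v ⊆ {v} ∪ Finset.univ.biUnion fun i : Fin d =>
      Finset.univ.filter fun w => (s.graph i).rel v w := by
    intro w hw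
    rw [mem_nbhd_iff] at hw
    simpa using hw
  refine (Finset.card_le_card hsub).trans ((Finset.card_union_le _ _).trans ?_)
  rw [Finset.card_singleton]
  refine Nat.add_le_add_left ?_ 1
  refine Finset.card_biUnion_le.trans ?_
  have : ∀ i : Fin d, (Finset.univ.filter fun w => (s.graph i).rel v w).card = k := by
    intro i
    have := (s.graph i).card_class v
    rwa [Nat.card_eq_fintype_card, Fintype.card_subtype] at this
  simp [this]

/-- Only tasks arriving at neighbours of w can join w, each at most with probability one, and the
symmetry of the neighbourhood relation bounds their number by 1 + d·k. -/
theorem arr_le (G : Fin d → EqualPartition n k) (j : Fin n → ℕ) (w : Fin n) (Q : Fin n → ℕ) :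
    arr G j w Q ≤ (1 + d * k : ℕ) * ind (j - Pi.single w 1) Q := by
  classical
  have h1 : arr G j w Q ≤ ∑ v ∈ (State.mk G Q).nbhd w, ind (j - Pi.single w 1) Q := by
    have h2 : ∑ v ∈ (State.mk G Q).nbhd w, ind (j - Pi.single w 1) Q =
        ∑ v : Fin n, if v ∈ (State.mk G Q).nbhd w then ind (j - Pi.single w 1) Q else 0 := by
      rw [← Finset.sum_filter]
      congr 1
      ext v
      simp
    rw [h2]
    refine Finset.sum_le_sum fun v _ => ?_
    have h0 := ind_nonneg (j - Pi.single w 1) Q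
    by_cases hw : w ∈ (State.mk G Q).shortest v
    · have h3 : v ∈ (State.mk G Q).nbhd w := by
        rw [← mem_nbhd_comm]
        exact Finset.mem_of_mem_filter w hw
      rw [if_pos (by convert hw), if_pos h3]
      have h4 : ind j (Function.update Q w (Q w + 1)) - ind j Q ≤ ind (j - Pi.single w 1) Q := by
        linarith [ind_join_le j Q w, ind_nonneg j Q]
      have h5 : ((((State.mk G Q).shortest v).card : ℝ))⁻¹ ≤ 1 := by
        apply inv_le_one_of_one_le₀
        exact_mod_cast Finset.card_pos.2 ⟨w, hw⟩
      have h6 := ind_mono j (le_update_succ Q w)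
      calc _ ≤ 1 * (ind j (Function.update Q w (Q w + 1)) - ind j Q) :=
            mul_le_mul_of_nonneg_right h5 (by linarith)
        _ ≤ _ := by linarith
    · rw [if_neg (by convert hw)]
      split_ifs
      · exact h0
      · exact le_rfl
  refine h1.trans ?_
  rw [Finset.sum_const, nsmul_eq_mul]
  exact mul_le_mul_of_nonneg_right (by exact_mod_cast card_nbhd_le _ _) (ind_nonneg _ _)

theorem sum_arr (s : State d k n) (j : Fin n → ℕ) :
    ∑ v : Fin n, ((s.shortest v).card : ℝ)⁻¹ *
        ∑ w ∈ s.shortest v, (ind j (s.join w).queue - ind j s.queue) =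
      ∑ w : Fin n, arr s.graph j w s.queue := by
  classical
  unfold arr
  rw [Finset.sum_comm]
  refine Finset.sum_congr rfl fun v _ => ?_
  rw [Finset.mul_sum, ← Finset.sum_filter]
  refine Finset.sum_congr ?_ fun w _ => rfl
  ext w
  simp

/-- The configuration of partitions after a swap of label `i`. -/
def moveGraph (G : Fin d → EqualPartition n k) (i : Fin d) (v w : Fin n) :
    Fin d → EqualPartition n k :=
  Function.update G i ((G i).swap v w)

theorem EqualPartition.swap_swap (P : EqualPartition n k) (v w : Fin n) :
    (P.swap v w).swap v w = P := by
  refine EqualPartition.ext_rel (Setoid.ext fun a b => ?_)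
  show P.rel (Equiv.swap v w (Equiv.swap v w a)) (Equiv.swap v w (Equiv.swap v w b)) ↔ _
  rw [Equiv.swap_apply_self, Equiv.swap_apply_self]

theorem moveGraph_moveGraph (G : Fin d → EqualPartition n k) (i : Fin d) (v w : Fin n) :
    moveGraph (moveGraph G i v w) i v w = G := by
  unfold moveGraph
  rw [Function.update_self, EqualPartition.swap_swap, Function.update_idem,
    Function.update_eq_self]

/-- Swaps are involutions, so being at G after a swap means being at the swapped G before it. Hence
the generator sends indicators of partitions to combinations of such indicators. -/
theorem moveGraph_eq_iff (G G' : Fin d → EqualPartition n k) (i : Fin d) (v w : Fin n) :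
    moveGraph G i v w = G' ↔ G = moveGraph G' i v w := by
  constructor
  · rintro rfl; exact (moveGraph_moveGraph _ _ _ _).symm
  · rintro rfl; exact moveGraph_moveGraph _ _ _ _

/-- The indicator of the event that the partitions are `G` and the queues are at least `j`. -/
def gInd (G : Fin d → EqualPartition n k) (j : Fin n → ℕ) (s : State d k n) : ℝ :=
  open Classical in if s.graph = G then ind j s.queue else 0

theorem gInd_nonneg (G : Fin d → EqualPartition n k) (j : Fin n → ℕ) (s : State d k n) :
    0 ≤ gInd G j s := by
  unfold gInd; split_ifs
  · exact ind_nonneg _ _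
  · exact le_rfl

theorem gInd_le_one (G : Fin d → EqualPartition n k) (j : Fin n → ℕ) (s : State d k n) :
    gInd G j s ≤ 1 := by
  unfold gInd; split_ifs
  · exact ind_le_one _ _
  · norm_num

/-- The indicator of the event that the partitions are `G`, times the total effect of arrivals
at `w`. -/
def gArr (G : Fin d → EqualPartition n k) (j : Fin n → ℕ) (w : Fin n) (s : State d k n) : ℝ :=
  open Classical in if s.graph = G then arr G j w s.queue else 0

/-- Services and arrivals contribute only at vertices with a positive bound. Their number depends on
j and not on n. -/
theorem gen_gInd (lam kap : ℝ) (G : Fin d → EqualPartition n k) (j : Fin n → ℕ)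
    (s : State d k n) :
    gen lam kap (gInd G j) s =
      ∑ v ∈ Finset.univ.filter (fun v => j v ≠ 0), (gInd G (j + Pi.single v 1) s - gInd G j s)
      + lam * ∑ w ∈ Finset.univ.filter (fun v => j v ≠ 0), gArr G j w s
      + kap * ∑ v : Fin n, ∑ i : Fin d, (n : ℝ)⁻¹ * ∑ w : Fin n,
          (gInd (moveGraph G i v w) j s - gInd G j s) := by
  classical
  have hm : ∀ i v w, gInd G j (s.move i v w) = gInd (moveGraph G i v w) j s := by
    intro i v w
    have h : (s.move i v w).graph = G ↔ s.graph = moveGraph G i v w :=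
      moveGraph_eq_iff s.graph G i v w
    unfold gInd
    simp only [h]
    rfl
  unfold gen
  simp only [hm]
  congr 1
  · congr 1
    · rw [Finset.sum_filter]
      refine Finset.sum_congr rfl fun v _ => ?_
      unfold gInd
      have h1 := ind_serve j s.queue v
      by_cases hG : s.graph = G
      · have hG' : (s.serve v).graph = G := hG
        simp only [hG, hG', if_true]
        refine (show _ = _ from h1).trans ?_
        by_cases h : j v = 0 <;> simp [h]
      · have hG' : ¬ (s.serve v).graph = G := hG
        simp [hG, hG']
    · rw [← Finset.mul_sum]
      congr 1
      by_cases hG : s.graph = G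
      · have h1 : ∀ w, gInd G j (s.join w) = ind j (s.join w).queue := fun w => if_pos hG
        have h2 : gInd G j s = ind j s.queue := if_pos hG
        have h3 : ∀ w, gArr G j w s = arr s.graph j w s.queue := fun w => by
          unfold gArr; rw [if_pos hG, hG]
        simp only [h1, h2, h3]
        rw [sum_arr, Finset.sum_filter]
        refine Finset.sum_congr rfl fun w _ => ?_
        split_ifs with hw
        · rfl
        · exact arr_of_eq_zero _ (not_not.1 hw) _
      · have h1 : ∀ w, gInd G j (s.join w) = 0 := fun w => if_neg hG
        have h2 : gInd G j s = 0 := if_neg hG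
        have h3 : ∀ w, gArr G j w s = 0 := fun w => if_neg hG
        simp [h1, h2, h3]
  · simp only [Finset.mul_sum]

theorem gArr_le (G : Fin d → EqualPartition n k) (j : Fin n → ℕ) (w : Fin n) (s : State d k n) :
    gArr G j w s ≤ (1 + d * k : ℕ) * gInd G (j - Pi.single w 1) s := by
  unfold gArr gInd
  split_ifs
  · exact arr_le _ _ _ _
  · simp

/-! ### Relabelling the vertices -/

/-- The partition in which `v` takes the place of `σ v`. -/
def EqualPartition.relabel (P : EqualPartition n k) (σ : Equiv.Perm (Fin n)) :
    EqualPartition n k where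
  rel := Setoid.comap σ P.rel
  card_class := fun u =>
    (Nat.card_congr (σ.subtypeEquiv fun _ => Iff.rfl)).trans (P.card_class (σ u))

/-- The state in which `v` takes the place of `σ v`. -/
def State.relabel (σ : Equiv.Perm (Fin n)) (s : State d k n) : State d k n where
  graph := fun i => (s.graph i).relabel σ
  queue := s.queue ∘ σ

theorem relabel_serve (σ : Equiv.Perm (Fin n)) (s : State d k n) (v : Fin n) :
    (s.relabel σ).serve v = (s.serve (σ v)).relabel σ := by
  refine State.ext rfl ?_
  funext u
  show Function.update (s.queue ∘ σ) v (s.queue (σ v) - 1) u = _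
  rw [← Function.update_comp_eq_of_injective _ σ.injective]
  rfl

theorem relabel_join (σ : Equiv.Perm (Fin n)) (s : State d k n) (v : Fin n) :
    (s.relabel σ).join v = (s.join (σ v)).relabel σ := by
  refine State.ext rfl ?_
  funext u
  show Function.update (s.queue ∘ σ) v (s.queue (σ v) + 1) u = _
  rw [← Function.update_comp_eq_of_injective _ σ.injective]
  rfl

theorem EqualPartition.relabel_swap (σ : Equiv.Perm (Fin n)) (P : EqualPartition n k)
    (v w : Fin n) : (P.relabel σ).swap v w = (P.swap (σ v) (σ w)).relabel σ := by
  refine EqualPartition.ext_rel (Setoid.ext fun a b => ?_)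
  show P.rel (σ (Equiv.swap v w a)) (σ (Equiv.swap v w b)) ↔
    P.rel (Equiv.swap (σ v) (σ w) (σ a)) (Equiv.swap (σ v) (σ w) (σ b))
  rw [σ.injective.map_swap, σ.injective.map_swap]

theorem relabel_move (σ : Equiv.Perm (Fin n)) (s : State d k n) (i : Fin d) (v w : Fin n) :
    (s.relabel σ).move i v w = (s.move i (σ v) (σ w)).relabel σ := by
  refine State.ext ?_ rfl
  funext i'
  show Function.update (s.relabel σ).graph i (((s.relabel σ).graph i).swap v w) i' =
    (Function.update s.graph i ((s.graph i).swap (σ v) (σ w)) i').relabel σ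
  by_cases h : i' = i
  · subst h
    rw [Function.update_self, Function.update_self]
    exact EqualPartition.relabel_swap _ _ _ _
  · rw [Function.update_of_ne h, Function.update_of_ne h]; rfl

theorem mem_nbhd_relabel (σ : Equiv.Perm (Fin n)) (s : State d k n) (v w : Fin n) :
    w ∈ (s.relabel σ).nbhd v ↔ σ w ∈ s.nbhd (σ v) := by
  rw [mem_nbhd_iff, mem_nbhd_iff, σ.injective.eq_iff]
  rfl

theorem mem_shortest_iff (s : State d k n) (v w : Fin n) :
    w ∈ s.shortest v ↔ w ∈ s.nbhd v ∧ ∀ u ∈ s.nbhd v, s.queue w ≤ s.queue u := by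
  simp [State.shortest]

theorem mem_shortest_relabel (σ : Equiv.Perm (Fin n)) (s : State d k n) (v w : Fin n) :
    w ∈ (s.relabel σ).shortest v ↔ σ w ∈ s.shortest (σ v) := by
  rw [mem_shortest_iff, mem_shortest_iff, mem_nbhd_relabel]
  refine and_congr_right fun _ => ?_
  rw [← σ.forall_congr_right (q := fun u => u ∈ s.nbhd (σ v) → s.queue (σ w) ≤ s.queue u)]
  refine forall_congr' fun u => ?_
  rw [mem_nbhd_relabel]
  rfl

theorem shortest_relabel (σ : Equiv.Perm (Fin n)) (s : State d k n) (v : Fin n) :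
    s.shortest (σ v) = ((s.relabel σ).shortest v).map σ.toEmbedding := by
  ext w
  obtain ⟨w, rfl⟩ := σ.surjective w
  simp [mem_shortest_relabel]

/-- The dynamics do not see the names of the vertices. This keeps the Cesàro means exchangeable when
started from an exchangeable law. -/
theorem gen_relabel (lam kap : ℝ) (f : State d k n → ℝ) (σ : Equiv.Perm (Fin n))
    (s : State d k n) :
    gen lam kap (fun s => f (s.relabel σ)) s = gen lam kap f (s.relabel σ) := by
  unfold gen
  simp only [relabel_serve, relabel_join, relabel_move]
  refine congrArg₂ _ (congrArg₂ _ ?_ ?_) ?_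
  · exact (Equiv.sum_comp σ fun v => f ((s.serve v).relabel σ) - f (s.relabel σ)).symm
  · rw [← Equiv.sum_comp σ]
    refine Finset.sum_congr rfl fun v _ => ?_
    rw [shortest_relabel, Finset.card_map, Finset.sum_map]
    rfl
  · rw [← Equiv.sum_comp σ]
    refine Finset.sum_congr rfl fun v _ => Finset.sum_congr rfl fun i _ => ?_
    rw [← Equiv.sum_comp σ]

/-! ### Existence of a stationary law with geometric tails -/

/-- The generator as a linear map. -/
def genL (lam kap : ℝ) : (State d k n → ℝ) →ₗ[ℝ] (State d k n → ℝ) where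
  toFun f := gen lam kap f
  map_add' f g := funext fun s => gen_add lam kap f g s
  map_smul' c f := funext fun s => gen_smul lam kap c f s

/-- One step of the uniformized chain. -/
def stepL (lam kap : ℝ) : (State d k n → ℝ) →ₗ[ℝ] (State d k n → ℝ) :=
  LinearMap.id + (rate d n lam kap + 1)⁻¹ • genL lam kap

theorem stepL_apply (lam kap : ℝ) (f : State d k n → ℝ) :
    stepL lam kap f = f + (rate d n lam kap + 1)⁻¹ • genL lam kap f := rfl

/-- The step divides by more than the total jump rate, so a positive share of f(s) always stays in
place. The extra 1 also keeps the denominator nonzero when n = 0. -/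
theorem stepL_nonneg {lam kap : ℝ} (hl : 0 ≤ lam) (hk : 0 ≤ kap) {f : State d k n → ℝ}
    (hf : ∀ s, 0 ≤ f s) (s : State d k n) : 0 ≤ stepL lam kap f s := by
  have h := neg_rate_mul_le_gen hl hk hf s
  have hr := rate_nonneg (d := d) (n := n) hl hk
  show 0 ≤ f s + (rate d n lam kap + 1)⁻¹ * gen lam kap f s
  have h1 : -f s ≤ (rate d n lam kap + 1)⁻¹ * gen lam kap f s := by
    rw [inv_mul_eq_div, le_div_iff₀ (by linarith)]
    nlinarith [hf s]
  linarith

/-- A mean (positive normalized functional) on functions of the state, symmetric under relabelling,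
with uniform law of the partitions and geometric tails of the queues. -/
structure IsGoodMean (φ : (State d k n → ℝ) →ₗ[ℝ] ℝ) : Prop where
  nonneg : ∀ f : State d k n → ℝ, (∀ s, 0 ≤ f s) → 0 ≤ φ f
  one : φ (fun _ => 1) = 1
  tail : ∀ G j, φ (gInd G j) ≤
    (1 / 8) ^ (∑ v, j v) / Fintype.card (Fin d → EqualPartition n k)
  uniform : ∀ G, φ (gInd G 0) = 1 / Fintype.card (Fin d → EqualPartition n k)
  relabel : ∀ (σ : Equiv.Perm (Fin n)) (f : State d k n → ℝ),
    φ (fun s => f (s.relabel σ)) = φ f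

theorem IsGoodMean.mono {φ : (State d k n → ℝ) →ₗ[ℝ] ℝ} (h : IsGoodMean φ)
    {f g : State d k n → ℝ} (hfg : ∀ s, f s ≤ g s) : φ f ≤ φ g := by
  have := h.nonneg (g - f) (fun s => by simpa using hfg s)
  rw [map_sub] at this
  linarith

theorem sum_sub_single {j : Fin n → ℕ} {w : Fin n} (h : j w ≠ 0) :
    ∑ v, j v = ∑ v, (j - Pi.single w 1 : Fin n → ℕ) v + 1 := by
  have h1 : j = (j - Pi.single w 1) + Pi.single w 1 := by
    funext u
    by_cases hu : u = w
    · subst hu; simp only [Pi.add_apply, Pi.sub_apply, Pi.single_eq_same]; omega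
    · simp [hu]
  conv_lhs => rw [h1]
  simp only [Pi.add_apply, Finset.sum_add_distrib, Finset.sum_pi_single', Finset.mem_univ,
    if_true]

theorem sum_add_single (j : Fin n → ℕ) (w : Fin n) :
    ∑ v, (j + Pi.single w 1 : Fin n → ℕ) v = ∑ v, j v + 1 := by
  simp [Finset.sum_add_distrib]

/-- Let M be the claimed bound for (G, j), and suppose all events obey their bounds. At each vertex
with a positive bound, a service event has probability at most M/8, and arrivals contribute at most
`lam`·(1 + d·k)·8·M ≤ 7M/8. Swaps bring in probabilities bounded by the same M, because the bound is
the same for all partitions. So the drift of the probability is at most the jump rate times its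
distance to M, and one step cannot overshoot. -/
theorem IsGoodMean.comp_stepL {lam kap : ℝ} (hl : 0 ≤ lam) (hk : 0 ≤ kap)
    (hsmall : lam * (1 + d * k : ℕ) * 8 ≤ 7 / 8)
    {φ : (State d k n → ℝ) →ₗ[ℝ] ℝ} (h : IsGoodMean φ) :
    IsGoodMean (φ ∘ₗ stepL lam kap) := by
  have hr := rate_nonneg (d := d) (n := n) hl hk
  have hr1 : 0 < (rate d n lam kap + 1)⁻¹ := by positivity
  set e := (rate d n lam kap + 1)⁻¹ with he
  have happ : ∀ f, (φ ∘ₗ stepL lam kap) f = φ f + e * φ (genL lam kap f) := by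
    intro f
    rw [LinearMap.comp_apply, stepL_apply, map_add, map_smul, smul_eq_mul]
  refine ⟨fun f hf => h.nonneg _ (stepL_nonneg hl hk hf), ?_, ?_, ?_, ?_⟩
  · rw [happ, h.one]
    have : genL lam kap (fun _ : State d k n => (1 : ℝ)) = 0 := funext fun s => gen_const lam kap 1 s
    rw [this, map_zero, mul_zero, add_zero]
  · intro G j
    set N : ℝ := (Fintype.card (Fin d → EqualPartition n k) : ℝ) with hN
    have hNp : 0 ≤ N := Nat.cast_nonneg _
    set S := Finset.univ.filter (fun v => j v ≠ 0) with hS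
    set M := (1 / 8 : ℝ) ^ (∑ v, j v) / N with hM
    have hM0 : 0 ≤ M := by positivity
    rw [happ]
    have h1 : φ (genL lam kap (gInd G j)) ≤
        ∑ v ∈ S, (φ (gInd G (j + Pi.single v 1)) - φ (gInd G j))
        + lam * ∑ w ∈ S, (1 + d * k : ℕ) * φ (gInd G (j - Pi.single w 1))
        + kap * ∑ v : Fin n, ∑ i : Fin d, (n : ℝ)⁻¹ * ∑ w : Fin n,
          (φ (gInd (moveGraph G i v w) j) - φ (gInd G j)) := by
      have : ∀ s, genL lam kap (gInd G j) s ≤ (∑ v ∈ S, (gInd G (j + Pi.single v 1) - gInd G j)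
        + lam • ∑ w ∈ S, ((1 + d * k : ℕ) : ℝ) • gInd G (j - Pi.single w 1)
        + kap • ∑ v : Fin n, ∑ i : Fin d, (n : ℝ)⁻¹ • ∑ w : Fin n,
          (gInd (moveGraph G i v w) j - gInd G j)) s := by
        intro s
        show gen lam kap (gInd G j) s ≤ _
        rw [gen_gInd]
        simp only [Pi.add_apply, Finset.sum_apply, Pi.sub_apply, Pi.smul_apply, smul_eq_mul]
        have := Finset.sum_le_sum fun w (_ : w ∈ S) => gArr_le G j w s
        have := mul_le_mul_of_nonneg_left this hl
        linarith
      refine (h.mono this).trans_eq ?_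
      simp only [map_add, map_sum, map_smul, map_sub, smul_eq_mul]
    have h2 : φ (genL lam kap (gInd G j)) ≤
        ∑ _v ∈ S, (M / 8 - φ (gInd G j)) + lam * ∑ _w ∈ S, (1 + d * k : ℕ) * (8 * M)
        + kap * ∑ _v : Fin n, ∑ _i : Fin d, (n : ℝ)⁻¹ * ∑ _w : Fin n,
          (M - φ (gInd G j)) := by
      refine h1.trans ?_
      have hn : (0 : ℝ) ≤ (n : ℝ)⁻¹ := by positivity
      gcongr with v hv w hw v _ i _ w _
      · refine (h.tail G _).trans_eq ?_
        rw [sum_add_single, hM]; ring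
      · refine (h.tail G _).trans_eq ?_
        have hw' : j w ≠ 0 := by simpa [hS] using hw
        rw [hM, sum_sub_single hw']; ring
      · exact h.tail _ _
    have h3 : kap * ∑ _v : Fin n, ∑ _i : Fin d, (n : ℝ)⁻¹ * ∑ _w : Fin n,
          (M - φ (gInd G j)) = kap * (d * n) * (M - φ (gInd G j)) := by
      rcases Nat.eq_zero_or_pos n with h0 | h0
      · subst h0; simp
      · have : (n : ℝ) ≠ 0 := by positivity
        simp only [Finset.sum_const, Finset.card_univ, Fintype.card_fin, nsmul_eq_mul]
        field_simp
    rw [h3] at h2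
    simp only [Finset.sum_const, nsmul_eq_mul] at h2
    have hSn : (S.card : ℝ) ≤ n := by
      have := Finset.card_le_univ S
      rw [Fintype.card_fin] at this
      exact_mod_cast this
    have hb : φ (gInd G j) ≤ M := h.tail G j
    -- The two inflows M/8 and 7M/8 add up to M at each vertex of S; this fixes the constant in
    -- `hsmall`.
    have h4 : (S.card : ℝ) * (M / 8 - φ (gInd G j)) +
        lam * (S.card * ((1 + d * k : ℕ) * (8 * M))) ≤ S.card * (M - φ (gInd G j)) := by
      have : (S.card * M) * (lam * (1 + d * k : ℕ) * 8) ≤ (S.card * M) * (7 / 8) :=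
        mul_le_mul_of_nonneg_left hsmall (by positivity)
      nlinarith
    have h5 : φ (genL lam kap (gInd G j)) ≤ (rate d n lam kap + 1) * (M - φ (gInd G j)) := by
      have h6 : (S.card + kap * (d * n)) * (M - φ (gInd G j)) ≤
          (rate d n lam kap + 1) * (M - φ (gInd G j)) := by
        refine mul_le_mul_of_nonneg_right ?_ (by linarith)
        unfold rate
        have : 0 ≤ lam * n := by positivity
        linarith
      nlinarith
    have h6 := mul_le_mul_of_nonneg_left h5 hr1.le
    rw [← mul_assoc, he, inv_mul_cancel₀ (by positivity), one_mul] at h6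
    linarith
  · intro G
    rw [happ]
    have : genL lam kap (gInd G 0) = kap • ∑ v : Fin n, ∑ i : Fin d, (n : ℝ)⁻¹ • ∑ w : Fin n,
          (gInd (moveGraph G i v w) 0 - gInd G 0) := by
      funext s
      show gen lam kap (gInd G 0) s = _
      rw [gen_gInd]
      simp only [Pi.zero_apply, ne_eq, not_true_eq_false, Finset.filter_false, Finset.sum_empty,
        mul_zero, zero_add, Pi.smul_apply, Finset.sum_apply, smul_eq_mul, Pi.sub_apply]
    rw [this]
    -- All partitions have equal mass, so each swap exchanges equal masses.
    have h0 : φ (∑ v : Fin n, ∑ i : Fin d, (n : ℝ)⁻¹ • ∑ w : Fin n,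
          (gInd (moveGraph G i v w) 0 - gInd G 0)) = 0 := by
      simp only [map_sum, map_smul, map_sub, h.uniform, sub_self, Finset.sum_const_zero,
        smul_zero]
    rw [map_smul, h0, smul_zero, mul_zero, add_zero, h.uniform]
  · intro σ f
    rw [happ, happ, h.relabel σ f]
    have : genL lam kap (fun s : State d k n => f (s.relabel σ)) =
        fun s => genL lam kap f (s.relabel σ) := funext fun s => gen_relabel lam kap f σ s
    rw [this, h.relabel σ]

/-- The mean over the states with empty queues and uniform partitions. -/
def emptyMean (d k n : ℕ) : (State d k n → ℝ) →ₗ[ℝ] ℝ where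
  toFun f := (∑ G : Fin d → EqualPartition n k, f ⟨G, 0⟩) /
    Fintype.card (Fin d → EqualPartition n k)
  map_add' f g := by simp [Finset.sum_add_distrib, add_div]
  map_smul' c f := by simp [← Finset.mul_sum, mul_div_assoc]

theorem emptyMean_apply (f : State d k n → ℝ) :
    emptyMean d k n f = (∑ G : Fin d → EqualPartition n k, f ⟨G, 0⟩) /
    Fintype.card (Fin d → EqualPartition n k) := rfl

/-- Relabelling of a partition as a permutation of the set of partitions. -/
def EqualPartition.relabelEquiv (σ : Equiv.Perm (Fin n)) :
    EqualPartition n k ≃ EqualPartition n k where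
  toFun P := P.relabel σ
  invFun P := P.relabel σ⁻¹
  left_inv P := EqualPartition.ext_rel (Setoid.ext fun a b => by
    show P.rel (σ (σ⁻¹ a)) (σ (σ⁻¹ b)) ↔ _
    simp)
  right_inv P := EqualPartition.ext_rel (Setoid.ext fun a b => by
    show P.rel (σ⁻¹ (σ a)) (σ⁻¹ (σ b)) ↔ _
    simp)

theorem isGoodMean_emptyMean [Nonempty (EqualPartition n k)] :
    IsGoodMean (emptyMean d k n) := by
  classical
  have hc : (Fintype.card (Fin d → EqualPartition n k) : ℝ) ≠ 0 := by
    exact_mod_cast Fintype.card_ne_zero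
  have hg : ∀ (G : Fin d → EqualPartition n k) (j : Fin n → ℕ),
      ∑ G' : Fin d → EqualPartition n k, gInd G j ⟨G', 0⟩ = ind j 0 := by
    intro G j
    unfold gInd
    rw [Finset.sum_eq_single G]
    · simp
    · intro G' _ h; exact if_neg h
    · simp
  refine ⟨?_, ?_, ?_, ?_, ?_⟩
  · intro f hf
    exact div_nonneg (Finset.sum_nonneg fun G _ => hf _) (Nat.cast_nonneg _)
  · rw [emptyMean_apply]
    simp only [Finset.sum_const, Finset.card_univ, nsmul_eq_mul, mul_one]
    exact div_self hc
  · intro G j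
    rw [emptyMean_apply, hg]
    gcongr
    by_cases h : j = 0
    · subst h; simp [ind]
    · have : ¬ j ≤ 0 := fun h' => h (le_antisymm h' (fun _ => Nat.zero_le _))
      rw [ind, if_neg this]
      positivity
  · intro G
    rw [emptyMean_apply, hg, ind_zero]
  · intro σ f
    rw [emptyMean_apply, emptyMean_apply]
    congr 1
    exact Equiv.sum_comp (Equiv.piCongrRight fun _ : Fin d =>
      EqualPartition.relabelEquiv (k := k) σ) fun G => f ⟨G, 0⟩

/-- The law of the uniformized chain after `m` steps. -/
def stepMean (d k n : ℕ) (lam kap : ℝ) : ℕ → ((State d k n → ℝ) →ₗ[ℝ] ℝ)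
  | 0 => emptyMean d k n
  | m + 1 => stepMean d k n lam kap m ∘ₗ stepL lam kap

theorem isGoodMean_stepMean [Nonempty (EqualPartition n k)] {lam kap : ℝ} (hl : 0 ≤ lam)
    (hk : 0 ≤ kap) (hsmall : lam * (1 + d * k : ℕ) * 8 ≤ 7 / 8) (m : ℕ) :
    IsGoodMean (stepMean d k n lam kap m) := by
  induction m with
  | zero => exact isGoodMean_emptyMean
  | succ m ih => exact ih.comp_stepL hl hk hsmall

/-- Cesàro means of the laws of the uniformized chain. -/
def cesaroMean (d k n : ℕ) (lam kap : ℝ) (N : ℕ) : (State d k n → ℝ) →ₗ[ℝ] ℝ :=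
  ((N + 1 : ℕ) : ℝ)⁻¹ • ∑ m ∈ Finset.range (N + 1), stepMean d k n lam kap m

theorem cesaroMean_apply (lam kap : ℝ) (N : ℕ) (f : State d k n → ℝ) :
    cesaroMean d k n lam kap N f =
      ((N + 1 : ℕ) : ℝ)⁻¹ * ∑ m ∈ Finset.range (N + 1), stepMean d k n lam kap m f := by
  simp [cesaroMean]

theorem isGoodMean_cesaroMean [Nonempty (EqualPartition n k)] {lam kap : ℝ} (hl : 0 ≤ lam)
    (hk : 0 ≤ kap) (hsmall : lam * (1 + d * k : ℕ) * 8 ≤ 7 / 8) (N : ℕ) :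
    IsGoodMean (cesaroMean d k n lam kap N) := by
  have h := isGoodMean_stepMean (d := d) (k := k) (n := n) hl hk hsmall
  have hN : ((N + 1 : ℕ) : ℝ) ≠ 0 := by positivity
  have hc : ∀ x : ℝ, ((N + 1 : ℕ) : ℝ)⁻¹ * ∑ _m ∈ Finset.range (N + 1), x = x := by
    intro x
    rw [Finset.sum_const, Finset.card_range, nsmul_eq_mul, ← mul_assoc, inv_mul_cancel₀ hN,
      one_mul]
  refine ⟨?_, ?_, ?_, ?_, ?_⟩
  · intro f hf
    rw [cesaroMean_apply]
    exact mul_nonneg (by positivity) (Finset.sum_nonneg fun m _ => (h m).nonneg f hf)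
  · rw [cesaroMean_apply]
    simp only [(h _).one, hc]
  · intro G j
    rw [cesaroMean_apply]
    refine le_trans ?_ (hc _).le
    gcongr with m _
    exact (h m).tail G j
  · intro G
    rw [cesaroMean_apply]
    simp only [(h _).uniform, hc]
  · intro σ f
    rw [cesaroMean_apply, cesaroMean_apply]
    simp only [(h _).relabel σ f]

theorem IsGoodMean.abs_le {φ : (State d k n → ℝ) →ₗ[ℝ] ℝ} (h : IsGoodMean φ)
    {f : State d k n → ℝ} {B : ℝ} (hf : ∀ s, |f s| ≤ B) : |φ f| ≤ B := by
  have hB : φ (fun _ => B) = B := by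
    have : (fun _ : State d k n => B) = B • fun _ => (1 : ℝ) := by funext; simp
    rw [this, map_smul, h.one, smul_eq_mul, mul_one]
  rw [_root_.abs_le]
  constructor
  · have := h.mono (f := -fun _ => B) (g := f) (fun s => by
      simpa using (_root_.abs_le.1 (hf s)).1)
    rw [map_neg, hB] at this
    exact this
  · have := h.mono (f := f) (g := fun _ => B) (fun s => (_root_.abs_le.1 (hf s)).2)
    rwa [hB] at this

/-- The generator is a multiple of (step minus identity), so its sum along the chain telescopes and
only the two ends remain. -/
theorem abs_cesaroMean_genL_le [Nonempty (EqualPartition n k)] {lam kap : ℝ} (hl : 0 ≤ lam)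
    (hk : 0 ≤ kap) (hsmall : lam * (1 + d * k : ℕ) * 8 ≤ 7 / 8) (N : ℕ)
    {f : State d k n → ℝ} {B : ℝ} (hf : ∀ s, |f s| ≤ B) :
    |cesaroMean d k n lam kap N (genL lam kap f)| ≤
      ((N + 1 : ℕ) : ℝ)⁻¹ * ((rate d n lam kap + 1) * (2 * B)) := by
  have hr := rate_nonneg (d := d) (n := n) hl hk
  have hr1 : rate d n lam kap + 1 ≠ 0 := by positivity
  have h1 : ∀ m, stepMean d k n lam kap m (genL lam kap f) = (rate d n lam kap + 1) *
      (stepMean d k n lam kap (m + 1) f - stepMean d k n lam kap m f) := by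
    intro m
    show _ = (rate d n lam kap + 1) *
      (stepMean d k n lam kap m (stepL lam kap f) - stepMean d k n lam kap m f)
    rw [stepL_apply, map_add, map_smul, smul_eq_mul]
    field_simp
    ring
  have hg := isGoodMean_stepMean (d := d) (k := k) (n := n) hl hk hsmall
  rw [cesaroMean_apply]
  simp only [h1]
  rw [← Finset.mul_sum, Finset.sum_range_sub (fun m => stepMean d k n lam kap m f), abs_mul, abs_mul, abs_of_nonneg
    (show (0 : ℝ) ≤ ((N + 1 : ℕ) : ℝ)⁻¹ by positivity), abs_of_nonneg
    (show 0 ≤ rate d n lam kap + 1 by positivity)]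
  gcongr
  refine (abs_sub _ _).trans ?_
  linarith [(hg (N + 1)).abs_le hf, (hg 0).abs_le hf]

/-- A limit point of the Cesàro means. -/
def limMean (d k n : ℕ) (lam kap : ℝ) (f : State d k n → ℝ) : ℝ :=
  Filter.limUnder (Filter.hyperfilter ℕ : Filter ℕ) fun N => cesaroMean d k n lam kap N f

/-! ### Passage to the limit of the Cesàro means, and countable additivity. -/

section LimMean

variable [Nonempty (EqualPartition n k)] {lam kap : ℝ} (hl : 0 ≤ lam) (hk : 0 ≤ kap)
  (hsmall : lam * (1 + d * k : ℕ) * 8 ≤ 7 / 8)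

include hl hk hsmall

/-- The values lie in a compact interval and the hyperfilter is an ultrafilter, so the limit exists
for all bounded functions at once, without choosing subsequences. -/
theorem tendsto_limMean {f : State d k n → ℝ} {B : ℝ} (hf : ∀ s, |f s| ≤ B) :
    Filter.Tendsto (fun N => cesaroMean d k n lam kap N f) (Filter.hyperfilter ℕ : Filter ℕ)
      (nhds (limMean d k n lam kap f)) := by
  have hb : ∀ N, cesaroMean d k n lam kap N f ∈ Set.Icc (-B) B := fun N =>
    _root_.abs_le.1 ((isGoodMean_cesaroMean hl hk hsmall N).abs_le hf)
  obtain ⟨x, -, hx⟩ := (isCompact_Icc (a := -B) (b := B)).ultrafilter_le_nhds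
    ((Filter.hyperfilter ℕ).map fun N => cesaroMean d k n lam kap N f)
    (by
      rw [Filter.le_principal_iff]
      exact Filter.mem_map.2 (Filter.univ_mem' hb))
  exact tendsto_nhds_limUnder ⟨x, hx⟩

theorem limMean_le {f : State d k n → ℝ} {B c : ℝ} (hf : ∀ s, |f s| ≤ B)
    (h : ∀ N, cesaroMean d k n lam kap N f ≤ c) : limMean d k n lam kap f ≤ c :=
  le_of_tendsto' (tendsto_limMean hl hk hsmall hf) h

theorem limMean_eq {f : State d k n → ℝ} {c : ℝ} {B : ℝ} (hf : ∀ s, |f s| ≤ B)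
    (h : ∀ N, cesaroMean d k n lam kap N f = c) : limMean d k n lam kap f = c := by
  refine tendsto_nhds_unique (tendsto_limMean hl hk hsmall hf) ?_
  simp only [h]
  exact tendsto_const_nhds

theorem limMean_genL {f : State d k n → ℝ} {B : ℝ} (hf : ∀ s, |f s| ≤ B) :
    limMean d k n lam kap (genL lam kap f) = 0 := by
  have h1 := tendsto_limMean hl hk hsmall (abs_gen_le hl hk hf)
  refine tendsto_nhds_unique h1 ?_
  refine Filter.Tendsto.mono_left ?_ Nat.hyperfilter_le_atTop
  refine squeeze_zero_norm (abs_cesaroMean_genL_le hl hk hsmall · hf) ?_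
  have h2 : Filter.Tendsto (fun N : ℕ => (N : ℝ)⁻¹) Filter.atTop (nhds 0) :=
    tendsto_inv_atTop_nhds_zero_nat
  have h3 := ((Filter.tendsto_add_atTop_iff_nat 1).2 h2).mul_const
    ((rate d n lam kap + 1) * (2 * B))
  simpa using h3

/-- The event that some queue has length at least `J`. -/
theorem cesaroMean_tail_le (J N : ℕ) {f : State d k n → ℝ}
    (hf : ∀ s, f s ≤ 1) (hf' : ∀ s : State d k n, (∀ v, s.queue v < J) → f s ≤ 0) :
    cesaroMean d k n lam kap N f ≤ n * (1 / 8 : ℝ) ^ J := by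
  classical
  have hg := isGoodMean_cesaroMean (d := d) (k := k) (n := n) hl hk hsmall N
  have h1 : ∀ s, f s ≤ (∑ v : Fin n, ∑ G : Fin d → EqualPartition n k,
      gInd G (Pi.single v J)) s := by
    intro s
    simp only [Finset.sum_apply]
    by_cases hs : ∀ v, s.queue v < J
    · exact (hf' s hs).trans (Finset.sum_nonneg fun v _ => Finset.sum_nonneg fun G _ =>
        gInd_nonneg _ _ _)
    · push Not at hs
      obtain ⟨v, hv⟩ := hs
      have h2 : gInd s.graph (Pi.single v J) s = 1 := by
        unfold gInd ind
        rw [if_pos rfl, if_pos]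
        intro u
        by_cases hu : u = v
        · subst hu; simpa using hv
        · simp [hu]
      calc f s ≤ gInd s.graph (Pi.single v J) s := by rw [h2]; exact hf s
        _ ≤ ∑ G : Fin d → EqualPartition n k, gInd G (Pi.single v J) s :=
          Finset.single_le_sum (f := fun G => gInd G (Pi.single v J) s)
            (fun G _ => gInd_nonneg _ _ _) (Finset.mem_univ s.graph)
        _ ≤ _ := Finset.single_le_sum
            (f := fun v => ∑ G : Fin d → EqualPartition n k, gInd G (Pi.single v J) s)
            (fun v _ => Finset.sum_nonneg fun G _ => gInd_nonneg _ _ _) (Finset.mem_univ v)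
  refine (hg.mono h1).trans ?_
  simp only [map_sum]
  have hc : (Fintype.card (Fin d → EqualPartition n k) : ℝ) ≠ 0 := by
    exact_mod_cast Fintype.card_ne_zero
  calc _ ≤ ∑ _v : Fin n, ∑ _G : Fin d → EqualPartition n k,
        (1 / 8 : ℝ) ^ J / Fintype.card (Fin d → EqualPartition n k) := by
        gcongr with v _ G _
        have := hg.tail G (Pi.single v J)
        rwa [Finset.sum_pi_single', if_pos (Finset.mem_univ v)] at this
    _ = _ := by
        simp only [Finset.sum_const, Finset.card_univ, nsmul_eq_mul, Fintype.card_fin]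
        field_simp

/-- A limit along an ultrafilter is a priori only finitely additive. The geometric tails are uniform
in N, so no mass escapes to infinity, and the limit is given by its point masses. -/
theorem hasSum_limMean {f : State d k n → ℝ} {B : ℝ} (hf : ∀ s, |f s| ≤ B) :
    HasSum (fun s => limMean d k n lam kap (open Classical in Pi.single s (1 : ℝ)) * f s)
      (limMean d k n lam kap f) := by
  classical
  have hB : 0 ≤ B ∨ IsEmpty (State d k n) := by
    rcases isEmpty_or_nonempty (State d k n) with h | ⟨⟨s⟩⟩
    · exact Or.inr h
    · exact Or.inl ((abs_nonneg _).trans (hf s))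
  have hst : Nonempty (State d k n) :=
    ⟨⟨fun _ => Classical.arbitrary _, fun _ => 0⟩⟩
  have hB : 0 ≤ B := hB.resolve_right (fun h => (not_isEmpty_iff.2 hst) h)
  have hsb : ∀ s s' : State d k n, |(Pi.single s (1 : ℝ) : State d k n → ℝ) s'| ≤ 1 := by
    intro s s'
    by_cases h : s' = s
    · subst h; simp
    · simp [h]
  rw [HasSum, Metric.tendsto_nhds]
  intro ε hε
  have ht : Filter.Tendsto (fun J : ℕ => (B + 1) * (n * (1 / 8 : ℝ) ^ J)) Filter.atTop
      (nhds ((B + 1) * (n * 0))) :=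
    ((tendsto_pow_atTop_nhds_zero_of_lt_one (by norm_num) (by norm_num)).const_mul _).const_mul _
  rw [mul_zero, mul_zero] at ht
  obtain ⟨J, hJ⟩ := (ht.eventually (gt_mem_nhds hε)).exists
  have hfin : {s : State d k n | ∀ v, s.queue v < J}.Finite := by
    refine Set.Finite.of_injOn (f := fun s : State d k n => (s.graph, s.queue))
      (t := (Set.univ : Set (Fin d → EqualPartition n k)) ×ˢ
        Set.pi Set.univ fun _ : Fin n => Set.Iio J) ?_ ?_ ?_
    · intro s hs
      exact ⟨trivial, fun v _ => hs v⟩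
    · intro s _ s' _ h
      simp only [Prod.mk.injEq] at h
      exact State.ext h.1 h.2
    · exact Set.finite_univ.prod (Set.Finite.pi fun _ => Set.finite_Iio J)
  -- There are finitely many partitions, so the states with all queues below J form a finite set.
  -- Any finite T containing it leaves only tail events.
  filter_upwards [Filter.mem_atTop hfin.toFinset] with T hT
  have hlim : Filter.Tendsto (fun N => cesaroMean d k n lam kap N f -
      ∑ s ∈ T, cesaroMean d k n lam kap N (Pi.single s (1 : ℝ)) * f s)
      (Filter.hyperfilter ℕ : Filter ℕ) (nhds (limMean d k n lam kap f -
      ∑ s ∈ T, limMean d k n lam kap (Pi.single s (1 : ℝ)) * f s)) :=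
    (tendsto_limMean hl hk hsmall hf).sub (tendsto_finsetSum _ fun s _ =>
      (tendsto_limMean hl hk hsmall (hsb s)).mul_const _)
  have hle : ∀ N, |cesaroMean d k n lam kap N f -
      ∑ s ∈ T, cesaroMean d k n lam kap N (Pi.single s (1 : ℝ)) * f s| ≤
      (B + 1) * (n * (1 / 8 : ℝ) ^ J) := by
    intro N
    -- The remainder is divided by B + 1, which is positive and exceeds the bound B, so that
    -- `cesaroMean_tail_le` applies to functions with values at most 1.
    have h1 : cesaroMean d k n lam kap N f -
        ∑ s ∈ T, cesaroMean d k n lam kap N (Pi.single s (1 : ℝ)) * f s =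
        (B + 1) * cesaroMean d k n lam kap N (fun s => (B + 1)⁻¹ * if s ∈ T then 0 else f s) := by
      have h2 : (fun s => (B + 1)⁻¹ * if s ∈ T then 0 else f s) =
          (B + 1)⁻¹ • (f - ∑ s ∈ T, f s • (Pi.single s (1 : ℝ) : State d k n → ℝ)) := by
        funext s
        simp only [Pi.smul_apply, Pi.sub_apply, Finset.sum_apply, smul_eq_mul]
        congr 1
        by_cases hs : s ∈ T
        · rw [if_pos hs, Finset.sum_eq_single s]
          · simp
          · intro b _ hb; simp [hb.symm]
          · exact fun h => absurd hs h
        · rw [if_neg hs, Finset.sum_eq_zero, sub_zero]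
          intro b hb
          have : s ≠ b := by rintro rfl; exact hs hb
          simp [this]
      rw [h2, map_smul, map_sub, map_sum, smul_eq_mul, ← mul_assoc, mul_inv_cancel₀ (by positivity),
        one_mul]
      congr 1
      refine Finset.sum_congr rfl fun s _ => ?_
      rw [map_smul, smul_eq_mul, mul_comm]
    have hbd : ∀ s, |(B + 1)⁻¹ * if s ∈ T then 0 else f s| ≤ 1 := by
      intro s
      rw [abs_mul, abs_of_nonneg (by positivity), inv_mul_le_iff₀ (by positivity)]
      split_ifs
      · simp; positivity
      · linarith [hf s]
    have h0 : ∀ s : State d k n, (∀ v, s.queue v < J) →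
        (B + 1)⁻¹ * (if s ∈ T then 0 else f s) = 0 := by
      intro s hs
      have : s ∈ T := hT (by simpa using hs)
      simp [this]
    have h3 := cesaroMean_tail_le hl hk hsmall J N
      (fun s => (_root_.abs_le.1 (hbd s)).2) (fun s hs => (h0 s hs).le)
    have h4 := cesaroMean_tail_le hl hk hsmall J N
      (f := -fun s => (B + 1)⁻¹ * (if s ∈ T then 0 else f s))
      (fun s => by
        have := (_root_.abs_le.1 (hbd s)).1
        show -_ ≤ (1 : ℝ)
        linarith) (fun s hs => by
        have h5 := h0 s hs
        show -((B + 1)⁻¹ * (if s ∈ T then 0 else f s)) ≤ (0 : ℝ)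
        rw [h5, neg_zero])
    rw [map_neg] at h4
    rw [h1, abs_mul, abs_of_nonneg (by positivity : (0 : ℝ) ≤ B + 1)]
    refine mul_le_mul_of_nonneg_left ?_ (by positivity)
    rw [_root_.abs_le]
    constructor <;> linarith
  have := le_of_tendsto' hlim.abs hle
  rw [dist_comm, Real.dist_eq]
  exact this.trans_lt hJ

/-- There is a stationary law with uniform partitions, invariant under relabelling, and with
geometric tails of the queues conditionally on the partitions. -/
theorem exists_stationary : ∃ π : Measure (State d k n), IsProbabilityMeasure π ∧
    (∀ f : State d k n → ℝ, (∃ B : ℝ, ∀ s, |f s| ≤ B) → ∫ s, gen lam kap f s ∂π = 0) ∧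
    (∀ G j, ∫ s, gInd G j s ∂π ≤
      (1 / 8) ^ (∑ v, j v) / Fintype.card (Fin d → EqualPartition n k)) ∧
    (∀ G, ∫ s, gInd G 0 s ∂π = 1 / Fintype.card (Fin d → EqualPartition n k)) ∧
    (∀ (σ : Equiv.Perm (Fin n)) (f : State d k n → ℝ), (∃ B : ℝ, ∀ s, |f s| ≤ B) →
      ∫ s, f (s.relabel σ) ∂π = ∫ s, f s ∂π) := by
  classical
  have hg := isGoodMean_cesaroMean (d := d) (k := k) (n := n) hl hk hsmall
  set p : State d k n → ℝ := fun s => limMean d k n lam kap (Pi.single s (1 : ℝ)) with hp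
  have hsb : ∀ s s' : State d k n, |(Pi.single s (1 : ℝ) : State d k n → ℝ) s'| ≤ 1 := by
    intro s s'
    by_cases h : s' = s
    · subst h; simp
    · simp [h]
  have hp0 : ∀ s, 0 ≤ p s := by
    intro s
    refine ge_of_tendsto' (tendsto_limMean hl hk hsmall (hsb s)) fun N => (hg N).nonneg _ ?_
    intro s'
    by_cases h : s' = s
    · subst h; simp
    · simp [h]
  have hp1 : HasSum p 1 := by
    have := hasSum_limMean hl hk hsmall (d := d) (k := k) (n := n) (f := fun _ => 1) (B := 1)
      (by simp)
    rw [limMean_eq hl hk hsmall (f := fun _ : State d k n => (1 : ℝ)) (c := 1) (B := 1) (by simp)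
      (fun N => (hg N).one)] at this
    simpa [hp] using this
  have hpE : HasSum (fun s => ENNReal.ofReal (p s)) 1 := by
    have h1 := ENNReal.ofReal_tsum_of_nonneg hp0 hp1.summable
    rw [hp1.tsum_eq, ENNReal.ofReal_one] at h1
    rw [h1]
    exact ENNReal.summable.hasSum
  set q : PMF (State d k n) := ⟨fun s => ENNReal.ofReal (p s), hpE⟩ with hq
  have hint : ∀ f : State d k n → ℝ, (∃ B : ℝ, ∀ s, |f s| ≤ B) →
      ∫ s, f s ∂q.toMeasure = limMean d k n lam kap f := by
    rintro f ⟨B, hB⟩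
    rw [PMF.integral_eq_tsum q f (integrable_of_abs_le hB)]
    have := (hasSum_limMean hl hk hsmall hB).tsum_eq
    rw [← this]
    refine tsum_congr fun s => ?_
    rw [smul_eq_mul]
    congr 1
    exact ENNReal.toReal_ofReal (hp0 s)
  have hgb : ∀ G j, ∀ s : State d k n, |gInd G j s| ≤ 1 := fun G j s => by
    rw [abs_of_nonneg (gInd_nonneg _ _ _)]; exact gInd_le_one _ _ _
  refine ⟨q.toMeasure, inferInstance, ?_, ?_, ?_, ?_⟩
  · rintro f ⟨B, hB⟩
    rw [hint _ ⟨_, abs_gen_le hl hk hB⟩]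
    exact limMean_genL hl hk hsmall hB
  · intro G j
    rw [hint _ ⟨1, hgb G j⟩]
    exact limMean_le hl hk hsmall (hgb G j) fun N => (hg N).tail G j
  · intro G
    rw [hint _ ⟨1, hgb G 0⟩]
    exact limMean_eq hl hk hsmall (hgb G 0) fun N => (hg N).uniform G
  · rintro σ f ⟨B, hB⟩
    rw [hint _ ⟨B, hB⟩, hint _ ⟨B, fun s => hB _⟩]
    refine tendsto_nhds_unique
      (tendsto_limMean hl hk hsmall (f := fun s => f (s.relabel σ)) (fun s => hB _)) ?_
    simp only [(hg _).relabel σ f]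
    exact tendsto_limMean hl hk hsmall hB

end LimMean

/-! ### All equal partitions are related by permutations -/

theorem card_div_eq (hk : 0 < k) (hkn : k ∣ n) (v : Fin n) :
    Nat.card {u : Fin n // (v : ℕ) / k = (u : ℕ) / k} = k := by
  obtain ⟨m, rfl⟩ := hkn
  have e : {u : Fin (k * m) // (v : ℕ) / k = (u : ℕ) / k} ≃ Fin k :=
    { toFun := fun u => ⟨(u : ℕ) % k, Nat.mod_lt _ hk⟩
      invFun := fun a => ⟨⟨k * ((v : ℕ) / k) + a, by
        have h1 : (v : ℕ) / k < m := Nat.div_lt_of_lt_mul v.2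
        calc k * ((v : ℕ) / k) + a < k * ((v : ℕ) / k) + k := by have := a.2; omega
          _ = k * ((v : ℕ) / k + 1) := by ring
          _ ≤ k * m := Nat.mul_le_mul_left k h1⟩, by
        rw [Nat.mul_add_div hk, Nat.div_eq_of_lt a.2, add_zero]⟩
      left_inv := fun u => by
        apply Subtype.ext; apply Fin.ext
        show k * ((v : ℕ) / k) + (u : ℕ) % k = u
        have := u.2
        simp only [this, Nat.div_add_mod]
      right_inv := fun a => by
        apply Fin.ext
        show (k * ((v : ℕ) / k) + a) % k = a
        rw [Nat.mul_add_mod, Nat.mod_eq_of_lt a.2] }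
  rw [Nat.card_congr e, Nat.card_eq_fintype_card, Fintype.card_fin]

/-- The partition of `Fin n` into intervals of length `k`. -/
def slotPartition (hk : 0 < k) (hkn : k ∣ n) : EqualPartition n k where
  rel := Setoid.ker fun u : Fin n => (u : ℕ) / k
  card_class v := card_div_eq hk hkn v

theorem slotPartition_relabel_rel (hk : 0 < k) (hkn : k ∣ n) (σ : Equiv.Perm (Fin n))
    (u v : Fin n) : ((slotPartition hk hkn).relabel σ).rel u v ↔ (σ u : ℕ) / k = (σ v : ℕ) / k :=
  Iff.rfl

/-- Number the classes and, within each class, its k elements; the pair (class, position) is the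
slot. -/
theorem exists_eq_slotPartition_relabel (hk : 0 < k) (hkn : k ∣ n) (P : EqualPartition n k) :
    ∃ σ : Equiv.Perm (Fin n), P = (slotPartition hk hkn).relabel σ := by
  classical
  obtain ⟨m, rfl⟩ := hkn
  set Q := Quotient P.rel
  have hf : ∀ q : Q, Nonempty ({u // (Quotient.mk P.rel u) = q} ≃ Fin k) := by
    intro q
    induction q using Quotient.inductionOn with
    | h v =>
      refine ⟨Finite.equivFinOfCardEq ?_⟩
      refine (Nat.card_congr ?_).trans (P.card_class v)
      refine (Equiv.subtypeEquivRight fun u => ?_)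
      rw [Quotient.eq]
      exact ⟨fun h => P.rel.symm h, fun h => P.rel.symm h⟩
  let e1 : Fin (k * m) ≃ Q × Fin k :=
    (Equiv.sigmaFiberEquiv (Quotient.mk P.rel)).symm.trans
      ((Equiv.sigmaCongrRight fun q => Classical.choice (hf q)).trans (Equiv.sigmaEquivProd Q (Fin k)))
  have he1 : ∀ u, (e1 u).1 = Quotient.mk P.rel u := fun u => rfl
  have hc : Nat.card Q = m := by
    have h1 := Nat.card_congr e1
    rw [Nat.card_prod, Nat.card_eq_fintype_card, Nat.card_eq_fintype_card (α := Fin k),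
      Fintype.card_fin, Fintype.card_fin, mul_comm] at h1
    exact (Nat.eq_of_mul_eq_mul_right hk h1).symm
  let e2 : Q ≃ Fin m := Finite.equivFinOfCardEq hc
  let σ : Fin (k * m) ≃ Fin (k * m) := e1.trans ((e2.prodCongr (Equiv.refl _)).trans
    (finProdFinEquiv.trans (finCongr (mul_comm m k))))
  refine ⟨σ, EqualPartition.ext_rel (Setoid.ext fun u v => ?_)⟩
  have hσ : ∀ u, (σ u : ℕ) / k = e2 (Quotient.mk P.rel u) := by
    intro u
    have : (σ u : ℕ) = ((e1 u).2 : ℕ) + k * (e2 (e1 u).1 : ℕ) := rfl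
    rw [this, Nat.add_mul_div_left _ _ hk, Nat.div_eq_of_lt (e1 u).2.2, zero_add, he1]
  rw [slotPartition_relabel_rel, hσ, hσ, ← Fin.ext_iff, e2.injective.eq_iff, Quotient.eq]

theorem EqualPartition.relabel_mul (P : EqualPartition n k) (σ τ : Equiv.Perm (Fin n)) :
    P.relabel (σ * τ) = (P.relabel σ).relabel τ := rfl

theorem EqualPartition.relabel_one (P : EqualPartition n k) : P.relabel 1 = P := rfl

theorem EqualPartition.relabel_swap_eq (P : EqualPartition n k) (v w : Fin n) :
    P.relabel (Equiv.swap v w) = P.swap v w := rfl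

theorem exists_eq_relabel (hk : 0 < k) (hkn : k ∣ n) (P P' : EqualPartition n k) :
    ∃ σ : Equiv.Perm (Fin n), P' = P.relabel σ := by
  obtain ⟨σ, rfl⟩ := exists_eq_slotPartition_relabel hk hkn P
  obtain ⟨σ', rfl⟩ := exists_eq_slotPartition_relabel hk hkn P'
  exact ⟨σ⁻¹ * σ', by rw [← EqualPartition.relabel_mul, mul_inv_cancel_left]⟩

/-! ### Uniqueness of the stationary law -/

/-- At a maximum of f all increments are nonpositive, so keeping a single one gives an upper bound.
If the generator vanishes there, each reachable state must be a maximum too. -/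
theorem gen_le_serve {lam kap : ℝ} (hl : 0 ≤ lam) (hk : 0 ≤ kap) {f : State d k n → ℝ}
    {s : State d k n} (hf : ∀ s', f s' ≤ f s) (v : Fin n) :
    gen lam kap f s ≤ f (s.serve v) - f s := by
  have h1 : ∑ v : Fin n, (f (s.serve v) - f s) ≤ f (s.serve v) - f s := by
    rw [← Finset.add_sum_erase _ _ (Finset.mem_univ v)]
    have : ∑ x ∈ Finset.univ.erase v, (f (s.serve x) - f s) ≤ 0 :=
      Finset.sum_nonpos fun x _ => sub_nonpos.2 (hf _)
    linarith
  have h2 : ∑ v : Fin n, lam * (((s.shortest v).card : ℝ)⁻¹ *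
        ∑ w ∈ s.shortest v, (f (s.join w) - f s)) ≤ 0 :=
    Finset.sum_nonpos fun v _ => mul_nonpos_of_nonneg_of_nonpos hl
      (mul_nonpos_of_nonneg_of_nonpos (by positivity)
        (Finset.sum_nonpos fun x _ => sub_nonpos.2 (hf _)))
  have h3 : ∑ v : Fin n, ∑ i : Fin d, kap * ((n : ℝ)⁻¹ *
      ∑ w : Fin n, (f (s.move i v w) - f s)) ≤ 0 :=
    Finset.sum_nonpos fun v _ => Finset.sum_nonpos fun i _ => mul_nonpos_of_nonneg_of_nonpos hk
      (mul_nonpos_of_nonneg_of_nonpos (by positivity)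
        (Finset.sum_nonpos fun x _ => sub_nonpos.2 (hf _)))
  unfold gen
  linarith

theorem gen_le_move {lam kap : ℝ} (hl : 0 ≤ lam) (hk : 0 ≤ kap) {f : State d k n → ℝ}
    {s : State d k n} (hf : ∀ s', f s' ≤ f s) (i : Fin d) (v w : Fin n) :
    gen lam kap f s ≤ kap * ((n : ℝ)⁻¹ * (f (s.move i v w) - f s)) := by
  have h1 : ∑ v : Fin n, (f (s.serve v) - f s) ≤ 0 :=
    Finset.sum_nonpos fun x _ => sub_nonpos.2 (hf _)
  have h2 : ∑ v : Fin n, lam * (((s.shortest v).card : ℝ)⁻¹ *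
        ∑ w ∈ s.shortest v, (f (s.join w) - f s)) ≤ 0 :=
    Finset.sum_nonpos fun v _ => mul_nonpos_of_nonneg_of_nonpos hl
      (mul_nonpos_of_nonneg_of_nonpos (by positivity)
        (Finset.sum_nonpos fun x _ => sub_nonpos.2 (hf _)))
  have hn : (0 : ℝ) ≤ (n : ℝ)⁻¹ := by positivity
  have h4 : ∀ v i, kap * ((n : ℝ)⁻¹ * ∑ w : Fin n, (f (s.move i v w) - f s)) ≤ 0 := fun v i =>
    mul_nonpos_of_nonneg_of_nonpos hk
      (mul_nonpos_of_nonneg_of_nonpos hn (Finset.sum_nonpos fun x _ => sub_nonpos.2 (hf _)))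
  have h3 : ∑ v : Fin n, ∑ i : Fin d, kap * ((n : ℝ)⁻¹ *
      ∑ w : Fin n, (f (s.move i v w) - f s)) ≤ kap * ((n : ℝ)⁻¹ * (f (s.move i v w) - f s)) := by
    rw [← Finset.add_sum_erase _ _ (Finset.mem_univ v),
      ← Finset.add_sum_erase _ _ (Finset.mem_univ i),
      ← Finset.add_sum_erase _ (fun w => f (s.move i v w) - f s) (Finset.mem_univ w)]
    have h5 : ∑ x ∈ Finset.univ.erase w, (f (s.move i v x) - f s) ≤ 0 :=
      Finset.sum_nonpos fun x _ => sub_nonpos.2 (hf _)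
    have h6 := mul_nonpos_of_nonneg_of_nonpos hk (mul_nonpos_of_nonneg_of_nonpos hn h5)
    have h7 := Finset.sum_nonpos fun (x : Fin d) (_ : x ∈ Finset.univ.erase i) => h4 v x
    have h8 := Finset.sum_nonpos fun (x : Fin n) (_ : x ∈ Finset.univ.erase v) =>
      Finset.sum_nonpos fun (y : Fin d) (_ : y ∈ (Finset.univ : Finset (Fin d))) => h4 x y
    rw [mul_add, mul_add]
    linarith
  unfold gen
  linarith

theorem integral_eq_tsum_real (μ : Measure (State d k n)) [IsProbabilityMeasure μ]
    {f : State d k n → ℝ} {B : ℝ} (hf : ∀ s, |f s| ≤ B) :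
    HasSum (fun s => μ.real {s} * f s) (∫ s, f s ∂μ) := by
  have h := integrable_of_abs_le (μ := μ) hf
  have h2 := hasSum_integral_iUnion (μ := μ) (f := f) (s := fun s => {s})
    (fun s => measurableSet_singleton s)
    (fun s s' h => Set.disjoint_singleton.2 h) h.integrableOn
  rw [Set.iUnion_of_singleton, setIntegral_univ] at h2
  simp only [integral_singleton, smul_eq_mul] at h2
  exact h2

/-- The set where one stationary law exceeds another is closed under the transitions. -/
theorem gen_indicator_eq_zero {lam kap : ℝ} (hl : 0 ≤ lam) (hk : 0 ≤ kap)
    (μ μ' : Measure (State d k n)) [IsProbabilityMeasure μ] [IsProbabilityMeasure μ']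
    (h : ∀ f : State d k n → ℝ, (∃ B : ℝ, ∀ s, |f s| ≤ B) → ∫ s, gen lam kap f s ∂μ = 0)
    (h' : ∀ f : State d k n → ℝ, (∃ B : ℝ, ∀ s, |f s| ≤ B) → ∫ s, gen lam kap f s ∂μ' = 0)
    {s : State d k n} (hs : μ'.real {s} < μ.real {s}) :
    gen lam kap ({s | μ'.real {s} < μ.real {s}}.indicator 1) s = 0 := by
  classical
  set A := {s | μ'.real {s} < μ.real {s}} with hA
  set f : State d k n → ℝ := A.indicator 1 with hf
  have hf0 : ∀ s, 0 ≤ f s := fun s => Set.indicator_nonneg (by simp) s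
  have hf1 : ∀ s, f s ≤ 1 := fun s => Set.indicator_le_self' (by simp) s
  have hfB : ∀ s, |f s| ≤ 1 := fun s => by rw [abs_of_nonneg (hf0 s)]; exact hf1 s
  have hgB := abs_gen_le (d := d) (k := k) hl hk hfB
  have h1 := (integral_eq_tsum_real μ hgB).sub (integral_eq_tsum_real μ' hgB)
  rw [h f ⟨1, hfB⟩, h' f ⟨1, hfB⟩, sub_zero] at h1
  -- On A the indicator is maximal and its generator is nonpositive; off A it is minimal and the
  -- generator is nonnegative. So the summand has a constant sign. The total is zero by stationarity
  -- of both laws, hence every summand vanishes, and on A the factor of the generator is nonzero.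
  have h2 : ∀ s, 0 ≤ -(μ.real {s} * gen lam kap f s - μ'.real {s} * gen lam kap f s) := by
    intro s
    by_cases hsA : s ∈ A
    · have hfs : f s = 1 := by simp [hf, hsA]
      have hn : n = 0 ∨ 0 < n := Nat.eq_zero_or_pos n
      have hg : gen lam kap f s ≤ 0 := by
        have := neg_rate_mul_le_gen hl hk (f := fun s' => 1 - f s')
          (fun s' => by linarith [hf1 s']) s
        rw [gen_sub, gen_const, hfs] at this
        linarith
      have : μ'.real {s} < μ.real {s} := hsA
      nlinarith
    · have hfs : f s = 0 := by simp [hf, hsA]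
      have hg : 0 ≤ gen lam kap f s := by
        have := neg_rate_mul_le_gen hl hk hf0 s
        rw [hfs] at this
        linarith
      have : μ.real {s} ≤ μ'.real {s} := not_lt.1 hsA
      nlinarith
  have h3 := h1.neg
  rw [neg_zero] at h3
  have h4 := (hasSum_zero_iff_of_nonneg h2).1 h3
  have h5 := congrFun h4 s
  simp only [Pi.zero_apply] at h5
  have h6 : (μ.real {s} - μ'.real {s}) * gen lam kap f s = 0 := by linarith
  rcases mul_eq_zero.1 h6 with h7 | h7
  · linarith
  · exact h7

/-- A set of states closed under services contains, with any state, the state with the same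
partitions and empty queues. -/
theorem empty_mem_of_closed {A : Set (State d k n)} (hA : ∀ s ∈ A, ∀ v, s.serve v ∈ A)
    {s : State d k n} (hs : s ∈ A) : (⟨s.graph, 0⟩ : State d k n) ∈ A := by
  obtain ⟨N, hN⟩ : ∃ N, ∑ v, s.queue v = N := ⟨_, rfl⟩
  induction N generalizing s with
  | zero =>
    have : s.queue = 0 := funext fun v => by
      have := Finset.sum_eq_zero_iff.1 hN v (Finset.mem_univ v)
      simpa using this
    rw [← this]
    exact hs
  | succ N ih =>
    obtain ⟨v, hv⟩ : ∃ v, s.queue v ≠ 0 := by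
      by_contra! h
      simp [h] at hN
    have h1 := ih (s := s.serve v) (hA s hs v) (by
      have h2 : (s.serve v).queue = s.queue - Pi.single v 1 := by
        funext u
        show Function.update s.queue v (s.queue v - 1) u = _
        by_cases hu : u = v
        · subst hu; simp
        · simp [hu]
      rw [h2]
      have := sum_sub_single hv
      omega)
    exact h1

/-- Transpositions generate all permutations, and any equal partition is a relabelling of any other.
The labels are adjusted one after the other. -/
theorem graph_mem_of_closed (hk : 0 < k) (hkn : k ∣ n) {A : Set (State d k n)}
    (hA : ∀ s ∈ A, ∀ i v w, s.move i v w ∈ A)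
    {s : State d k n} (hs : s ∈ A) (G : Fin d → EqualPartition n k) :
    (⟨G, s.queue⟩ : State d k n) ∈ A := by
  classical
  have h1 : ∀ (i : Fin d) (σ : Equiv.Perm (Fin n)) (G : Fin d → EqualPartition n k),
      (⟨G, s.queue⟩ : State d k n) ∈ A →
      (⟨Function.update G i ((G i).relabel σ), s.queue⟩ : State d k n) ∈ A := by
    intro i σ G hG
    induction σ using Equiv.Perm.swap_induction_on' with
    | one => simpa [EqualPartition.relabel_one] using hG
    | mul_swap σ v w _ ih =>
      have h2 := hA _ ih i v w
      convert h2 using 1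
      refine State.ext ?_ rfl
      show Function.update G i ((G i).relabel (σ * Equiv.swap v w)) =
        Function.update (Function.update G i ((G i).relabel σ)) i
        ((Function.update G i ((G i).relabel σ) i).swap v w)
      rw [Function.update_idem, Function.update_self, EqualPartition.relabel_mul,
        EqualPartition.relabel_swap_eq]
  have h2 : ∀ T : Finset (Fin d), (⟨fun i => if i ∈ T then G i else s.graph i, s.queue⟩ :
      State d k n) ∈ A := by
    intro T
    induction T using Finset.induction_on with
    | empty => simpa using hs
    | insert i T hi ih =>
      obtain ⟨σ, hσ⟩ := exists_eq_relabel hk hkn (s.graph i) (G i)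
      have h3 := h1 i σ _ ih
      convert h3 using 1
      refine State.ext (funext fun i' => ?_) rfl
      by_cases hi' : i' = i
      · subst hi'; simp [hi, hσ]
      · simp [hi']
  simpa using h2 Finset.univ

/-- Two distinct probability laws exceed each other in different places. Both places lead, through
services and, for `kap` > 0, swaps, to one common state with empty queues, where each law would
strictly exceed the other. For `kap` = 0 the partitions are frozen, and the two places have to be
found over the same partitions. -/
theorem stationary_unique {lam kap : ℝ} (hl : 0 ≤ lam) (hk : 0 ≤ kap) (hk0 : 0 < k) (hkn : k ∣ n)
    (hn : 0 < n)
    (μ μ' : Measure (State d k n)) (h : IsStationaryLaw lam kap μ)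
    (h' : IsStationaryLaw lam kap μ') : μ = μ' := by
  classical
  have := h.isProbabilityMeasure
  have := h'.isProbabilityMeasure
  have hg : ∀ f : State d k n → ℝ, (∃ B : ℝ, ∀ s, |f s| ≤ B) → ∫ s, gen lam kap f s ∂μ = 0 :=
    fun f hf => integral_gen_eq_zero hl hk μ hf fun t ht => h.invariant t ht f hf
  have hg' : ∀ f : State d k n → ℝ, (∃ B : ℝ, ∀ s, |f s| ≤ B) → ∫ s, gen lam kap f s ∂μ' = 0 :=
    fun f hf => integral_gen_eq_zero hl hk μ' hf fun t ht => h'.invariant t ht f hf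
  -- closure properties
  have hcl : ∀ μ μ' : Measure (State d k n), IsProbabilityMeasure μ → IsProbabilityMeasure μ' →
      (∀ f : State d k n → ℝ, (∃ B : ℝ, ∀ s, |f s| ≤ B) → ∫ s, gen lam kap f s ∂μ = 0) →
      (∀ f : State d k n → ℝ, (∃ B : ℝ, ∀ s, |f s| ≤ B) → ∫ s, gen lam kap f s ∂μ' = 0) →
      ∀ s ∈ {s | μ'.real {s} < μ.real {s}},
        (∀ v, s.serve v ∈ {s | μ'.real {s} < μ.real {s}}) ∧
        (0 < kap → ∀ i v w, s.move i v w ∈ {s | μ'.real {s} < μ.real {s}}) := by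
    intro μ μ' _ _ hg hg' s hs
    have h0 := gen_indicator_eq_zero hl hk μ μ' hg hg' hs
    have hle : ∀ s', ({s | μ'.real {s} < μ.real {s}}.indicator 1 : State d k n → ℝ) s' ≤
        ({s | μ'.real {s} < μ.real {s}}.indicator 1 : State d k n → ℝ) s := by
      intro s'
      rw [Set.indicator_of_mem hs]
      exact Set.indicator_le_self' (by simp) s'
    have hs1 : ({s | μ'.real {s} < μ.real {s}}.indicator 1 : State d k n → ℝ) s = 1 :=
      Set.indicator_of_mem hs _
    constructor
    · intro v
      have := gen_le_serve hl hk hle v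
      rw [h0, hs1] at this
      by_contra hv
      rw [Set.indicator_of_notMem hv] at this
      norm_num at this
    · intro hkap i v w
      have := gen_le_move hl hk hle i v w
      rw [h0, hs1] at this
      by_contra hv
      rw [Set.indicator_of_notMem hv] at this
      have hn' : (0 : ℝ) < (n : ℝ)⁻¹ := by positivity
      nlinarith [mul_pos hkap hn']
  have hopp : ∀ s s', μ'.real {s} < μ.real {s} → μ.real {s'} < μ'.real {s'} →
      (kap = 0 → s.graph = s'.graph) → False := by
    intro s s' hs hs' hG
    have h1 := empty_mem_of_closed (fun s hs => (hcl μ μ' ‹_› ‹_› hg hg' s hs).1) hs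
    have h2 := empty_mem_of_closed (fun s hs => (hcl μ' μ ‹_› ‹_› hg' hg s hs).1) hs'
    have h3 : (⟨s'.graph, 0⟩ : State d k n) ∈ {s | μ'.real {s} < μ.real {s}} := by
      rcases hk.eq_or_lt with h0 | h0
      · rw [← hG h0.symm]; exact h1
      · exact graph_mem_of_closed hk0 hkn (fun s hs => (hcl μ μ' ‹_› ‹_› hg hg' s hs).2 h0) h1 _
    have h4 : μ'.real {(⟨s'.graph, 0⟩ : State d k n)} < μ.real {⟨s'.graph, 0⟩} := h3
    have h5 : μ.real {(⟨s'.graph, 0⟩ : State d k n)} < μ'.real {⟨s'.graph, 0⟩} := h2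
    exact lt_asymm h4 h5
  -- masses agree
  have hgraph : kap = 0 → ∀ μ : Measure (State d k n), IsStationaryLaw lam kap μ →
      ∀ G : Fin d → EqualPartition n k,
      μ.real {s | s.graph = G} * Fintype.card (Fin d → EqualPartition n k) = 1 := by
    intro h0 μ h G
    have := h.isProbabilityMeasure
    have h1 : ∑ G' : Fin d → EqualPartition n k, μ.real {s | s.graph = G'} = 1 := by
      rw [← measureReal_biUnion_finset]
      · have : (⋃ G' ∈ (Finset.univ : Finset (Fin d → EqualPartition n k)),
          {s : State d k n | s.graph = G'}) = Set.univ := by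
          ext s; simp
        rw [this]; simp
      · intro G _ G' _ hne
        rw [Function.onFun, Set.disjoint_left]
        intro s hs hs'
        exact hne (hs.symm.trans hs')
      · exact fun _ _ => MeasurableSet.of_discrete
    have h2 : ∀ G', μ.real {s | s.graph = G'} = μ.real {s | s.graph = G} := fun G' => by
      simp only [Measure.real, h.uniform_of_static h0 G' G]
    simp only [h2, Finset.sum_const, Finset.card_univ, nsmul_eq_mul] at h1
    linarith
  have key : ∀ μ μ' : Measure (State d k n), IsStationaryLaw lam kap μ →
      IsStationaryLaw lam kap μ' → ∀ s, μ'.real {s} < μ.real {s} →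
      ∃ s', μ.real {s'} < μ'.real {s'} ∧ (kap = 0 → s.graph = s'.graph) := by
    intro μ μ' h h' s hs
    have := h.isProbabilityMeasure
    have := h'.isProbabilityMeasure
    by_contra! hcon
    -- Both laws give the same mass to this event: for `kap` = 0 it fixes the partitions, whose law
    -- is uniform; otherwise it is the whole space. So an excess at s is balanced by a deficit
    -- inside the event.
    set f : State d k n → ℝ := fun s' => if kap = 0 → s.graph = s'.graph then 1 else 0 with hf
    have hfB : ∀ s, |f s| ≤ 1 := by intro s; simp only [hf]; split_ifs <;> simp
    have heq : ∫ s, f s ∂μ = ∫ s, f s ∂μ' := by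
      by_cases h0 : kap = 0
      · have h1 : ∀ μ : Measure (State d k n), ∫ s, f s ∂μ = μ.real {s' | s'.graph = s.graph} := by
          intro μ
          rw [← integral_indicator_one MeasurableSet.of_discrete]
          congr 1
          funext s'
          simp only [hf, h0, Set.indicator_apply, Set.mem_ofPred_eq, forall_const, Pi.one_apply,
            eq_comm]
        rw [h1, h1]
        have h2 := hgraph h0 μ h s.graph
        have h3 := hgraph h0 μ' h' s.graph
        have h4 : (Fintype.card (Fin d → EqualPartition n k) : ℝ) ≠ 0 := by
          intro h; rw [h] at h2; simp at h2
        exact mul_right_cancel₀ h4 (h2.trans h3.symm)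
      · simp [hf, h0]
    have h1 := (integral_eq_tsum_real μ hfB).sub (integral_eq_tsum_real μ' hfB)
    rw [heq, sub_self] at h1
    have h2 : ∀ s', 0 ≤ μ.real {s'} * f s' - μ'.real {s'} * f s' := by
      intro s'
      rw [← sub_mul]
      simp only [hf]
      split_ifs with hc
      · have : μ'.real {s'} ≤ μ.real {s'} := by
          by_contra hlt
          obtain ⟨h5, h6⟩ := hcon s' (not_le.1 hlt)
          exact h6 (hc h5)
        simpa using this
      · simp
    have h3 := congrFun ((hasSum_zero_iff_of_nonneg h2).1 h1) s
    have h4 : f s = 1 := by simp [hf]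
    simp only [h4, mul_one, Pi.zero_apply] at h3
    linarith
  have hreal : ∀ s, μ.real {s} = μ'.real {s} := by
    intro s
    rcases lt_trichotomy (μ.real {s}) (μ'.real {s}) with h1 | h1 | h1
    · obtain ⟨s', h2, h3⟩ := key μ' μ h' h s h1
      exact (hopp s' s h2 h1 fun h0 => (h3 h0).symm).elim
    · exact h1
    · obtain ⟨s', h2, h3⟩ := key μ μ' h h' s h1
      exact (hopp s s' h1 h2 h3).elim
  refine Measure.ext_of_singleton fun s => ?_
  have := hreal s
  rwa [measureReal_eq_measureReal_iff] at this

/-! ### The conditional laws of the queues given the partitions -/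

/-- A family of laws of the queues, indexed by the partitions, with the properties of the
conditional laws of the queues given the partitions at stationarity. -/
structure IsLocalEquilibrium (lam kap : ℝ)
    (ν : (Fin d → EqualPartition n k) → Measure (Fin n → ℕ)) : Prop where
  prob : ∀ G, IsProbabilityMeasure (ν G)
  tail : ∀ G j, ∫ Q, ind j Q ∂ν G ≤ (1 / 8) ^ (∑ v, j v)
  exch : ∀ (σ : Equiv.Perm (Fin n)) G (f : (Fin n → ℕ) → ℝ), (∃ B : ℝ, ∀ Q, |f Q| ≤ B) →
    ∫ Q, f Q ∂ν (fun i => (G i).relabel σ) = ∫ Q, f (Q ∘ σ) ∂ν G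
  balance : ∀ G j,
    ∑ v ∈ Finset.univ.filter (fun v => j v ≠ 0),
        (∫ Q, ind (j + Pi.single v 1) Q ∂ν G - ∫ Q, ind j Q ∂ν G)
      + lam * ∑ w ∈ Finset.univ.filter (fun v => j v ≠ 0), ∫ Q, arr G j w Q ∂ν G
      + kap * ∑ v : Fin n, ∑ i : Fin d, (n : ℝ)⁻¹ * ∑ w : Fin n,
          (∫ Q, ind j Q ∂ν (moveGraph G i v w) - ∫ Q, ind j Q ∂ν G) = 0

/-- The conditional law of the queues given the partitions. -/
def condQueue (π : Measure (State d k n)) (G : Fin d → EqualPartition n k) :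
    Measure (Fin n → ℕ) :=
  (ProbabilityTheory.cond π {s | s.graph = G}).map State.queue

theorem abs_arr_le (G : Fin d → EqualPartition n k) (j : Fin n → ℕ) (w : Fin n)
    (Q : Fin n → ℕ) : |arr G j w Q| ≤ (1 + d * k : ℕ) := by
  rw [abs_of_nonneg (arr_nonneg _ _ _ _)]
  refine (arr_le G j w Q).trans ?_
  have := ind_le_one (j - Pi.single w 1) Q
  have h : (0 : ℝ) ≤ (1 + d * k : ℕ) := Nat.cast_nonneg _
  nlinarith

theorem abs_ind_le (j Q : Fin n → ℕ) : |ind j Q| ≤ 1 := by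
  rw [abs_of_nonneg (ind_nonneg _ _)]; exact ind_le_one _ _

/-! ### Disintegration over uniformly distributed partitions. -/

section

variable {π : Measure (State d k n)}
  (hu : ∀ G, ∫ s, gInd G 0 s ∂π = 1 / Fintype.card (Fin d → EqualPartition n k))

include hu

theorem real_graph_eq (G : Fin d → EqualPartition n k) :
    π.real {s | s.graph = G} = 1 / Fintype.card (Fin d → EqualPartition n k) := by
  classical
  rw [← hu G, ← integral_indicator_one MeasurableSet.of_discrete]
  refine integral_congr_ae (.of_forall fun s => ?_)
  by_cases h : s.graph = G
  · simp [gInd, h, ind_zero]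
  · simp [gInd, h]

theorem isProbabilityMeasure_condQueue [IsProbabilityMeasure π] [Nonempty (EqualPartition n k)]
    (G : Fin d → EqualPartition n k) : IsProbabilityMeasure (condQueue π G) := by
  have h1 : π {s | s.graph = G} ≠ 0 := by
    intro h0
    have h2 := real_graph_eq hu G
    rw [Measure.real, h0] at h2
    have : (Fintype.card (Fin d → EqualPartition n k) : ℝ) ≠ 0 := by
      exact_mod_cast Fintype.card_ne_zero
    exact (one_div_ne_zero this) (by simpa using h2.symm)
  have := ProbabilityTheory.cond_isProbabilityMeasure h1
  exact Measure.isProbabilityMeasure_map (Measurable.of_discrete).aemeasurable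

theorem integral_condQueue (G : Fin d → EqualPartition n k) (f : (Fin n → ℕ) → ℝ) :
    ∫ Q, f Q ∂condQueue π G = Fintype.card (Fin d → EqualPartition n k) *
      ∫ s, (open Classical in if s.graph = G then f s.queue else 0) ∂π := by
  classical
  unfold condQueue
  rw [integral_map (Measurable.of_discrete).aemeasurable
    (Measurable.of_discrete).aestronglyMeasurable, ProbabilityTheory.cond, integral_smul_measure,
    ← integral_indicator MeasurableSet.of_discrete]
  have h1 : (π {s | s.graph = G})⁻¹.toReal = Fintype.card (Fin d → EqualPartition n k) := by
    rw [ENNReal.toReal_inv]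
    have := real_graph_eq hu G
    rw [Measure.real] at this
    rw [this, one_div, inv_inv]
  rw [h1, smul_eq_mul]
  congr 1
  refine integral_congr_ae (.of_forall fun s => ?_)
  simp only [Set.indicator_apply, Set.mem_ofPred_eq]

theorem integral_queue_eq [IsProbabilityMeasure π] [Nonempty (EqualPartition n k)] {f : (Fin n → ℕ) → ℝ} {B : ℝ}
    (hf : ∀ Q, |f Q| ≤ B) :
    ∫ s, f s.queue ∂π = (∑ G : Fin d → EqualPartition n k, ∫ Q, f Q ∂condQueue π G) /
      Fintype.card (Fin d → EqualPartition n k) := by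
  classical
  have hc : (Fintype.card (Fin d → EqualPartition n k) : ℝ) ≠ 0 := by
    exact_mod_cast Fintype.card_ne_zero
  simp only [integral_condQueue hu, ← Finset.mul_sum]
  rw [mul_div_assoc, mul_div_cancel₀ _ hc, ← integral_finsetSum]
  · refine integral_congr_ae (.of_forall fun s => ?_)
    simp
  · intro G _
    refine integrable_of_abs_le (B := B) fun s => ?_
    split_ifs
    · exact hf _
    · rw [abs_zero]; exact (abs_nonneg _).trans (hf s.queue)

end

/-- The balance equation is stationarity tested on the event of partitions G and Q ≥ j. Since the
partitions are uniform, conditioning multiplies every term, including those with swapped partitions,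
by the same constant. -/
theorem exists_localEquilibrium [Nonempty (EqualPartition n k)] {lam kap : ℝ} (hl : 0 ≤ lam)
    (hk : 0 ≤ kap) (hsmall : lam * (1 + d * k : ℕ) * 8 ≤ 7 / 8) :
    ∃ (π : Measure (State d k n)) (ν : (Fin d → EqualPartition n k) → Measure (Fin n → ℕ)),
      IsStationaryLaw lam kap π ∧ IsLocalEquilibrium lam kap ν ∧
      (∀ f : (Fin n → ℕ) → ℝ, (∃ B : ℝ, ∀ Q, |f Q| ≤ B) → ∫ s, f s.queue ∂π =
        (∑ G : Fin d → EqualPartition n k, ∫ Q, f Q ∂ν G) /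
          Fintype.card (Fin d → EqualPartition n k)) ∧
      (∀ (σ : Equiv.Perm (Fin n)) (f : State d k n → ℝ), (∃ B : ℝ, ∀ s, |f s| ≤ B) →
        ∫ s, f (s.relabel σ) ∂π = ∫ s, f s ∂π) := by
  classical
  obtain ⟨π, hπ, hgen, htail, hu, hrel⟩ :=
    exists_stationary (d := d) (k := k) (n := n) hl hk hsmall
  have hc : (0 : ℝ) < Fintype.card (Fin d → EqualPartition n k) := by
    exact_mod_cast Fintype.card_pos
  have hind : ∀ G j, ∫ Q, ind j Q ∂condQueue π G =
      Fintype.card (Fin d → EqualPartition n k) * ∫ s, gInd G j s ∂π := by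
    intro G j
    rw [integral_condQueue hu]
    rfl
  have harr : ∀ G j w, ∫ Q, arr G j w Q ∂condQueue π G =
      Fintype.card (Fin d → EqualPartition n k) * ∫ s, gArr G j w s ∂π := by
    intro G j w
    rw [integral_condQueue hu]
    rfl
  have hig : ∀ G j, Integrable (gInd G j) π := fun G j =>
    integrable_of_abs_le (B := 1) fun s => by
      rw [abs_of_nonneg (gInd_nonneg _ _ _)]; exact gInd_le_one _ _ _
  have his : ∀ G j G' j', Integrable (fun s => gInd G j s - gInd G' j' s) π :=
    fun G j G' j' => (hig G j).sub (hig G' j')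
  have hia : ∀ G j w, Integrable (gArr G j w) π := fun G j w =>
    integrable_of_abs_le (B := (1 + d * k : ℕ)) fun s => by
      unfold gArr
      split_ifs
      · exact abs_arr_le _ _ _ _
      · rw [abs_zero]; positivity
  refine ⟨π, condQueue π, ⟨hπ, fun t _ f hf => integral_semigroup_eq hl hk π hgen hf t, ?_⟩,
    ⟨fun G => isProbabilityMeasure_condQueue hu G, ?_, ?_, ?_⟩, ?_, hrel⟩
  · intro _ G G'
    have h1 := real_graph_eq hu G
    rw [← real_graph_eq hu G'] at h1
    rwa [measureReal_eq_measureReal_iff] at h1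
  · intro G j
    rw [hind]
    have := mul_le_mul_of_nonneg_left (htail G j) hc.le
    rwa [mul_div_cancel₀ _ hc.ne'] at this
  · rintro σ G f ⟨B, hB⟩
    rw [integral_condQueue hu, integral_condQueue hu]
    congr 1
    rw [← hrel σ]
    · refine integral_congr_ae (.of_forall fun s => ?_)
      have h1 : (s.relabel σ).graph = (fun i => (G i).relabel σ) ↔ s.graph = G := by
        constructor
        · intro h
          funext i
          exact (EqualPartition.relabelEquiv σ).injective (congrFun h i)
        · rintro rfl; rfl
      simp only [h1]
      rfl
    · refine ⟨B, fun s => ?_⟩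
      split_ifs
      · exact hB _
      · rw [abs_zero]; exact (abs_nonneg _).trans (hB s.queue)
  · intro G j
    have h1 := hgen (gInd G j) ⟨1, fun s => by
      rw [abs_of_nonneg (gInd_nonneg _ _ _)]; exact gInd_le_one _ _ _⟩
    simp only [gen_gInd] at h1
    have i1 : Integrable (fun s => ∑ v ∈ Finset.univ.filter (fun v => j v ≠ 0),
        (gInd G (j + Pi.single v 1) s - gInd G j s)) π :=
      integrable_finsetSum _ fun v _ => his _ _ _ _
    have i2 : Integrable (fun s => ∑ w ∈ Finset.univ.filter (fun v => j v ≠ 0),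
        gArr G j w s) π := integrable_finsetSum _ fun w _ => hia _ _ _
    have i3 : ∀ v i, Integrable (fun s => (n : ℝ)⁻¹ * ∑ w : Fin n,
          (gInd (moveGraph G i v w) j s - gInd G j s)) π := fun v i =>
      (integrable_finsetSum _ fun w _ => his _ _ _ _).const_mul _
    have i4 : Integrable (fun s => ∑ v : Fin n, ∑ i : Fin d, (n : ℝ)⁻¹ * ∑ w : Fin n,
          (gInd (moveGraph G i v w) j s - gInd G j s)) π :=
      integrable_finsetSum _ fun v _ => integrable_finsetSum _ fun i _ => i3 v i
    have hsplit : ∀ F₁ F₂ F₃ : State d k n → ℝ, Integrable F₁ π → Integrable F₂ π →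
        Integrable F₃ π → ∫ s, F₁ s + lam * F₂ s + kap * F₃ s ∂π =
          ∫ s, F₁ s ∂π + lam * ∫ s, F₂ s ∂π + kap * ∫ s, F₃ s ∂π := by
      intro F₁ F₂ F₃ h₁ h₂ h₃
      rw [integral_add (f := fun s => F₁ s + lam * F₂ s) (h₁.add (h₂.const_mul _))
        (h₃.const_mul _), integral_add h₁ (h₂.const_mul _), integral_const_mul, integral_const_mul]
    rw [hsplit _ _ _ i1 i2 i4, integral_finsetSum _ fun v _ => his _ _ _ _, integral_finsetSum _ fun w _ => hia _ _ _,
      integral_finsetSum _ fun v _ => integrable_finsetSum _ fun i _ => i3 v i] at h1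
    simp only [hind, harr]
    have h2 : ∀ v i, ∫ s, (n : ℝ)⁻¹ * ∑ w : Fin n,
          (gInd (moveGraph G i v w) j s - gInd G j s) ∂π = (n : ℝ)⁻¹ * ∑ w : Fin n,
          (∫ s, gInd (moveGraph G i v w) j s ∂π - ∫ s, gInd G j s ∂π) := by
      intro v i
      rw [integral_const_mul, integral_finsetSum _ fun w _ => his _ _ _ _]
      simp only [integral_sub (hig _ _) (hig _ _)]
    simp only [integral_finsetSum _ fun i _ => i3 _ i, h2, integral_sub (hig _ _) (hig _ _)] at h1
    rw [← mul_zero (Fintype.card (Fin d → EqualPartition n k) : ℝ), ← h1]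
    simp only [Finset.mul_sum, mul_add, mul_sub]
    congr 1
    · congr 1
      refine Finset.sum_congr rfl fun w _ => by ring
    · refine Finset.sum_congr rfl fun v _ => Finset.sum_congr rfl fun i _ =>
        Finset.sum_congr rfl fun w _ => by ring
  · rintro f ⟨B, hB⟩
    exact integral_queue_eq hu hB

/-! ### Partitions as permutations of slots -/

/-- The partitions in which `v` sits in the slot `τ i v`, the hyperedges being intervals of `k`
slots. -/
def graphOf (hk : 0 < k) (hkn : k ∣ n) (τ : Fin d → Equiv.Perm (Fin n)) :
    Fin d → EqualPartition n k :=
  fun i => (slotPartition hk hkn).relabel (τ i)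

theorem graphOf_rel (hk : 0 < k) (hkn : k ∣ n) (τ : Fin d → Equiv.Perm (Fin n)) (i : Fin d)
    (u v : Fin n) : (graphOf hk hkn τ i).rel u v ↔ (τ i u : ℕ) / k = (τ i v : ℕ) / k := Iff.rfl

/-- Permute the vertices before looking up the slots of label `i`. -/
def rmul (τ : Fin d → Equiv.Perm (Fin n)) (i : Fin d) (σ : Equiv.Perm (Fin n)) :
    Fin d → Equiv.Perm (Fin n) := Function.update τ i (τ i * σ)

/-- Permute the slots of label `i`. -/
def lmul (τ : Fin d → Equiv.Perm (Fin n)) (i : Fin d) (θ : Equiv.Perm (Fin n)) :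
    Fin d → Equiv.Perm (Fin n) := Function.update τ i (θ * τ i)

theorem rmul_rmul (τ : Fin d → Equiv.Perm (Fin n)) (i : Fin d) (σ σ' : Equiv.Perm (Fin n)) :
    rmul (rmul τ i σ) i σ' = rmul τ i (σ * σ') := by
  simp [rmul, mul_assoc]

theorem lmul_lmul (τ : Fin d → Equiv.Perm (Fin n)) (i : Fin d) (θ θ' : Equiv.Perm (Fin n)) :
    lmul (lmul τ i θ) i θ' = lmul τ i (θ' * θ) := by
  simp [lmul, mul_assoc]

theorem rmul_one (τ : Fin d → Equiv.Perm (Fin n)) (i : Fin d) : rmul τ i 1 = τ := by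
  simp [rmul]

theorem lmul_one (τ : Fin d → Equiv.Perm (Fin n)) (i : Fin d) : lmul τ i 1 = τ := by
  simp [lmul]

theorem graphOf_rmul_swap (hk : 0 < k) (hkn : k ∣ n) (τ : Fin d → Equiv.Perm (Fin n)) (i : Fin d)
    (v w : Fin n) :
    graphOf hk hkn (rmul τ i (Equiv.swap v w)) = moveGraph (graphOf hk hkn τ) i v w := by
  funext i'
  unfold graphOf rmul moveGraph
  by_cases h : i' = i
  · subst h
    rw [Function.update_self, Function.update_self]
    rfl
  · rw [Function.update_of_ne h, Function.update_of_ne h]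

/-- Slots are auxiliary: permuting them while respecting the intervals does not change the
partitions. This redundancy lets a vertex be put into any unused class. -/
theorem graphOf_lmul (hk : 0 < k) (hkn : k ∣ n) (τ : Fin d → Equiv.Perm (Fin n)) (i : Fin d)
    (θ : Equiv.Perm (Fin n))
    (hθ : ∀ a b, (θ a : ℕ) / k = (θ b : ℕ) / k ↔ (a : ℕ) / k = (b : ℕ) / k) :
    graphOf hk hkn (lmul τ i θ) = graphOf hk hkn τ := by
  funext i'
  refine EqualPartition.ext_rel (Setoid.ext fun u v => ?_)
  rw [graphOf_rel, graphOf_rel]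
  unfold lmul
  by_cases h : i' = i
  · subst h
    rw [Function.update_self]
    exact hθ _ _
  · rw [Function.update_of_ne h]

/-- A partial assignment of slots to vertices: a finite set of triples
(label, vertex, slot), with injective restriction to each label. -/
structure Valid (n : ℕ) (K : Finset (Fin d × ℕ × ℕ)) : Prop where
  vertex_lt : ∀ t ∈ K, t.2.1 < n
  slot_lt : ∀ t ∈ K, t.2.2 < n
  inj : ∀ t ∈ K, ∀ t' ∈ K, t.1 = t'.1 → (t.2.1 = t'.2.1 ↔ t.2.2 = t'.2.2)

theorem Valid.mono {K K' : Finset (Fin d × ℕ × ℕ)} (h : Valid n K') (hK : K ⊆ K') :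
    Valid n K :=
  ⟨fun t ht => h.vertex_lt t (hK ht), fun t ht => h.slot_lt t (hK ht),
    fun t ht t' ht' => h.inj t (hK ht) t' (hK ht')⟩

theorem Valid.eq_of_vertex {K : Finset (Fin d × ℕ × ℕ)} (h : Valid n K) {i : Fin d} {v a a' : ℕ}
    (h1 : (i, v, a) ∈ K) (h2 : (i, v, a') ∈ K) : a = a' :=
  (h.inj _ h1 _ h2 rfl).1 rfl

theorem Valid.eq_of_slot {K : Finset (Fin d × ℕ × ℕ)} (h : Valid n K) {i : Fin d} {v v' a : ℕ}
    (h1 : (i, v, a) ∈ K) (h2 : (i, v', a) ∈ K) : v = v' :=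
  (h.inj _ h1 _ h2 rfl).2 rfl

/-- The permutations extending a partial assignment. -/
def Ext (n : ℕ) (K : Finset (Fin d × ℕ × ℕ)) : Finset (Fin d → Equiv.Perm (Fin n)) :=
  open Classical in Finset.univ.filter fun τ =>
    ∀ t ∈ K, ∀ h : t.2.1 < n, (τ t.1 ⟨t.2.1, h⟩ : ℕ) = t.2.2

theorem mem_Ext {K : Finset (Fin d × ℕ × ℕ)} {τ : Fin d → Equiv.Perm (Fin n)} :
    τ ∈ Ext n K ↔ ∀ t ∈ K, ∀ h : t.2.1 < n, (τ t.1 ⟨t.2.1, h⟩ : ℕ) = t.2.2 := by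
  simp [Ext]

theorem mem_Ext_rmul {K : Finset (Fin d × ℕ × ℕ)} {τ : Fin d → Equiv.Perm (Fin n)} {i : Fin d}
    {σ : Equiv.Perm (Fin n)}
    (hσ : ∀ t ∈ K, t.1 = i → ∀ h : t.2.1 < n, σ ⟨t.2.1, h⟩ = ⟨t.2.1, h⟩) :
    rmul τ i σ ∈ Ext n K ↔ τ ∈ Ext n K := by
  rw [mem_Ext, mem_Ext]
  refine forall_congr' fun t => forall_congr' fun ht => forall_congr' fun h => ?_
  by_cases hi : t.1 = i
  · subst hi
    simp [rmul, hσ t ht rfl h]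
  · simp [rmul, Function.update_of_ne hi]

theorem mem_Ext_lmul {K : Finset (Fin d × ℕ × ℕ)} {τ : Fin d → Equiv.Perm (Fin n)} {i : Fin d}
    {θ : Equiv.Perm (Fin n)}
    (hθ : ∀ t ∈ K, t.1 = i → ∀ h : t.2.2 < n, θ ⟨t.2.2, h⟩ = ⟨t.2.2, h⟩) :
    lmul τ i θ ∈ Ext n K ↔ τ ∈ Ext n K := by
  rw [mem_Ext, mem_Ext]
  refine forall_congr' fun t => forall_congr' fun ht => forall_congr' fun h => ?_
  by_cases hi : t.1 = i
  · subst hi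
    simp only [lmul, Function.update_self, Equiv.Perm.mul_apply]
    constructor
    · intro h1
      have h2 : t.2.2 < n := h1 ▸ (θ _).2
      have h3 : θ (τ t.1 ⟨t.2.1, h⟩) = θ ⟨t.2.2, h2⟩ := by
        rw [hθ t ht rfl h2]; exact Fin.ext h1
      exact congrArg Fin.val (θ.injective h3)
    · intro h1
      have h2 : t.2.2 < n := h1 ▸ (τ _ _).2
      have h3 : τ t.1 ⟨t.2.1, h⟩ = ⟨t.2.2, h2⟩ := Fin.ext h1
      rw [h3, hθ t ht rfl h2]
  · simp [lmul, Function.update_of_ne hi]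

theorem mem_Ext_iff_erase {K : Finset (Fin d × ℕ × ℕ)} {t : Fin d × ℕ × ℕ} (ht : t ∈ K)
    {τ : Fin d → Equiv.Perm (Fin n)} (h : t.2.1 < n) :
    τ ∈ Ext n K ↔ τ ∈ Ext n (K.erase t) ∧ (τ t.1 ⟨t.2.1, h⟩ : ℕ) = t.2.2 := by
  rw [mem_Ext, mem_Ext]
  constructor
  · intro h1
    exact ⟨fun t' ht' => h1 t' (Finset.mem_of_mem_erase ht'), h1 t ht h⟩
  · rintro ⟨h1, h2⟩ t' ht'
    by_cases he : t' = t
    · subst he; exact fun _ => h2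
    · exact h1 t' (Finset.mem_erase.2 ⟨he, ht'⟩)

/-- The vertices not used by `K` for the label `i`. -/
def freeVertices (n : ℕ) (K : Finset (Fin d × ℕ × ℕ)) (i : Fin d) : Finset (Fin n) :=
  open Classical in Finset.univ.filter fun w => ∀ t ∈ K, t.1 = i → t.2.1 ≠ w

/-- The slots not used by `K` for the label `i`. -/
def freeSlots (n : ℕ) (K : Finset (Fin d × ℕ × ℕ)) (i : Fin d) : Finset (Fin n) :=
  open Classical in Finset.univ.filter fun a => ∀ t ∈ K, t.1 = i → t.2.2 ≠ a

theorem mem_freeVertices {K : Finset (Fin d × ℕ × ℕ)} {i : Fin d} {w : Fin n} :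
    w ∈ freeVertices n K i ↔ ∀ t ∈ K, t.1 = i → t.2.1 ≠ w := by
  simp [freeVertices]

theorem mem_freeSlots {K : Finset (Fin d × ℕ × ℕ)} {i : Fin d} {w : Fin n} :
    w ∈ freeSlots n K i ↔ ∀ t ∈ K, t.1 = i → t.2.2 ≠ w := by
  simp [freeSlots]

theorem card_compl_le_of_forall {S : Finset (Fin n)} {ι : Type*} (A : Finset ι) (f : ι → ℕ)
    (h : ∀ w : Fin n, w ∉ S → ∃ t ∈ A, f t = w) : (Finset.univ \ S).card ≤ A.card := by
  classical
  calc (Finset.univ \ S).card = ((Finset.univ \ S).map Fin.valEmbedding).card := by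
        rw [Finset.card_map]
    _ ≤ (A.image f).card := by
        refine Finset.card_le_card fun x hx => ?_
        rw [Finset.mem_map] at hx
        obtain ⟨w, hw, rfl⟩ := hx
        obtain ⟨t, ht, htw⟩ := h w (Finset.mem_sdiff.1 hw).2
        exact Finset.mem_image.2 ⟨t, ht, htw⟩
    _ ≤ A.card := Finset.card_image_le

theorem card_compl_freeVertices_le (K : Finset (Fin d × ℕ × ℕ)) (i : Fin d) :
    (Finset.univ \ freeVertices n K i).card ≤ K.card := by
  refine card_compl_le_of_forall K (fun t => t.2.1) fun w hw => ?_
  rw [mem_freeVertices] at hw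
  push Not at hw
  obtain ⟨t, ht, -, h⟩ := hw
  exact ⟨t, ht, h⟩

theorem card_compl_freeSlots_le (K : Finset (Fin d × ℕ × ℕ)) (i : Fin d) :
    (Finset.univ \ freeSlots n K i).card ≤ K.card := by
  refine card_compl_le_of_forall K (fun t => t.2.2) fun w hw => ?_
  rw [mem_freeSlots] at hw
  push Not at hw
  obtain ⟨t, ht, -, h⟩ := hw
  exact ⟨t, ht, h⟩

theorem le_card_of_card_compl_le {S : Finset (Fin n)} {m : ℕ}
    (h : (Finset.univ \ S).card ≤ m) : (n : ℝ) - m ≤ S.card := by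
  have h1 := Finset.card_sdiff_add_card_eq_card (Finset.subset_univ S)
  rw [Finset.card_univ, Fintype.card_fin] at h1
  have h2 : n ≤ m + S.card := by omega
  have h3 : (n : ℝ) ≤ m + S.card := by exact_mod_cast h2
  linarith

theorem Valid.ne_vertex_of_mem_erase {K : Finset (Fin d × ℕ × ℕ)} (hK : Valid n K)
    {t t' : Fin d × ℕ × ℕ} (ht : t ∈ K) (ht' : t' ∈ K.erase t) (hi : t'.1 = t.1) :
    t'.2.1 ≠ t.2.1 := by
  intro h
  refine Finset.ne_of_mem_erase ht' (Prod.ext hi (Prod.ext h ?_))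
  exact (hK.inj t' (Finset.mem_of_mem_erase ht') t ht hi).1 h

theorem Valid.ne_slot_of_mem_erase {K : Finset (Fin d × ℕ × ℕ)} (hK : Valid n K)
    {t t' : Fin d × ℕ × ℕ} (ht : t ∈ K) (ht' : t' ∈ K.erase t) (hi : t'.1 = t.1) :
    t'.2.2 ≠ t.2.2 := by
  intro h
  refine Finset.ne_of_mem_erase ht' (Prod.ext hi (Prod.ext ?_ h))
  exact (hK.inj t' (Finset.mem_of_mem_erase ht') t ht hi).2 h

/-- Decomposition of the extensions of `K.erase t` according to the vertex in the slot of `t`. -/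
theorem sum_Ext_erase_vertex {K : Finset (Fin d × ℕ × ℕ)} (hK : Valid n K)
    {t : Fin d × ℕ × ℕ} (ht : t ∈ K) (X : (Fin d → Equiv.Perm (Fin n)) → ℝ) :
    ∑ τ ∈ Ext n (K.erase t), X τ = ∑ w ∈ freeVertices n (K.erase t) t.1, ∑ τ ∈ Ext n K,
      X (rmul τ t.1 (Equiv.swap ⟨t.2.1, hK.vertex_lt t ht⟩ w)) := by
  classical
  set v : Fin n := ⟨t.2.1, hK.vertex_lt t ht⟩ with hv
  set a : Fin n := ⟨t.2.2, hK.slot_lt t ht⟩ with ha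
  have hfix : ∀ w ∈ freeVertices n (K.erase t) t.1, ∀ t' ∈ K.erase t, t'.1 = t.1 →
      ∀ h : t'.2.1 < n, Equiv.swap v w ⟨t'.2.1, h⟩ = ⟨t'.2.1, h⟩ := by
    intro w hw t' ht' hi h
    refine Equiv.swap_apply_of_ne_of_ne ?_ ?_
    · intro he
      exact hK.ne_vertex_of_mem_erase ht ht' hi (congrArg Fin.val he)
    · intro he
      exact mem_freeVertices.1 hw t' ht' hi (congrArg Fin.val he)
  have hmap : ∀ τ ∈ Ext n (K.erase t), (τ t.1).symm a ∈ freeVertices n (K.erase t) t.1 := by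
    intro τ hτ
    rw [mem_freeVertices]
    intro t' ht' hi he
    have h1 := mem_Ext.1 hτ t' ht' (hK.vertex_lt t' (Finset.mem_of_mem_erase ht'))
    have h2 : (⟨t'.2.1, hK.vertex_lt t' (Finset.mem_of_mem_erase ht')⟩ : Fin n) =
        (τ t.1).symm a := Fin.ext he
    rw [h2, hi, Equiv.apply_symm_apply] at h1
    exact hK.ne_slot_of_mem_erase ht ht' hi h1.symm
  rw [← Finset.sum_fiberwise_of_maps_to hmap]
  refine Finset.sum_congr rfl fun w hw => ?_
  -- If w occupies the slot of t, swapping w with the vertex of t produces an extension of K, and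
  -- the swap is its own inverse. Both vertices are free for the other triples of this label.
  refine Finset.sum_nbij' (fun τ => rmul τ t.1 (Equiv.swap v w))
    (fun τ => rmul τ t.1 (Equiv.swap v w)) ?_ ?_ ?_ ?_ ?_
  · intro τ hτ
    rw [Finset.mem_filter] at hτ
    rw [mem_Ext_iff_erase ht (hK.vertex_lt t ht), mem_Ext_rmul (hfix w hw)]
    refine ⟨hτ.1, ?_⟩
    show ((rmul τ t.1 (Equiv.swap v w)) t.1 v : ℕ) = a
    rw [rmul, Function.update_self, Equiv.Perm.mul_apply, Equiv.swap_apply_left, ← hτ.2,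
      Equiv.apply_symm_apply]
  · intro τ hτ
    rw [mem_Ext_iff_erase ht (hK.vertex_lt t ht)] at hτ
    rw [Finset.mem_filter, mem_Ext_rmul (hfix w hw)]
    refine ⟨hτ.1, ?_⟩
    rw [Equiv.symm_apply_eq, rmul, Function.update_self, Equiv.Perm.mul_apply,
      Equiv.swap_apply_right]
    exact (Fin.ext hτ.2).symm
  · intro τ _
    rw [rmul_rmul, Equiv.swap_mul_self, rmul_one]
  · intro τ _
    rw [rmul_rmul, Equiv.swap_mul_self, rmul_one]
  · intro τ _
    rw [rmul_rmul, Equiv.swap_mul_self, rmul_one]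

/-- Decomposition of the extensions of `K.erase t` according to the slot of the vertex of `t`. -/
theorem sum_Ext_erase_slot {K : Finset (Fin d × ℕ × ℕ)} (hK : Valid n K)
    {t : Fin d × ℕ × ℕ} (ht : t ∈ K) (X : (Fin d → Equiv.Perm (Fin n)) → ℝ) :
    ∑ τ ∈ Ext n (K.erase t), X τ = ∑ w ∈ freeSlots n (K.erase t) t.1, ∑ τ ∈ Ext n K,
      X (lmul τ t.1 (Equiv.swap ⟨t.2.2, hK.slot_lt t ht⟩ w)) := by
  classical
  set v : Fin n := ⟨t.2.1, hK.vertex_lt t ht⟩ with hv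
  set a : Fin n := ⟨t.2.2, hK.slot_lt t ht⟩ with ha
  have hfix : ∀ w ∈ freeSlots n (K.erase t) t.1, ∀ t' ∈ K.erase t, t'.1 = t.1 →
      ∀ h : t'.2.2 < n, Equiv.swap a w ⟨t'.2.2, h⟩ = ⟨t'.2.2, h⟩ := by
    intro w hw t' ht' hi h
    refine Equiv.swap_apply_of_ne_of_ne ?_ ?_
    · intro he
      exact hK.ne_slot_of_mem_erase ht ht' hi (congrArg Fin.val he)
    · intro he
      exact mem_freeSlots.1 hw t' ht' hi (congrArg Fin.val he)
  have hmap : ∀ τ ∈ Ext n (K.erase t), τ t.1 v ∈ freeSlots n (K.erase t) t.1 := by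
    intro τ hτ
    rw [mem_freeSlots]
    intro t' ht' hi he
    have h1 := mem_Ext.1 hτ t' ht' (hK.vertex_lt t' (Finset.mem_of_mem_erase ht'))
    rw [he, hi] at h1
    have h2 := (τ t.1).injective (Fin.ext h1)
    exact hK.ne_vertex_of_mem_erase ht ht' hi (congrArg Fin.val h2)
  rw [← Finset.sum_fiberwise_of_maps_to hmap]
  refine Finset.sum_congr rfl fun w hw => ?_
  refine Finset.sum_nbij' (fun τ => lmul τ t.1 (Equiv.swap a w))
    (fun τ => lmul τ t.1 (Equiv.swap a w)) ?_ ?_ ?_ ?_ ?_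
  · intro τ hτ
    rw [Finset.mem_filter] at hτ
    rw [mem_Ext_iff_erase ht (hK.vertex_lt t ht), mem_Ext_lmul (hfix w hw)]
    refine ⟨hτ.1, ?_⟩
    show ((lmul τ t.1 (Equiv.swap a w)) t.1 v : ℕ) = a
    rw [lmul, Function.update_self, Equiv.Perm.mul_apply, hτ.2, Equiv.swap_apply_right]
  · intro τ hτ
    rw [mem_Ext_iff_erase ht (hK.vertex_lt t ht)] at hτ
    rw [Finset.mem_filter, mem_Ext_lmul (hfix w hw)]
    refine ⟨hτ.1, ?_⟩
    have h1 : τ t.1 v = a := Fin.ext hτ.2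
    rw [lmul, Function.update_self, Equiv.Perm.mul_apply, h1, Equiv.swap_apply_left]
  · intro τ _
    rw [lmul_lmul, Equiv.swap_mul_self, lmul_one]
  · intro τ _
    rw [lmul_lmul, Equiv.swap_mul_self, lmul_one]
  · intro τ _
    rw [lmul_lmul, Equiv.swap_mul_self, lmul_one]

theorem card_Ext_erase_vertex {K : Finset (Fin d × ℕ × ℕ)} (hK : Valid n K)
    {t : Fin d × ℕ × ℕ} (ht : t ∈ K) :
    (Ext n (K.erase t)).card = (freeVertices n (K.erase t) t.1).card * (Ext n K).card := by
  have := sum_Ext_erase_vertex hK ht (fun _ => 1)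
  simp only [Finset.sum_const, nsmul_eq_mul, mul_one] at this
  exact_mod_cast this

theorem card_Ext_erase_slot {K : Finset (Fin d × ℕ × ℕ)} (hK : Valid n K)
    {t : Fin d × ℕ × ℕ} (ht : t ∈ K) :
    (Ext n (K.erase t)).card = (freeSlots n (K.erase t) t.1).card * (Ext n K).card := by
  have := sum_Ext_erase_slot hK ht (fun _ => 1)
  simp only [Finset.sum_const, nsmul_eq_mul, mul_one] at this
  exact_mod_cast this

theorem card_Ext_pos {K : Finset (Fin d × ℕ × ℕ)} (hK : Valid n K) : 0 < (Ext n K).card := by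
  induction K using Finset.induction_on with
  | empty => exact Finset.card_pos.2 ⟨1, mem_Ext.2 (by simp)⟩
  | insert t K ht ih =>
    have h1 := ih (hK.mono (Finset.subset_insert t K))
    have h2 := card_Ext_erase_vertex hK (Finset.mem_insert_self t K)
    rw [Finset.erase_insert ht] at h2
    rw [h2] at h1
    exact pos_of_mul_pos_right h1 (Nat.zero_le _)

/-- The mean over the extensions of `K`. -/
def avg (n : ℕ) (K : Finset (Fin d × ℕ × ℕ)) (X : (Fin d → Equiv.Perm (Fin n)) → ℝ) : ℝ :=
  (∑ τ ∈ Ext n K, X τ) / (Ext n K).card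

theorem avg_congr {K : Finset (Fin d × ℕ × ℕ)} {X Y : (Fin d → Equiv.Perm (Fin n)) → ℝ}
    (h : ∀ τ ∈ Ext n K, X τ = Y τ) : avg n K X = avg n K Y := by
  unfold avg; rw [Finset.sum_congr rfl h]

theorem avg_const {K : Finset (Fin d × ℕ × ℕ)} (hK : Valid n K) (c : ℝ) :
    avg n K (fun _ => c) = c := by
  have : ((Ext n K).card : ℝ) ≠ 0 := by exact_mod_cast (card_Ext_pos hK).ne'
  simp [avg, this]

theorem avg_add (K : Finset (Fin d × ℕ × ℕ)) (X Y : (Fin d → Equiv.Perm (Fin n)) → ℝ) :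
    avg n K (fun τ => X τ + Y τ) = avg n K X + avg n K Y := by
  simp [avg, Finset.sum_add_distrib, add_div]

theorem avg_sub (K : Finset (Fin d × ℕ × ℕ)) (X Y : (Fin d → Equiv.Perm (Fin n)) → ℝ) :
    avg n K (fun τ => X τ - Y τ) = avg n K X - avg n K Y := by
  simp [avg, Finset.sum_sub_distrib, sub_div]

theorem avg_mul (K : Finset (Fin d × ℕ × ℕ)) (c : ℝ) (X : (Fin d → Equiv.Perm (Fin n)) → ℝ) :
    avg n K (fun τ => c * X τ) = c * avg n K X := by
  simp [avg, ← Finset.mul_sum, mul_div_assoc]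

theorem avg_sum (K : Finset (Fin d × ℕ × ℕ)) {ι : Type*} (S : Finset ι)
    (X : ι → (Fin d → Equiv.Perm (Fin n)) → ℝ) :
    avg n K (fun τ => ∑ x ∈ S, X x τ) = ∑ x ∈ S, avg n K (X x) := by
  unfold avg
  rw [Finset.sum_comm, Finset.sum_div]

theorem abs_avg_le {K : Finset (Fin d × ℕ × ℕ)}
    {X : (Fin d → Equiv.Perm (Fin n)) → ℝ} {B : ℝ} (hB : 0 ≤ B) (hX : ∀ τ, |X τ| ≤ B) :
    |avg n K X| ≤ B := by
  unfold avg
  rw [abs_div, Nat.abs_cast]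
  refine div_le_of_le_mul₀ (Nat.cast_nonneg _) hB ?_
  refine (Finset.abs_sum_le_sum_abs _ _).trans ?_
  refine (Finset.sum_le_sum fun τ _ => hX τ).trans ?_
  simp [mul_comm]

theorem avg_erase_vertex {K : Finset (Fin d × ℕ × ℕ)} (hK : Valid n K)
    {t : Fin d × ℕ × ℕ} (ht : t ∈ K) (X : (Fin d → Equiv.Perm (Fin n)) → ℝ) :
    (freeVertices n (K.erase t) t.1).card * avg n (K.erase t) X =
      ∑ w ∈ freeVertices n (K.erase t) t.1,
        avg n K (fun τ => X (rmul τ t.1 (Equiv.swap ⟨t.2.1, hK.vertex_lt t ht⟩ w))) := by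
  have h1 : ((Ext n K).card : ℝ) ≠ 0 := by exact_mod_cast (card_Ext_pos hK).ne'
  have h0 := card_Ext_pos (hK.mono (Finset.erase_subset t K))
  rw [card_Ext_erase_vertex hK ht] at h0
  have h2 : ((freeVertices n (K.erase t) t.1).card : ℝ) ≠ 0 := by
    exact_mod_cast (pos_of_mul_pos_left h0 (Nat.zero_le _)).ne'
  unfold avg
  rw [sum_Ext_erase_vertex hK ht, card_Ext_erase_vertex hK ht, Nat.cast_mul, ← Finset.sum_div]
  field_simp

theorem avg_erase_slot {K : Finset (Fin d × ℕ × ℕ)} (hK : Valid n K)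
    {t : Fin d × ℕ × ℕ} (ht : t ∈ K) (X : (Fin d → Equiv.Perm (Fin n)) → ℝ) :
    (freeSlots n (K.erase t) t.1).card * avg n (K.erase t) X =
      ∑ w ∈ freeSlots n (K.erase t) t.1,
        avg n K (fun τ => X (lmul τ t.1 (Equiv.swap ⟨t.2.2, hK.slot_lt t ht⟩ w))) := by
  have h1 : ((Ext n K).card : ℝ) ≠ 0 := by exact_mod_cast (card_Ext_pos hK).ne'
  have h0 := card_Ext_pos (hK.mono (Finset.erase_subset t K))
  rw [card_Ext_erase_slot hK ht] at h0
  have h2 : ((freeSlots n (K.erase t) t.1).card : ℝ) ≠ 0 := by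
    exact_mod_cast (pos_of_mul_pos_left h0 (Nat.zero_le _)).ne'
  unfold avg
  rw [sum_Ext_erase_slot hK ht, card_Ext_erase_slot hK ht, Nat.cast_mul, ← Finset.sum_div]
  field_simp

/-- If `m * a` is a sum of `m` terms bounded by `B`, all but a few of which equal `b`, then `a` is
close to `b`. -/
theorem abs_sub_le_of_sum_eq {ι : Type*} [DecidableEq ι] {W F : Finset ι} (hF : F ⊆ W) {Y : ι → ℝ} {a b B : ℝ}
    (hsum : (W.card : ℝ) * a = ∑ w ∈ W, Y w) (hY : ∀ w, |Y w| ≤ B) (hb : |b| ≤ B)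
    (hYF : ∀ w ∈ F, Y w = b) {e : ℝ}
    (he : ((W \ F).card : ℝ) * (2 * B) ≤ e * W.card) (hW : 0 < W.card) : |a - b| ≤ e := by
  have h1 : (W.card : ℝ) * (a - b) = ∑ w ∈ W \ F, (Y w - b) := by
    have h2 : ∑ w ∈ W, (Y w - b) = ∑ w ∈ W \ F, (Y w - b) := by
      rw [← Finset.sum_sdiff hF, Finset.sum_eq_zero (s := F) fun w hw => by rw [hYF w hw, sub_self],
        add_zero]
    rw [← h2, Finset.sum_sub_distrib, ← hsum, Finset.sum_const, nsmul_eq_mul]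
    ring
  have h3 : |∑ w ∈ W \ F, (Y w - b)| ≤ ((W \ F).card : ℝ) * (2 * B) := by
    refine (Finset.abs_sum_le_sum_abs _ _).trans ?_
    have : ∀ w ∈ W \ F, |Y w - b| ≤ 2 * B := fun w _ => by
      refine (abs_sub _ _).trans ?_
      linarith [hY w]
    refine (Finset.sum_le_sum this).trans ?_
    rw [Finset.sum_const, nsmul_eq_mul]
  have hW' : (0 : ℝ) < W.card := by exact_mod_cast hW
  have h4 : (W.card : ℝ) * |a - b| ≤ W.card * e := by
    rw [← abs_of_pos hW', ← abs_mul, abs_of_pos hW', h1]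
    linarith
  exact le_of_mul_le_mul_left h4 hW'

/-! ### The effect of moves, and of revealing a fresh slot or vertex -/

set_option maxHeartbeats 800000 in
/-- Averaged over the extensions of `K`, the generator of the swaps of label `i` removes the triples
of label `i` from `K` at rate two each, up to a small error. -/
theorem abs_sum_moves_sub_le {K : Finset (Fin d × ℕ × ℕ)} (hK : Valid n K) (i : Fin d)
    {X : (Fin d → Equiv.Perm (Fin n)) → ℝ} {B : ℝ} (hX : ∀ τ, |X τ| ≤ B) :
    |(∑ v : Fin n, ∑ w : Fin n, (avg n K (fun τ => X (rmul τ i (Equiv.swap v w))) - avg n K X))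
      - 2 * n * ∑ t ∈ K.filter (fun t => t.1 = i), (avg n (K.erase t) X - avg n K X)| ≤
      6 * B * K.card * (K.filter (fun t => t.1 = i)).card := by
  classical
  have hB : 0 ≤ B := (abs_nonneg _).trans (hX 1)
  set Z : Fin n → Fin n → ℝ := fun v w =>
    avg n K (fun τ => X (rmul τ i (Equiv.swap v w))) - avg n K X with hZ
  have hZB : ∀ v w, |Z v w| ≤ 2 * B := fun v w => by
    refine (abs_sub _ _).trans ?_
    have := abs_avg_le (K := K) (X := fun τ => X (rmul τ i (Equiv.swap v w))) hB (fun τ => hX _)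
    have := abs_avg_le (K := K) hB hX
    linarith
  have hZsymm : ∀ v w, Z v w = Z w v := fun v w => by
    simp only [hZ, Equiv.swap_comm v w]
  have hZself : ∀ v, Z v v = 0 := fun v => by
    simp only [hZ, Equiv.swap_self]
    have : ∀ τ : Fin d → Equiv.Perm (Fin n), rmul τ i (Equiv.refl (Fin n)) = τ := fun τ => rmul_one τ i
    simp [this]
  set F := freeVertices n K i with hF
  -- Swapping two vertices that K does not use permutes the extensions of K, so it has no effect on
  -- the average. Only swaps that touch a revealed vertex remain.
  have hZfree : ∀ v ∈ F, ∀ w ∈ F, Z v w = 0 := by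
    intro v hv w hw
    rw [hF, mem_freeVertices] at hv hw
    have hfix : ∀ t ∈ K, t.1 = i → ∀ h : t.2.1 < n,
        Equiv.swap v w ⟨t.2.1, h⟩ = ⟨t.2.1, h⟩ := fun t ht hi h =>
      Equiv.swap_apply_of_ne_of_ne (fun he => hv t ht hi (congrArg Fin.val he))
        (fun he => hw t ht hi (congrArg Fin.val he))
    simp only [hZ, avg]
    rw [sub_eq_zero]
    congr 1
    refine Finset.sum_nbij' (fun τ => rmul τ i (Equiv.swap v w))
      (fun τ => rmul τ i (Equiv.swap v w)) ?_ ?_ ?_ ?_ ?_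
    · intro τ hτ; rwa [mem_Ext_rmul hfix]
    · intro τ hτ; rwa [mem_Ext_rmul hfix]
    · intro τ _; rw [rmul_rmul, Equiv.swap_mul_self, rmul_one]
    · intro τ _; rw [rmul_rmul, Equiv.swap_mul_self, rmul_one]
    · intro τ _; rfl
  set Ki := K.filter (fun t => t.1 = i) with hKi
  have hcompl : ∀ f : Fin n → ℝ, ∑ v ∈ Finset.univ \ F, f v =
      ∑ t ∈ Ki.attach, f ⟨t.1.2.1, hK.vertex_lt t.1 (Finset.mem_of_mem_filter _ t.2)⟩ := by
    intro f
    symm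
    refine Finset.sum_bij (fun t _ =>
      ⟨t.1.2.1, hK.vertex_lt t.1 (Finset.mem_of_mem_filter _ t.2)⟩) ?_ ?_ ?_ ?_
    · intro t _
      have ht := Finset.mem_filter.1 t.2
      simp only [Finset.mem_sdiff, Finset.mem_univ, true_and, hF, mem_freeVertices]
      intro h
      exact h t.1 ht.1 ht.2 rfl
    · intro t _ t' _ h
      have ht := Finset.mem_filter.1 t.2
      have ht' := Finset.mem_filter.1 t'.2
      have h1 : t.1.2.1 = t'.1.2.1 := congrArg Fin.val h
      have h2 : t.1.1 = t'.1.1 := ht.2.trans ht'.2.symm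
      exact Subtype.ext (Prod.ext h2 (Prod.ext h1 ((hK.inj _ ht.1 _ ht'.1 h2).1 h1)))
    · intro v hv
      simp only [Finset.mem_sdiff, Finset.mem_univ, true_and, hF, mem_freeVertices] at hv
      push Not at hv
      obtain ⟨t, ht, hi, h⟩ := hv
      exact ⟨⟨t, Finset.mem_filter.2 ⟨ht, hi⟩⟩, Finset.mem_attach _ _, Fin.ext h⟩
    · intro t _; rfl
  -- By symmetry in v and w, each revealed vertex enters once as first and once as second partner.
  -- This is the factor 2 in the rate of forgetting.
  have hsplit : ∑ v, ∑ w, Z v w = ∑ v ∈ Finset.univ \ F, (∑ w, Z v w + ∑ w ∈ F, Z v w) := by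
    have h1 : ∑ v ∈ F, ∑ w, Z v w = ∑ v ∈ Finset.univ \ F, ∑ w ∈ F, Z v w := by
      rw [Finset.sum_comm, ← Finset.sum_sdiff (Finset.subset_univ F),
        Finset.sum_eq_zero (s := F) fun w hw => Finset.sum_eq_zero fun v hv => hZfree v hv w hw,
        add_zero]
      exact Finset.sum_congr rfl fun w _ => Finset.sum_congr rfl fun v _ => hZsymm v w
    rw [Finset.sum_add_distrib, ← h1, ← Finset.sum_sdiff (Finset.subset_univ F)]
  have hatt : ∑ t ∈ Ki, (avg n (K.erase t) X - avg n K X) =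
      ∑ t ∈ Ki.attach, (avg n (K.erase t.1) X - avg n K X) :=
    (Finset.sum_attach Ki fun t => avg n (K.erase t) X - avg n K X).symm
  rw [hsplit, hcompl, hatt, Finset.mul_sum, ← Finset.sum_sub_distrib]
  refine (Finset.abs_sum_le_sum_abs _ _).trans ?_
  have hmain : ∀ t ∈ Ki.attach,
      |∑ w, Z ⟨t.1.2.1, hK.vertex_lt t.1 (Finset.mem_of_mem_filter _ t.2)⟩ w +
        ∑ w ∈ F, Z ⟨t.1.2.1, hK.vertex_lt t.1 (Finset.mem_of_mem_filter _ t.2)⟩ w -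
        2 * n * (avg n (K.erase t.1) X - avg n K X)| ≤ 6 * B * K.card := by
    rintro ⟨t, ht0⟩ -
    obtain ⟨ht, hi⟩ := Finset.mem_filter.1 ht0
    subst hi
    set v : Fin n := ⟨t.2.1, hK.vertex_lt t ht⟩ with hv
    set W := freeVertices n (K.erase t) t.1 with hW
    set δ := avg n (K.erase t) X - avg n K X with hδ
    have hδB : |δ| ≤ 2 * B := by
      refine (abs_sub _ _).trans ?_
      have := abs_avg_le (K := K.erase t) hB hX
      have := abs_avg_le (K := K) hB hX
      linarith
    have h1 : ∑ w ∈ W, Z v w = W.card * δ := by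
      have := avg_erase_vertex hK ht X
      simp only [hZ, hδ]
      rw [Finset.sum_sub_distrib, ← this, Finset.sum_const, nsmul_eq_mul, mul_sub]
    have h2 : ∑ w ∈ F, Z v w = ∑ w ∈ W, Z v w := by
      have hFW : F ⊆ W := fun w hw => by
        rw [hW, mem_freeVertices]
        intro t' ht'
        exact mem_freeVertices.1 hw t' (Finset.mem_of_mem_erase ht')
      refine Finset.sum_subset hFW fun w hw hwF => ?_
      have : w = v := by
        rw [hF, mem_freeVertices] at hwF
        push Not at hwF
        obtain ⟨t', ht', hi', h'⟩ := hwF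
        by_cases he : t' = t
        · subst he; exact Fin.ext h'.symm
        · exact absurd h' (mem_freeVertices.1 hw t' (Finset.mem_erase.2 ⟨he, ht'⟩) hi')
      rw [this, hZself]
    have h3 : ∑ w, Z v w = W.card * δ + ∑ w ∈ Finset.univ \ W, Z v w := by
      rw [← Finset.sum_sdiff (Finset.subset_univ W), h1, add_comm]
    have hcard : ((Finset.univ \ W).card : ℝ) ≤ K.card := by
      have h4 := card_compl_freeVertices_le (n := n) (K.erase t) t.1
      exact_mod_cast h4.trans (Finset.card_le_card (Finset.erase_subset t K))
    have hWn : (W.card : ℝ) = n - (Finset.univ \ W).card := by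
      have h4 := Finset.card_sdiff_add_card_eq_card (Finset.subset_univ W)
      rw [Finset.card_univ, Fintype.card_fin] at h4
      have h5 : ((Finset.univ \ W).card : ℝ) + W.card = n := by exact_mod_cast h4
      linarith
    have h5 : |∑ w ∈ Finset.univ \ W, Z v w| ≤ K.card * (2 * B) := by
      refine (Finset.abs_sum_le_sum_abs _ _).trans ((Finset.sum_le_sum fun w _ => hZB v w).trans ?_)
      rw [Finset.sum_const, nsmul_eq_mul]
      exact mul_le_mul_of_nonneg_right hcard (by linarith)
    show |∑ w, Z v w + ∑ w ∈ F, Z v w - 2 * n * δ| ≤ _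
    rw [h2, h1, h3, hWn]
    -- Two errors remain: swaps with partners outside W, at most 2·B·|K|, and the replacement of |W|
    -- by n in both copies, at most 4·B·|K|.
    have h6 : (n - ((Finset.univ \ W).card : ℝ)) * δ + ∑ w ∈ Finset.univ \ W, Z v w +
        (n - ((Finset.univ \ W).card : ℝ)) * δ - 2 * n * δ =
        ∑ w ∈ Finset.univ \ W, Z v w - 2 * ((Finset.univ \ W).card : ℝ) * δ := by ring
    rw [h6]
    refine (abs_sub _ _).trans ?_
    rw [abs_mul, abs_of_nonneg (by positivity : (0 : ℝ) ≤ 2 * ((Finset.univ \ W).card : ℝ))]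
    have h7 : 2 * ((Finset.univ \ W).card : ℝ) * |δ| ≤ 2 * K.card * (2 * B) := by gcongr
    have h8 : 6 * B * (K.card : ℝ) = K.card * (2 * B) + 2 * K.card * (2 * B) := by ring
    rw [h8]
    exact add_le_add h5 h7
  refine (Finset.sum_le_sum hmain).trans ?_
  rw [Finset.sum_const, Finset.card_attach, nsmul_eq_mul, mul_comm]

/-- Exchange of two classes of slots that exchanges the slots `a` and `b`. -/
def slotSwap (k a b x : ℕ) : ℕ :=
  k * Equiv.swap (a / k) (b / k) (x / k) +
    if x / k = a / k ∨ x / k = b / k then Equiv.swap (a % k) (b % k) (x % k) else x % k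

theorem slotSwap_offset_lt (hk : 0 < k) (a b x : ℕ) :
    (if x / k = a / k ∨ x / k = b / k then Equiv.swap (a % k) (b % k) (x % k) else x % k) < k := by
  have h1 := Nat.mod_lt a hk
  have h2 := Nat.mod_lt b hk
  have h3 := Nat.mod_lt x hk
  split_ifs
  · rw [Equiv.swap_apply_def]; split_ifs <;> assumption
  · assumption

theorem slotSwap_div (hk : 0 < k) (a b x : ℕ) :
    slotSwap k a b x / k = Equiv.swap (a / k) (b / k) (x / k) := by
  unfold slotSwap
  rw [Nat.mul_add_div hk, Nat.div_eq_of_lt (slotSwap_offset_lt hk a b x), add_zero]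

theorem slotSwap_mod (hk : 0 < k) (a b x : ℕ) :
    slotSwap k a b x % k = if x / k = a / k ∨ x / k = b / k then
      Equiv.swap (a % k) (b % k) (x % k) else x % k := by
  unfold slotSwap
  rw [Nat.mul_add_mod, Nat.mod_eq_of_lt (slotSwap_offset_lt hk a b x)]

theorem slotSwap_slotSwap (hk : 0 < k) (a b x : ℕ) :
    slotSwap k a b (slotSwap k a b x) = x := by
  conv_lhs => rw [slotSwap]
  rw [slotSwap_div hk, slotSwap_mod hk, Equiv.swap_apply_self]
  have h : (Equiv.swap (a / k) (b / k) (x / k) = a / k ∨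
      Equiv.swap (a / k) (b / k) (x / k) = b / k) ↔ (x / k = a / k ∨ x / k = b / k) := by
    rw [Equiv.swap_apply_eq_iff, Equiv.swap_apply_left, Equiv.swap_apply_eq_iff,
      Equiv.swap_apply_right, or_comm]
  simp only [h]
  conv_rhs => rw [← Nat.div_add_mod x k]
  congr 1
  split_ifs
  · rw [Equiv.swap_apply_self]
  · rfl

theorem slotSwap_right (a b : ℕ) : slotSwap k a b b = a := by
  simp [slotSwap, Nat.div_add_mod]

theorem slotSwap_of_ne {a b x : ℕ} (ha : x / k ≠ a / k) (hb : x / k ≠ b / k) :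
    slotSwap k a b x = x := by
  simp [slotSwap, ha, hb, Equiv.swap_apply_of_ne_of_ne ha hb, Nat.div_add_mod]

theorem slotSwap_lt (hk : 0 < k) (hkn : k ∣ n) {a b x : ℕ} (ha : a < n) (hb : b < n) (hx : x < n) :
    slotSwap k a b x < n := by
  obtain ⟨m, rfl⟩ := hkn
  have h : ∀ y, y / k < m ↔ y < k * m := fun y => by
    rw [Nat.div_lt_iff_lt_mul hk, mul_comm]
  rw [← h] at *
  rw [slotSwap_div hk, Equiv.swap_apply_def]
  split_ifs <;> assumption

/-- For every two slots there is a permutation of the slots which respects the classes, takes the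
second slot to the first one, and moves only slots in the classes of the two. -/
theorem exists_slot_perm (hk : 0 < k) (hkn : k ∣ n) (a b : Fin n) :
    ∃ θ : Equiv.Perm (Fin n),
      (∀ x y, (θ x : ℕ) / k = (θ y : ℕ) / k ↔ (x : ℕ) / k = (y : ℕ) / k) ∧ θ b = a ∧
      ∀ x : Fin n, (x : ℕ) / k ≠ (a : ℕ) / k → (x : ℕ) / k ≠ (b : ℕ) / k → θ x = x := by
  let f : Fin n → Fin n := fun x => ⟨slotSwap k a b x, slotSwap_lt hk hkn a.2 b.2 x.2⟩
  have hf : Function.Involutive f := fun x => Fin.ext (slotSwap_slotSwap hk a b x)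
  refine ⟨hf.toPerm f, ?_, ?_, ?_⟩
  · intro x y
    show slotSwap k a b x / k = slotSwap k a b y / k ↔ _
    rw [slotSwap_div hk, slotSwap_div hk, (Equiv.swap _ _).injective.eq_iff]
  · exact Fin.ext (slotSwap_right _ _)
  · intro x hxa hxb
    exact Fin.ext (slotSwap_of_ne hxa hxb)

/-- At most m bad choices among at least n/2, each costing at most 2·B. -/
theorem card_sdiff_mul_le {W F : Finset (Fin n)} {B : ℝ} (hB : 0 ≤ B) {m : ℕ}
    (hF : (Finset.univ \ F).card ≤ m) (hW : (n : ℝ) ≤ 2 * W.card) (hn : 0 < n) :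
    ((W \ F).card : ℝ) * (2 * B) ≤ (4 * B * m / n) * W.card := by
  have h1 : ((W \ F).card : ℝ) ≤ m := by
    exact_mod_cast (Finset.card_le_card (Finset.sdiff_subset_sdiff (Finset.subset_univ W)
      (Finset.Subset.refl F))).trans hF
  have hn' : (0 : ℝ) < n := by exact_mod_cast hn
  calc ((W \ F).card : ℝ) * (2 * B) ≤ m * (2 * B) := by gcongr
    _ = (4 * B * m / n) * (n / 2) := by field_simp; ring
    _ ≤ _ := by
      gcongr
      linarith

/-- Revealing the slot of a vertex, in a class of slots not used yet. -/
theorem abs_avg_insert_slot_le (hk : 0 < k) (hkn : k ∣ n) {K : Finset (Fin d × ℕ × ℕ)}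
    {t : Fin d × ℕ × ℕ} (htK : t ∉ K) (hK : Valid n (insert t K))
    (hfresh : ∀ t' ∈ K, t'.1 = t.1 → t'.2.2 / k ≠ t.2.2 / k)
    (hcard : 2 * K.card ≤ n)
    {X : (Fin d → Equiv.Perm (Fin n)) → ℝ} {B : ℝ} (hX : ∀ τ, |X τ| ≤ B)
    (hXsymm : ∀ τ i (θ : Equiv.Perm (Fin n)),
      (∀ a b, (θ a : ℕ) / k = (θ b : ℕ) / k ↔ (a : ℕ) / k = (b : ℕ) / k) →
      X (lmul τ i θ) = X τ) :
    |avg n K X - avg n (insert t K) X| ≤ 4 * B * (k * K.card : ℕ) / n := by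
  classical
  have hB : 0 ≤ B := (abs_nonneg _).trans (hX 1)
  have htm := Finset.mem_insert_self t K
  have hn : 0 < n := (Nat.zero_le _).trans_lt (hK.vertex_lt t htm)
  have hsum := avg_erase_slot hK htm X
  rw [Finset.erase_insert htK] at hsum
  set a : Fin n := ⟨t.2.2, hK.slot_lt t htm⟩ with ha
  set W := freeSlots n K t.1 with hW
  set F : Finset (Fin n) := Finset.univ.filter fun b =>
    ∀ t' ∈ K, t'.1 = t.1 → t'.2.2 / k ≠ (b : ℕ) / k with hF
  have hFW : F ⊆ W := by
    intro b hb
    rw [hF, Finset.mem_filter] at hb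
    rw [hW, mem_freeSlots]
    intro t' ht' hi he
    exact hb.2 t' ht' hi (by rw [he])
  have hWn : (n : ℝ) ≤ 2 * W.card := by
    have h1 := le_card_of_card_compl_le (card_compl_freeSlots_le (n := n) K t.1)
    have h2 : (2 : ℝ) * K.card ≤ n := by exact_mod_cast hcard
    linarith
  have hFc : (Finset.univ \ F).card ≤ k * K.card := by
    have h1 : (Finset.univ \ F).card ≤ ((Finset.range k) ×ˢ K).card :=
      card_compl_le_of_forall _ (fun p => k * (p.2.2.2 / k) + p.1) fun b hb => by
        simp only [hF, Finset.mem_filter, Finset.mem_univ, true_and] at hb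
        push Not at hb
        obtain ⟨t', ht', -, h⟩ := hb
        exact ⟨((b : ℕ) % k, t'), Finset.mem_product.2
          ⟨Finset.mem_range.2 (Nat.mod_lt _ hk), ht'⟩, by
            show k * (t'.2.2 / k) + (b : ℕ) % k = b
            rw [h, Nat.div_add_mod]⟩
    rwa [Finset.card_product, Finset.card_range] at h1
  refine abs_sub_le_of_sum_eq hFW hsum (B := B)
    (fun w => abs_avg_le hB fun τ => hX _) (abs_avg_le hB hX) ?_
    (card_sdiff_mul_le hB hFc hWn hn) ?_
  · intro b hb
    have hb2 := (Finset.mem_filter.1 hb).2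
    obtain ⟨θ, hθ, hθb, hθfix⟩ := exists_slot_perm hk hkn a b
    -- The swap of a and b followed by θ fixes a and every slot of K, because the classes of a and
    -- of b are both unused by K. So it permutes the extensions, while θ alone does not change X.
    -- Hence putting the vertex into b is as good as putting it into a.
    have hfix : ∀ t' ∈ insert t K, t'.1 = t.1 → ∀ h : t'.2.2 < n,
        (θ * Equiv.swap a b) ⟨t'.2.2, h⟩ = ⟨t'.2.2, h⟩ := by
      intro t' ht' hi h
      rw [Equiv.Perm.mul_apply]
      rcases Finset.mem_insert.1 ht' with rfl | ht'
      · show θ (Equiv.swap a b a) = a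
        rw [Equiv.swap_apply_left, hθb]
      · have h1 := hfresh t' ht' hi
        have h2 := hb2 t' ht' hi
        rw [Equiv.swap_apply_of_ne_of_ne]
        · exact hθfix _ h1 h2
        · intro he; exact h1 (congrArg (· / k) (congrArg Fin.val he))
        · intro he; exact h2 (congrArg (· / k) (congrArg Fin.val he))
    unfold avg
    congr 1
    refine Finset.sum_nbij' (fun τ => lmul τ t.1 (θ * Equiv.swap a b))
      (fun τ => lmul τ t.1 (θ * Equiv.swap a b)⁻¹) ?_ ?_ ?_ ?_ ?_
    · intro τ hτ; rwa [mem_Ext_lmul hfix]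
    · intro τ hτ
      rwa [mem_Ext_lmul]
      intro t' ht' hi h
      rw [Equiv.Perm.inv_eq_iff_eq, hfix t' ht' hi h]
    · intro τ _; rw [lmul_lmul, inv_mul_cancel, lmul_one]
    · intro τ _; rw [lmul_lmul, mul_inv_cancel, lmul_one]
    · intro τ _
      rw [← lmul_lmul, hXsymm _ _ _ hθ]
  · rw [← Nat.cast_pos (α := ℝ)]
    have : (0 : ℝ) < n := by exact_mod_cast hn
    linarith

/-- Revealing the vertex in a slot, the vertex being not used yet. -/
theorem abs_avg_insert_vertex_le {K : Finset (Fin d × ℕ × ℕ)} {J : Finset ℕ}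
    {t : Fin d × ℕ × ℕ} (htK : t ∉ K) (hK : Valid n (insert t K))
    (hfresh : ∀ t' ∈ K, t'.2.1 ≠ t.2.1) (htJ : t.2.1 ∉ J)
    (hcard : 2 * K.card ≤ n)
    {X : (Fin d → Equiv.Perm (Fin n)) → ℝ} {B : ℝ} (hX : ∀ τ, |X τ| ≤ B)
    (hXsymm : ∀ τ (v w : Fin n), (v : ℕ) ∉ J → (w : ℕ) ∉ J →
      X (fun i => τ i * Equiv.swap v w) = X τ) :
    |avg n K X - avg n (insert t K) X| ≤ 4 * B * (K.card + J.card : ℕ) / n := by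
  classical
  have hB : 0 ≤ B := (abs_nonneg _).trans (hX 1)
  have htm := Finset.mem_insert_self t K
  have hn : 0 < n := (Nat.zero_le _).trans_lt (hK.vertex_lt t htm)
  have hsum := avg_erase_vertex hK htm X
  rw [Finset.erase_insert htK] at hsum
  set v : Fin n := ⟨t.2.1, hK.vertex_lt t htm⟩ with hv
  set W := freeVertices n K t.1 with hW
  set F : Finset (Fin n) := Finset.univ.filter fun b =>
    (∀ t' ∈ K, t'.2.1 ≠ (b : ℕ)) ∧ (b : ℕ) ∉ J with hF
  have hFW : F ⊆ W := by
    intro b hb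
    rw [hF, Finset.mem_filter] at hb
    rw [hW, mem_freeVertices]
    intro t' ht' _
    exact hb.2.1 t' ht'
  have hWn : (n : ℝ) ≤ 2 * W.card := by
    have h1 := le_card_of_card_compl_le (card_compl_freeVertices_le (n := n) K t.1)
    have h2 : (2 : ℝ) * K.card ≤ n := by exact_mod_cast hcard
    linarith
  have hFc : (Finset.univ \ F).card ≤ K.card + J.card := by
    have h1 : (Finset.univ \ F).card ≤ (K.disjSum J).card :=
      card_compl_le_of_forall _ (Sum.elim (fun t => t.2.1) id) fun b hb => by
        simp only [hF, Finset.mem_filter, Finset.mem_univ, true_and, not_and_or, not_not] at hb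
        push Not at hb
        rcases hb with ⟨t', ht', h⟩ | h
        · exact ⟨Sum.inl t', by simpa using ht', h⟩
        · exact ⟨Sum.inr b, by simpa using h, rfl⟩
    rwa [Finset.card_disjSum] at h1
  refine abs_sub_le_of_sum_eq hFW hsum (B := B)
    (fun w => abs_avg_le hB fun τ => hX _) (abs_avg_le hB hX) ?_
    (card_sdiff_mul_le hB hFc hWn hn) ?_
  · intro w hw
    have hw2 := (Finset.mem_filter.1 hw).2
    -- The swap of v and w in label t.1 differs from the swap in all labels, under which X is
    -- invariant, by the swap in all the other labels. The latter permutes the extensions, since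
    -- neither vertex occurs in K.
    set g : (Fin d → Equiv.Perm (Fin n)) → (Fin d → Equiv.Perm (Fin n)) := fun τ i =>
      if i = t.1 then τ i else τ i * Equiv.swap v w with hg
    have hgg : ∀ τ, g (g τ) = τ := by
      intro τ
      funext i
      simp only [hg]
      split_ifs
      · rfl
      · rw [mul_assoc, Equiv.swap_mul_self, mul_one]
    have hgE : ∀ τ ∈ Ext n (insert t K), g τ ∈ Ext n (insert t K) := by
      intro τ hτ
      rw [mem_Ext] at hτ ⊢
      intro t' ht' h
      rw [← hτ t' ht' h]
      simp only [hg]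
      split_ifs with hi
      · rfl
      · rw [Equiv.Perm.mul_apply, Equiv.swap_apply_of_ne_of_ne]
        · intro he
          rcases Finset.mem_insert.1 ht' with rfl | ht'
          · exact hi rfl
          · exact hfresh t' ht' (congrArg Fin.val he)
        · intro he
          rcases Finset.mem_insert.1 ht' with rfl | ht'
          · exact hi rfl
          · exact hw2.1 t' ht' (congrArg Fin.val he)
    unfold avg
    congr 1
    refine Finset.sum_nbij' g g hgE hgE (fun τ _ => hgg τ) (fun τ _ => hgg τ) ?_
    intro τ _
    rw [← hXsymm (rmul τ t.1 (Equiv.swap v w)) v w htJ hw2.2]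
    congr 1
    funext i
    simp only [hg, rmul]
    split_ifs with hi
    · subst hi
      rw [Function.update_self, mul_assoc, Equiv.swap_mul_self, mul_one]
    · rw [Function.update_of_ne hi]
  · rw [← Nat.cast_pos (α := ℝ)]
    have : (0 : ℝ) < n := by exact_mod_cast hn
    linarith

/-! ### Fresh completions of partial assignments -/

/-- The neighbourhood of `v` as far as it is known from `K`. -/
def NB (k : ℕ) (K : Finset (Fin d × ℕ × ℕ)) (v : ℕ) : Finset ℕ :=
  insert v ((K.filter fun t' => ∃ t ∈ K, t.1 = t'.1 ∧ t.2.1 = v ∧ t.2.2 / k = t'.2.2 / k).image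
    fun t' => t'.2.1)

theorem mem_NB {K : Finset (Fin d × ℕ × ℕ)} {u v : ℕ} :
    u ∈ NB k K v ↔ u = v ∨ ∃ i a a', (i, v, a) ∈ K ∧ (i, u, a') ∈ K ∧ a / k = a' / k := by
  unfold NB
  rw [Finset.mem_insert]
  refine or_congr_right ?_
  simp only [Finset.mem_image, Finset.mem_filter]
  constructor
  · rintro ⟨⟨i, u', a'⟩, ⟨h1, ⟨i', v', a⟩, h2, h3, h4, h5⟩, h6⟩
    simp only at h3 h4 h5 h6
    subst h3 h4 h6
    exact ⟨i', a, a', h2, h1, h5⟩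
  · rintro ⟨i, a, a', h1, h2, h3⟩
    exact ⟨(i, u, a'), ⟨h2, (i, v, a), h1, rfl, rfl, h3⟩, rfl⟩

theorem self_mem_NB {K : Finset (Fin d × ℕ × ℕ)} {v : ℕ} : v ∈ NB k K v := mem_NB.2 (Or.inl rfl)

theorem mem_NB_comm {K : Finset (Fin d × ℕ × ℕ)} {u v : ℕ} : u ∈ NB k K v ↔ v ∈ NB k K u := by
  rw [mem_NB, mem_NB]
  constructor
  · rintro (h | ⟨i, a, a', h1, h2, h3⟩)
    · exact Or.inl h.symm
    · exact Or.inr ⟨i, a', a, h2, h1, h3.symm⟩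
  · rintro (h | ⟨i, a, a', h1, h2, h3⟩)
    · exact Or.inl h.symm
    · exact Or.inr ⟨i, a', a, h2, h1, h3.symm⟩

/-- A known neighbour is determined by its label and its position within the hyperedge. -/
theorem card_NB_le (hk : 0 < k) {K : Finset (Fin d × ℕ × ℕ)} (hK : Valid n K) (v : ℕ) :
    (NB k K v).card ≤ 1 + d * k := by
  unfold NB
  refine (Finset.card_insert_le _ _).trans ?_
  rw [add_comm]
  refine Nat.add_le_add_left (Finset.card_image_le.trans ?_) 1
  have h1 : ((Finset.univ : Finset (Fin d)) ×ˢ Finset.range k).card = d * k := by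
    rw [Finset.card_product, Finset.card_univ, Fintype.card_fin, Finset.card_range]
  rw [← h1]
  refine Finset.card_le_card_of_injOn (fun t => (t.1, t.2.2 % k)) ?_ ?_
  · intro t _
    simp [Nat.mod_lt _ hk]
  · rintro ⟨i, u, a⟩ h ⟨i', u', a'⟩ h' he
    simp only [Finset.coe_filter, Set.mem_ofPred_eq] at h h'
    simp only [Prod.mk.injEq] at he
    obtain ⟨rfl, he⟩ := he
    obtain ⟨h1, ⟨i2, v2, b⟩, h2, h3, h4, h5⟩ := h
    obtain ⟨h1', ⟨i2', v2', b'⟩, h2', h3', h4', h5'⟩ := h'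
    simp only at h3 h4 h5 h3' h4' h5'
    subst h3 h4 h3' h4'
    have h6 := hK.eq_of_vertex h2 h2'
    subst h6
    have h7 : a = a' := by
      rw [← Nat.div_add_mod a k, ← Nat.div_add_mod a' k, he, ← h5, ← h5']
    subst h7
    rw [hK.eq_of_slot h1 h1']

/-- The hyperedge of label `i` at `v` is completely known from `K`. -/
def IsFull (k : ℕ) (K : Finset (Fin d × ℕ × ℕ)) (i : Fin d) (v : ℕ) : Prop :=
  ∃ a, (i, v, a) ∈ K ∧ ∀ a', a' / k = a / k → ∃ u, (i, u, a') ∈ K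

/-- The hyperedges at all vertices of the neighbourhood of `w` are completely known from `K`. -/
def IsComplete (k : ℕ) (K : Finset (Fin d × ℕ × ℕ)) (w : ℕ) : Prop :=
  ∀ v ∈ NB k K w, ∀ i, IsFull k K i v

theorem IsFull.mono {K K' : Finset (Fin d × ℕ × ℕ)} (hK : K ⊆ K') {i : Fin d} {v : ℕ}
    (h : IsFull k K i v) : IsFull k K' i v := by
  obtain ⟨a, h1, h2⟩ := h
  refine ⟨a, hK h1, fun a' ha' => ?_⟩
  obtain ⟨u, hu⟩ := h2 a' ha'
  exact ⟨u, hK hu⟩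

/-- All slots of the hyperedges at v are already taken, so later revelations cannot add neighbours.
Hence completeness can be reached in two rounds. -/
theorem NB_subset_of_isFull {K K' : Finset (Fin d × ℕ × ℕ)} (hK : K ⊆ K') (hK' : Valid n K')
    {v : ℕ} (h : ∀ i, IsFull k K i v) : NB k K' v ⊆ NB k K v := by
  intro u hu
  rw [mem_NB] at hu ⊢
  refine hu.imp_right ?_
  rintro ⟨i, a, a', h1, h2, h3⟩
  obtain ⟨b, hb1, hb2⟩ := h i
  have := hK'.eq_of_vertex h1 (hK hb1)
  subst this
  obtain ⟨u', hu'⟩ := hb2 a' h3.symm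
  have := hK'.eq_of_slot h2 (hK hu')
  subst this
  exact ⟨i, a, a', hb1, hu', h3⟩

/-- Once the hyperedges at v are completely revealed, the neighbourhood is the same for all
extensions of K and can be read off from K. -/
theorem mem_nbhd_graphOf (hk : 0 < k) (hkn : k ∣ n) {K : Finset (Fin d × ℕ × ℕ)} (hK : Valid n K)
    {τ : Fin d → Equiv.Perm (Fin n)} (hτ : τ ∈ Ext n K) {v : Fin n}
    (hv : ∀ i, IsFull k K i v) (Q : Fin n → ℕ) (u : Fin n) :
    u ∈ (State.mk (graphOf hk hkn τ) Q).nbhd v ↔ (u : ℕ) ∈ NB k K v := by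
  rw [mem_nbhd_iff, mem_NB]
  rw [mem_Ext] at hτ
  have hval : ∀ i (w : Fin n) a, (i, (w : ℕ), a) ∈ K → (τ i w : ℕ) = a := fun i w a h =>
    hτ _ h w.2
  refine or_congr Fin.ext_iff ?_
  constructor
  · rintro ⟨i, h⟩
    have h : (τ i v : ℕ) / k = (τ i u : ℕ) / k := h
    obtain ⟨a, h1, h2⟩ := hv i
    rw [hval _ _ _ h1] at h
    obtain ⟨u', hu'⟩ := h2 _ h.symm
    have h3 := hτ _ hu' (hK.vertex_lt _ hu')
    have h4 := (τ i).injective (Fin.ext h3)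
    have h5 : u' = (u : ℕ) := congrArg Fin.val h4
    subst h5
    exact ⟨i, a, _, h1, hu', h⟩
  · rintro ⟨i, a, a', h1, h2, h3⟩
    refine ⟨i, ?_⟩
    show (τ i v : ℕ) / k = (τ i u : ℕ) / k
    rw [hval _ _ _ h1, hval _ _ _ h2, h3]

/-- All vertices of a known hyperedge have the same colour. -/
def IsMono (k : ℕ) (col : ℕ → Bool) (K : Finset (Fin d × ℕ × ℕ)) : Prop :=
  ∀ t ∈ K, ∀ t' ∈ K, t.1 = t'.1 → t.2.2 / k = t'.2.2 / k → col t.2.1 = col t'.2.1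

theorem IsMono.mono {col : ℕ → Bool} {K K' : Finset (Fin d × ℕ × ℕ)} (hK : K ⊆ K')
    (h : IsMono k col K') : IsMono k col K :=
  fun t ht t' ht' => h t (hK ht) t' (hK ht')

theorem IsMono.col_eq_of_mem_NB {col : ℕ → Bool} {K : Finset (Fin d × ℕ × ℕ)}
    (h : IsMono k col K) {u v : ℕ} (hu : u ∈ NB k K v) : col u = col v := by
  rw [mem_NB] at hu
  rcases hu with rfl | ⟨i, a, a', h1, h2, h3⟩
  · rfl
  · exact (h _ h1 _ h2 rfl h3).symm

/-- `Fresh n k col c J l K K'`: the partial assignment `K'` arises from `K` by adding `l` triples with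
vertices of colour `c`, each of which puts a vertex into a class of slots not used before, or a
vertex not used before (and not in `J`) into a slot. -/
inductive Fresh (n k : ℕ) (col : ℕ → Bool) (c : Bool) (J : Finset ℕ) :
    ℕ → Finset (Fin d × ℕ × ℕ) → Finset (Fin d × ℕ × ℕ) → Prop
  | refl (K) : Fresh n k col c J 0 K K
  | slot {l K K'} (h : Fresh n k col c J l K K') (i : Fin d) (b a : ℕ) (hb : b < n) (ha : a < n)
      (hc : col b = c) (hfb : ∀ t ∈ K', t.1 = i → t.2.1 ≠ b)
      (hfa : ∀ t ∈ K', t.1 = i → t.2.2 / k ≠ a / k) :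
      Fresh n k col c J (l + 1) K (insert (i, b, a) K')
  | vertex {l K K'} (h : Fresh n k col c J l K K') (i : Fin d) (b a : ℕ) (hb : b < n) (ha : a < n)
      (hc : col b = c) (hfb : ∀ t ∈ K', t.2.1 ≠ b) (hJ : b ∉ J)
      (hfa : ∀ t ∈ K', t.1 = i → t.2.2 ≠ a)
      (hm : ∀ t ∈ K', t.1 = i → t.2.2 / k = a / k → col t.2.1 = c) :
      Fresh n k col c J (l + 1) K (insert (i, b, a) K')

section Fresh

variable {col : ℕ → Bool} {c : Bool} {J : Finset ℕ} {l : ℕ} {K K' K'' : Finset (Fin d × ℕ × ℕ)}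

theorem Fresh.subset (h : Fresh n k col c J l K K') : K ⊆ K' := by
  induction h with
  | refl => exact subset_rfl
  | slot h i b a hb ha hc hfb hfa ih => exact ih.trans (Finset.subset_insert _ _)
  | vertex h i b a hb ha hc hfb hJ hfa hm ih => exact ih.trans (Finset.subset_insert _ _)

theorem Fresh.card_le (h : Fresh n k col c J l K K') : K'.card ≤ K.card + l := by
  induction h with
  | refl => exact le_rfl
  | slot h i b a hb ha hc hfb hfa ih =>
    exact (Finset.card_insert_le _ _).trans (by omega)
  | vertex h i b a hb ha hc hfb hJ hfa hm ih =>
    exact (Finset.card_insert_le _ _).trans (by omega)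

theorem valid_insert {i : Fin d} {b a : ℕ} (hK : Valid n K) (hb : b < n) (ha : a < n)
    (hfb : ∀ t ∈ K, t.1 = i → t.2.1 ≠ b) (hfa : ∀ t ∈ K, t.1 = i → t.2.2 ≠ a) :
    Valid n (insert (i, b, a) K) := by
  refine ⟨?_, ?_, ?_⟩
  · intro t ht
    rcases Finset.mem_insert.1 ht with rfl | ht
    · exact hb
    · exact hK.vertex_lt t ht
  · intro t ht
    rcases Finset.mem_insert.1 ht with rfl | ht
    · exact ha
    · exact hK.slot_lt t ht
  · intro t ht t' ht' hi
    rcases Finset.mem_insert.1 ht with rfl | ht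
    · rcases Finset.mem_insert.1 ht' with rfl | ht'
      · simp
      · exact iff_of_false (fun h => hfb t' ht' hi.symm h.symm) (fun h => hfa t' ht' hi.symm h.symm)
    · rcases Finset.mem_insert.1 ht' with rfl | ht'
      · exact iff_of_false (fun h => hfb t ht hi h) (fun h => hfa t ht hi h)
      · exact hK.inj t ht t' ht' hi

theorem Fresh.valid (h : Fresh n k col c J l K K') (hK : Valid n K) : Valid n K' := by
  induction h with
  | refl => exact hK
  | slot h i b a hb ha hc hfb hfa ih =>
    exact valid_insert (ih hK) hb ha hfb fun t ht hi he => hfa t ht hi (by rw [he])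
  | vertex h i b a hb ha hc hfb hJ hfa hm ih =>
    exact valid_insert (ih hK) hb ha (fun t ht _ => hfb t ht) hfa

theorem isMono_insert {i : Fin d} {b a : ℕ} (hK : IsMono k col K)
    (hm : ∀ t ∈ K, t.1 = i → t.2.2 / k = a / k → col t.2.1 = col b) :
    IsMono k col (insert (i, b, a) K) := by
  intro t ht t' ht' hi hs
  rcases Finset.mem_insert.1 ht with rfl | ht
  · rcases Finset.mem_insert.1 ht' with rfl | ht'
    · rfl
    · exact (hm t' ht' hi.symm hs.symm).symm
  · rcases Finset.mem_insert.1 ht' with rfl | ht'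
    · exact hm t ht hi hs
    · exact hK t ht t' ht' hi hs

theorem Fresh.isMono (h : Fresh n k col c J l K K') (hK : IsMono k col K) : IsMono k col K' := by
  induction h with
  | refl => exact hK
  | slot h i b a hb ha hc hfb hfa ih =>
    exact isMono_insert (ih hK) fun t ht hi he => absurd he (hfa t ht hi)
  | vertex h i b a hb ha hc hfb hJ hfa hm ih =>
    exact isMono_insert (ih hK) fun t ht hi he => (hm t ht hi he).trans hc.symm

theorem Fresh.trans {l' : ℕ} (h : Fresh n k col c J l K K') (h' : Fresh n k col c J l' K' K'') :
    Fresh n k col c J (l + l') K K'' := by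
  induction h' with
  | refl => exact h
  | slot h' i b a hb ha hc hfb hfa ih => exact (ih h).slot i b a hb ha hc hfb hfa
  | vertex h' i b a hb ha hc hfb hJ hfa hm ih => exact (ih h).vertex i b a hb ha hc hfb hJ hfa hm

theorem Fresh.of_le {m : ℕ} (h : Fresh n k col c J l K K') (hnm : n ≤ m) :
    Fresh m k col c J l K K' := by
  induction h with
  | refl => exact .refl _
  | slot h' i b a hb ha hc hfb hfa ih =>
    exact ih.slot i b a (hb.trans_le hnm) (ha.trans_le hnm) hc hfb hfa
  | vertex h' i b a hb ha hc hfb hJ hfa hm ih =>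
    exact ih.vertex i b a (hb.trans_le hnm) (ha.trans_le hnm) hc hfb hJ hfa hm

/-- The triples whose vertex has colour `c`. -/
def colK (col : ℕ → Bool) (c : Bool) (K : Finset (Fin d × ℕ × ℕ)) : Finset (Fin d × ℕ × ℕ) :=
  K.filter fun t => col t.2.1 = c

theorem colK_subset : colK col c K ⊆ K := Finset.filter_subset _ _

theorem mem_colK {t : Fin d × ℕ × ℕ} : t ∈ colK col c K ↔ t ∈ K ∧ col t.2.1 = c :=
  Finset.mem_filter

/-- Freshness is inherited by the part of one colour. This allows the equations of the hierarchy to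
be used for each factor of a product separately. -/
theorem Fresh.colK_self (h : Fresh n k col c J l K K') :
    Fresh n k col c (J.filter fun b => col b = c) l (colK col c K) (colK col c K') := by
  induction h with
  | refl => exact .refl _
  | slot h' i b a hb ha hc hfb hfa ih =>
    unfold colK
    rw [Finset.filter_insert, if_pos hc]
    exact ih.slot i b a hb ha hc (fun t ht => hfb t (colK_subset ht))
      (fun t ht => hfa t (colK_subset ht))
  | vertex h' i b a hb ha hc hfb hJ hfa hm ih =>
    unfold colK
    rw [Finset.filter_insert, if_pos hc]
    exact ih.vertex i b a hb ha hc (fun t ht => hfb t (colK_subset ht))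
      (fun h => hJ (Finset.mem_of_mem_filter _ h)) (fun t ht => hfa t (colK_subset ht))
      (fun t ht => hm t (colK_subset ht))

theorem Fresh.colK_of_ne {c' : Bool} (h : Fresh n k col c J l K K') (hc' : c ≠ c') :
    colK col c' K' = colK col c' K := by
  induction h with
  | refl => rfl
  | slot h' i b a hb ha hc hfb hfa ih =>
    rw [← ih, colK, Finset.filter_insert, if_neg (by simpa [hc] using hc')]; rfl
  | vertex h' i b a hb ha hc hfb hJ hfa hm ih =>
    rw [← ih, colK, Finset.filter_insert, if_neg (by simpa [hc] using hc')]; rfl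

/-- Monotone tasks, each of which can be done in `m` fresh steps, can be done together. -/
theorem Fresh.exists_forall {ι : Type*} (S : Finset ι) (P : ι → Finset (Fin d × ℕ × ℕ) → Prop)
    (hP : ∀ x K K', K ⊆ K' → P x K → P x K') (m N : ℕ)
    (hstep : ∀ x ∈ S, ∀ K₁, K ⊆ K₁ → Valid n K₁ → IsMono k col K₁ → K₁.card + m ≤ N →
      ∃ l ≤ m, ∃ K₂, Fresh n k col c J l K₁ K₂ ∧ P x K₂)
    (hv : Valid n K) (hm : IsMono k col K) (hN : K.card + m * S.card ≤ N) :
    ∃ l ≤ m * S.card, ∃ K', Fresh n k col c J l K K' ∧ ∀ x ∈ S, P x K' := by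
  classical
  induction S using Finset.induction_on with
  | empty => exact ⟨0, Nat.zero_le _, K, .refl _, by simp⟩
  | insert x S hx ih =>
    rw [Finset.card_insert_of_notMem hx] at hN ⊢
    obtain ⟨l, hl, K', hK', hS⟩ := ih (fun y hy => hstep y (Finset.mem_insert_of_mem hy))
      (by nlinarith)
    obtain ⟨l', hl', K'', hK'', hx'⟩ := hstep x (Finset.mem_insert_self x S) K' hK'.subset
      (hK'.valid hv) (hK'.isMono hm) (by have := hK'.card_le; nlinarith)
    refine ⟨l + l', by nlinarith, K'', hK'.trans hK'', fun y hy => ?_⟩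
    rcases Finset.mem_insert.1 hy with rfl | hy
    · exact hx'
    · exact hP y _ _ hK''.subset (hS y hy)

theorem exists_notMem_of_injOn {f : ℕ → ℕ} (hf : Function.Injective f) (S : Finset ℕ) :
    ∃ x ≤ S.card, f x ∉ S := by
  by_contra! h
  have h1 : ((Finset.range (S.card + 1)).image f).card ≤ S.card :=
    Finset.card_le_card fun y hy => by
      obtain ⟨x, hx, rfl⟩ := Finset.mem_image.1 hy
      exact h x (Nat.lt_succ_iff.1 (Finset.mem_range.1 hx))
  rw [Finset.card_image_of_injective _ hf, Finset.card_range] at h1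
  omega

theorem Fresh.exists_slot (hk : 0 < k) (i : Fin d) {v : ℕ} (hvn : v < n)
    (hvc : col v = c) (hn : k * (K.card + 1) ≤ n) :
    ∃ l ≤ 1, ∃ K', Fresh n k col c J l K K' ∧ ∃ a, (i, v, a) ∈ K' := by
  by_cases h : ∃ a, (i, v, a) ∈ K
  · exact ⟨0, Nat.zero_le _, K, .refl _, h⟩
  -- Among the first |K| + 1 classes one is unused; v goes into its first slot.
  · obtain ⟨x, hx, hxS⟩ := exists_notMem_of_injOn Function.injective_id
      (K.image fun t => t.2.2 / k)
    have hx' : x ≤ K.card := hx.trans Finset.card_image_le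
    have hxn : k * x < n := by
      have : k * x < k * (x + 1) := by nlinarith
      have := Nat.mul_le_mul_left k (show x + 1 ≤ K.card + 1 by omega)
      omega
    refine ⟨1, le_rfl, insert (i, v, k * x) K, ?_, k * x, Finset.mem_insert_self _ _⟩
    refine (Fresh.refl K).slot i v (k * x) hvn hxn hvc ?_ ?_
    · rintro ⟨i', v', a'⟩ ht rfl rfl
      exact h ⟨a', ht⟩
    · intro t ht _ he
      rw [Nat.mul_div_cancel_left _ hk] at he
      exact hxS (Finset.mem_image.2 ⟨t, ht, he⟩)

/-- Every colour has its x-th vertex at most at 2·x + 1, so a vertex of the required colour outside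
K and J exists below n. Taking the colour of the hyperedge keeps it monochromatic. -/
theorem Fresh.exists_vertex (hcol : ∀ c, ∃ f : ℕ → ℕ, Function.Injective f ∧
      ∀ x, col (f x) = c ∧ f x ≤ 2 * x + 1) (hm : IsMono k col K) (i : Fin d) {w a a' : ℕ}
    (hw : (i, w, a) ∈ K) (hwc : col w = c) (haa' : a' / k = a / k) (ha' : a' < n)
    (hn : 2 * (K.card + J.card + 1) ≤ n) :
    ∃ l ≤ 1, ∃ K', Fresh n k col c J l K K' ∧ ∃ u, (i, u, a') ∈ K' := by
  by_cases h : ∃ u, (i, u, a') ∈ K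
  · exact ⟨0, Nat.zero_le _, K, .refl _, h⟩
  · obtain ⟨f, hf, hfc⟩ := hcol c
    obtain ⟨x, hx, hxS⟩ := exists_notMem_of_injOn hf ((K.image fun t => t.2.1) ∪ J)
    have hx' : x ≤ K.card + J.card :=
      hx.trans ((Finset.card_union_le _ _).trans (Nat.add_le_add_right Finset.card_image_le _))
    rw [Finset.mem_union, not_or] at hxS
    refine ⟨1, le_rfl, insert (i, f x, a') K, ?_, f x, Finset.mem_insert_self _ _⟩
    refine (Fresh.refl K).vertex i (f x) a' ?_ ha' (hfc x).1 ?_ hxS.2 ?_ ?_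
    · have := (hfc x).2
      omega
    · intro t ht he
      exact hxS.1 (Finset.mem_image.2 ⟨t, ht, he⟩)
    · rintro ⟨i', u, b⟩ ht rfl rfl
      exact h ⟨u, ht⟩
    · intro t ht hi he
      rw [← hwc]
      exact hm t ht (i, w, a) hw hi (he.trans haa')

/-- One step places v into a class, and at most k further steps fill that class. -/
theorem Fresh.exists_isFull (hk : 0 < k) (hkn : k ∣ n) (hcol : ∀ c, ∃ f : ℕ → ℕ,
      Function.Injective f ∧ ∀ x, col (f x) = c ∧ f x ≤ 2 * x + 1) (hv : Valid n K)
    (hm : IsMono k col K) (i : Fin d) {v : ℕ} (hvn : v < n) (hvc : col v = c)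
    (hn : (k + 2) * (K.card + (1 + k) + J.card + 1) ≤ n) :
    ∃ l ≤ 1 + k, ∃ K', Fresh n k col c J l K K' ∧ IsFull k K' i v := by
  obtain ⟨l, hl, K₁, hK₁, a, ha⟩ := Fresh.exists_slot (J := J) hk i hvn hvc (by nlinarith)
  have hK₁v := hK₁.valid hv
  have hc₁ := hK₁.card_le
  obtain ⟨l', hl', K₂, hK₂, hS⟩ := Fresh.exists_forall (n := n) (k := k) (col := col) (c := c)
    (J := J) (K := K₁) (Finset.range k)
    (fun o K => ∃ u, (i, u, k * (a / k) + o) ∈ K)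
    (fun o K K' hKK' ⟨u, hu⟩ => ⟨u, hKK' hu⟩) 1 (K.card + (1 + k)) (by
      intro o ho K₂ h12 hv₂ hm₂ hcard
      have ho := Finset.mem_range.1 ho
      have hdiv : (k * (a / k) + o) / k = a / k := by
        rw [Nat.mul_add_div hk, Nat.div_eq_of_lt ho, add_zero]
      have han := hK₁v.slot_lt _ ha
      refine Fresh.exists_vertex hcol hm₂ i (h12 ha) hvc hdiv ?_ (by nlinarith)
      obtain ⟨m, rfl⟩ := hkn
      have h1 : a / k < m := Nat.div_lt_of_lt_mul han
      have h2 := Nat.mul_le_mul_left k h1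
      rw [Nat.mul_succ] at h2
      omega) hK₁v (hK₁.isMono hm) (by rw [Finset.card_range]; omega)
  rw [Finset.card_range] at hl'
  refine ⟨l + l', by omega, K₂, hK₁.trans hK₂, a, hK₂.subset ha, fun a' ha' => ?_⟩
  have := hS (a' % k) (Finset.mem_range.2 (Nat.mod_lt _ hk))
  rwa [← ha', Nat.div_add_mod] at this

/-- The number of fresh steps that suffices to know the neighbourhoods of the neighbours of a
vertex. -/
def stepBound (d k : ℕ) : ℕ := d * (1 + k) * (2 + d * k)

/-- First the d hyperedges at w are filled, then those at its at most 1 + d·k neighbours; d·(1 + k)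
steps for each of these 2 + d·k vertices give `stepBound`. The second round does not enlarge the
neighbourhood of w. -/
theorem Fresh.exists_isComplete (hk : 0 < k) (hkn : k ∣ n) (hcol : ∀ c, ∃ f : ℕ → ℕ,
      Function.Injective f ∧ ∀ x, col (f x) = c ∧ f x ≤ 2 * x + 1) (hv : Valid n K)
    (hm : IsMono k col K) {w : ℕ} (hwn : w < n) (hwc : col w = c)
    (hn : (k + 2) * (K.card + stepBound d k + J.card + 1) ≤ n) :
    ∃ l ≤ stepBound d k, ∃ K', Fresh n k col c J l K K' ∧ IsComplete k K' w := by
  have hfull : ∀ v, v < n → col v = c → ∀ K₁ : Finset (Fin d × ℕ × ℕ), Valid n K₁ →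
      IsMono k col K₁ → K₁.card + d * (1 + k) ≤ K.card + stepBound d k →
      ∃ l ≤ d * (1 + k), ∃ K₂, Fresh n k col c J l K₁ K₂ ∧ ∀ i, IsFull k K₂ i v := by
    intro v hvn hvc K₁ hv₁ hm₁ hcard
    obtain ⟨l, hl, K₂, hK₂, h⟩ := Fresh.exists_forall (n := n) (k := k) (col := col) (c := c)
      (J := J) (K := K₁) Finset.univ (fun i K => IsFull k K i v)
      (fun i K K' hKK' h => h.mono hKK') (1 + k) (K.card + stepBound d k) (by
        intro i _ K₂ _ hv₂ hm₂ hcard₂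
        refine Fresh.exists_isFull hk hkn hcol hv₂ hm₂ i hvn hvc (le_trans ?_ hn)
        exact Nat.mul_le_mul_left _ (by omega)) hv₁ hm₁ (by
        rw [Finset.card_univ, Fintype.card_fin]; rwa [mul_comm])
    rw [Finset.card_univ, Fintype.card_fin, mul_comm] at hl
    exact ⟨l, hl, K₂, hK₂, fun i => h i (Finset.mem_univ i)⟩
  have hR : stepBound d k = d * (1 + k) + d * (1 + k) * (1 + d * k) := by
    unfold stepBound; ring
  obtain ⟨l, hl, K₁, hK₁, h₁⟩ := hfull w hwn hwc K hv hm (by rw [hR]; omega)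
  have hc₁ := hK₁.card_le
  have hv₁ := hK₁.valid hv
  have hm₁ := hK₁.isMono hm
  have hNB := card_NB_le hk hv₁ w
  have hNB' := Nat.mul_le_mul_left (d * (1 + k)) hNB
  obtain ⟨l', hl', K₂, hK₂, h₂⟩ := Fresh.exists_forall (n := n) (k := k) (col := col) (c := c)
    (J := J) (K := K₁) (NB k K₁ w) (fun v K => ∀ i, IsFull k K i v)
    (fun v K K' hKK' h i => (h i).mono hKK') (d * (1 + k)) (K.card + stepBound d k) (by
      intro v hvN K₂ _ hv₂ hm₂ hcard₂
      refine hfull v ?_ ((hm₁.col_eq_of_mem_NB hvN).trans hwc) K₂ hv₂ hm₂ hcard₂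
      rcases mem_NB.1 hvN with rfl | ⟨i, a, a', -, h, -⟩
      · exact hwn
      · exact hv₁.vertex_lt _ h) hv₁ hm₁ (by rw [hR]; omega)
  refine ⟨l + l', by rw [hR]; omega, K₂, hK₁.trans hK₂, fun v hv' => h₂ v ?_⟩
  exact NB_subset_of_isFull hK₂.subset (hK₂.valid hv₁) h₁ hv'

end Fresh

/-! ### Expansion of the arrival terms -/

/-- Inclusion-exclusion: the indicator of Q u = q is that of q ≤ Q u minus that of q + 1 ≤ Q u, and
the product over T is expanded. Only lower bounds on queues appear, as the hierarchy demands. -/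
theorem sum_powerset_neg_one_pow (nb T : Finset ℕ) (hT : T ⊆ nb) (q : ℕ) (Q : ℕ → ℕ) :
    ∑ T' ∈ T.powerset, (-1 : ℝ) ^ T'.card *
        (if ∀ u ∈ nb, q + (if u ∈ T' ∨ u ∉ T then 1 else 0) ≤ Q u then 1 else 0) =
      if (∀ u ∈ T, Q u = q) ∧ ∀ u ∈ nb, u ∉ T → q + 1 ≤ Q u then 1 else 0 := by
  classical
  have h1 : ∏ u ∈ T, (-(if q + 1 ≤ Q u then (1 : ℝ) else 0) + (if q ≤ Q u then 1 else 0)) =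
      if ∀ u ∈ T, Q u = q then 1 else 0 := by
    rw [Finset.prod_congr rfl (g := fun u => if Q u = q then (1 : ℝ) else 0), Finset.prod_ite_zero,
      Finset.prod_const_one]
    intro u _
    rcases lt_trichotomy (Q u) q with h | h | h
    · rw [if_neg (by omega), if_neg (by omega), if_neg (by omega)]; norm_num
    · rw [if_neg (by omega), if_pos (by omega), if_pos (by omega)]; norm_num
    · rw [if_pos (by omega), if_pos (by omega), if_neg (by omega)]; norm_num
  by_cases hc : ∀ u ∈ nb, u ∉ T → q + 1 ≤ Q u
  · have h2 : (if (∀ u ∈ T, Q u = q) ∧ ∀ u ∈ nb, u ∉ T → q + 1 ≤ Q u then (1 : ℝ) else 0) =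
        if ∀ u ∈ T, Q u = q then 1 else 0 := if_congr (and_iff_left hc) rfl rfl
    rw [h2, ← h1, Finset.prod_add]
    refine Finset.sum_congr rfl fun T' hT' => ?_
    rw [Finset.mem_powerset] at hT'
    rw [Finset.prod_neg, mul_assoc, Finset.prod_ite_zero, Finset.prod_ite_zero]
    simp only [Finset.prod_const_one]
    rw [ite_zero_mul_ite_zero, one_mul]
    congr 1
    refine if_congr ⟨fun h => ⟨fun u hu => ?_, fun u hu => ?_⟩, fun h u hu => ?_⟩ rfl rfl
    · have := h u (hT (hT' hu)); rwa [if_pos (Or.inl hu)] at this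
    · have := h u (hT (Finset.mem_sdiff.1 hu).1)
      omega
    · by_cases huT : u ∈ T
      · by_cases huT' : u ∈ T'
        · rw [if_pos (Or.inl huT')]; exact h.1 u huT'
        · rw [if_neg (by tauto)]
          exact h.2 u (Finset.mem_sdiff.2 ⟨huT, huT'⟩)
      · rw [if_pos (Or.inr huT)]; exact hc u hu huT
  · rw [if_neg (fun h => hc h.2)]
    refine Finset.sum_eq_zero fun T' _ => ?_
    rw [if_neg, mul_zero]
    intro h
    refine hc fun u hu huT => ?_
    have := h u hu
    rwa [if_pos (Or.inr huT)] at this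

/-- The set T stands for the set of shortest queues. For given queue lengths at most one T
contributes, and its weight 1/|T| is the probability that the task picks w. -/
theorem sum_powerset_mem (nb : Finset ℕ) {w : ℕ} (hw : w ∈ nb) (q : ℕ) (Q : ℕ → ℕ) :
    ∑ T ∈ nb.powerset.filter (w ∈ ·), ∑ T' ∈ T.powerset, (-1 : ℝ) ^ T'.card * (T.card : ℝ)⁻¹ *
        (if ∀ u ∈ nb, q + (if u ∈ T' ∨ u ∉ T then 1 else 0) ≤ Q u then 1 else 0) =
      if (∀ u ∈ nb, Q w ≤ Q u) ∧ Q w = q then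
        ((nb.filter fun u => Q u = q).card : ℝ)⁻¹ else 0 := by
  classical
  have h1 : ∀ T ∈ nb.powerset.filter (w ∈ ·),
      ∑ T' ∈ T.powerset, (-1 : ℝ) ^ T'.card * (T.card : ℝ)⁻¹ *
        (if ∀ u ∈ nb, q + (if u ∈ T' ∨ u ∉ T then 1 else 0) ≤ Q u then 1 else 0) =
      if (∀ u ∈ T, Q u = q) ∧ ∀ u ∈ nb, u ∉ T → q + 1 ≤ Q u then (T.card : ℝ)⁻¹ else 0 := by
    intro T hT
    have hT := Finset.mem_powerset.1 (Finset.mem_filter.1 hT).1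
    rw [← mul_boole, ← sum_powerset_neg_one_pow nb T hT q Q, Finset.mul_sum]
    exact Finset.sum_congr rfl fun _ _ => by ring
  rw [Finset.sum_congr rfl h1]
  have h2 : ∀ T ∈ nb.powerset.filter (w ∈ ·),
      ((∀ u ∈ T, Q u = q) ∧ ∀ u ∈ nb, u ∉ T → q + 1 ≤ Q u) →
        T = nb.filter fun u => Q u = q := by
    intro T hT h
    have hT := Finset.mem_powerset.1 (Finset.mem_filter.1 hT).1
    ext u
    rw [Finset.mem_filter]
    refine ⟨fun hu => ⟨hT hu, h.1 u hu⟩, fun hu => ?_⟩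
    by_contra hn
    have := h.2 u hu.1 hn
    omega
  split_ifs with hc
  · rw [Finset.sum_eq_single (nb.filter fun u => Q u = q), if_pos]
    · refine ⟨fun u hu => (Finset.mem_filter.1 hu).2, fun u hu huT => ?_⟩
      have := hc.1 u hu
      rw [hc.2] at this
      rw [Finset.mem_filter, not_and] at huT
      have := huT hu
      omega
    · intro T hT hne
      exact if_neg fun h => hne (h2 T hT h)
    · intro h
      refine absurd (Finset.mem_filter.2 ⟨Finset.mem_powerset.2 (Finset.filter_subset _ _), ?_⟩) h
      exact Finset.mem_filter.2 ⟨hw, hc.2⟩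
  · refine Finset.sum_eq_zero fun T hT => if_neg fun h => hc ?_
    have hwT := (Finset.mem_filter.1 hT).2
    refine ⟨fun u hu => ?_, h.1 w hwT⟩
    rw [h.1 w hwT]
    by_cases hu' : u ∈ T
    · exact (h.1 u hu').ge
    · exact (Nat.le_succ _).trans (h.2 u hu hu')

/-- The queue lengths `j` with a condition at `w` replaced by conditions on the neighbours. -/
def raise (nb : Finset ℕ) (j : ℕ →₀ ℕ) (w : ℕ) (T T' : Finset ℕ) : ℕ →₀ ℕ :=
  j.erase w ⊔ Finsupp.indicator nb fun u _ => j w - 1 + if u ∈ T' ∨ u ∉ T then 1 else 0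

theorem raise_le_iff {nb : Finset ℕ} {j : ℕ →₀ ℕ} {w : ℕ} {T T' : Finset ℕ} {Q : ℕ → ℕ} :
    (∀ u, raise nb j w T T' u ≤ Q u) ↔ (∀ u, u ≠ w → j u ≤ Q u) ∧
      ∀ u ∈ nb, j w - 1 + (if u ∈ T' ∨ u ∉ T then 1 else 0) ≤ Q u := by
  classical
  simp only [raise, Finsupp.sup_apply, sup_le_iff, forall_and]
  refine and_congr (forall_congr' fun u => ?_) (forall_congr' fun u => ?_)
  · by_cases hu : u = w
    · simp [hu]
    · simp [hu, Finsupp.erase_ne]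
  · rw [Finsupp.indicator_apply]
    by_cases hu : u ∈ nb
    · simp [hu]
    · simp [hu]

theorem support_raise (nb : Finset ℕ) (j : ℕ →₀ ℕ) (w : ℕ) (T T' : Finset ℕ) :
    (raise nb j w T T').support ⊆ j.support ∪ nb := by
  intro u hu
  rw [Finset.mem_union]
  by_contra h
  rw [not_or, Finsupp.notMem_support_iff] at h
  rw [Finsupp.mem_support_iff] at hu
  refine hu ?_
  rw [raise, Finsupp.sup_apply, Finsupp.indicator_of_notMem h.2]
  by_cases huw : u = w
  · simp [huw]
  · simp [Finsupp.erase_ne huw, h.1]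

/-- The conditions produced by an arrival at w are weaker than j by at most one unit, at w. So the
weight loses a single factor. -/
theorem degree_le_degree_raise {nb : Finset ℕ} (j : ℕ →₀ ℕ) {w : ℕ} (hw : w ∈ nb)
    (T T' : Finset ℕ) : j.degree ≤ (raise nb j w T T').degree + 1 := by
  have : j ≤ raise nb j w T T' + Finsupp.single w 1 := by
    intro u
    rw [Finsupp.add_apply, raise, Finsupp.sup_apply]
    by_cases huw : u = w
    · subst huw
      rw [Finsupp.indicator_of_mem hw]
      simp only [Finsupp.erase_same, Finsupp.single_eq_same]
      have : j u - 1 + 0 ≤ 0 ⊔ (j u - 1 + if u ∈ T' ∨ u ∉ T then 1 else 0) :=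
        le_sup_of_le_right (Nat.add_le_add_left (Nat.zero_le _) _)
      omega
    · rw [Finsupp.erase_ne huw]
      exact le_add_right le_sup_left
  have h := Finsupp.degree_mono this
  rwa [map_add, Finsupp.degree_single] at h

/-- The arrivals at the queue of `w`, in terms of a functional `V` of queue length conditions and
partial assignments. -/
def arrTerm (k : ℕ) (V : (ℕ →₀ ℕ) → Finset (Fin d × ℕ × ℕ) → ℝ)
    (K : Finset (Fin d × ℕ × ℕ)) (j : ℕ →₀ ℕ) (w : ℕ) : ℝ :=
  ∑ v ∈ NB k K w, ∑ T ∈ (NB k K v).powerset.filter (w ∈ ·), ∑ T' ∈ T.powerset,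
    (-1 : ℝ) ^ T'.card * (T.card : ℝ)⁻¹ * V (raise (NB k K v) j w T T') K

/-- The restriction of `j` to the first `n` vertices. -/
def vec (n : ℕ) (j : ℕ →₀ ℕ) : Fin n → ℕ := fun b => j b

open Classical in
theorem ind_vec {j : ℕ →₀ ℕ} (hj : ∀ b ∈ j.support, b < n) (Q : Fin n → ℕ) :
    ind (vec n j) Q = if ∀ u, j u ≤ (if h : u < n then Q ⟨u, h⟩ else 0) then 1 else 0 := by
  unfold ind
  refine if_congr ⟨fun h u => ?_, fun h b => ?_⟩ rfl rfl
  · by_cases hu : u < n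
    · rw [dif_pos hu]; exact h ⟨u, hu⟩
    · rw [dif_neg hu]
      have := mt (hj u) hu
      rw [Finsupp.notMem_support_iff] at this
      exact this.le
  · have := h b
    rwa [dif_pos b.2] at this

open Classical in
-- An arrival at w matters only if w is exactly one task short and all other bounds already hold.
theorem ind_update_sub {j : ℕ →₀ ℕ} (hj : ∀ b ∈ j.support, b < n) (Q : Fin n → ℕ) (w : Fin n)
    (hw : j w ≠ 0) :
    ind (vec n j) (Function.update Q w (Q w + 1)) - ind (vec n j) Q =
      if (∀ u, u ≠ (w : ℕ) → j u ≤ (if h : u < n then Q ⟨u, h⟩ else 0)) ∧ Q w = j w - 1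
        then 1 else 0 := by
  classical
  have hrest : ∀ Q' : Fin n → ℕ, (∀ u, j u ≤ (if h : u < n then Q' ⟨u, h⟩ else 0)) ↔
      (∀ u, u ≠ (w : ℕ) → j u ≤ (if h : u < n then Q' ⟨u, h⟩ else 0)) ∧ j w ≤ Q' w := by
    intro Q'
    constructor
    · intro h
      refine ⟨fun u _ => h u, ?_⟩
      have := h w
      rwa [dif_pos w.2] at this
    · rintro ⟨h1, h2⟩ u
      by_cases hu : u = w
      · subst hu; rwa [dif_pos w.2]
      · exact h1 u hu
  rw [ind_vec hj, ind_vec hj, if_congr (hrest _) rfl rfl, if_congr (hrest Q) rfl rfl]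
  have h2 : (∀ u, u ≠ (w : ℕ) → j u ≤
        (if h : u < n then Function.update Q w (Q w + 1) ⟨u, h⟩ else 0)) ↔
      (∀ u, u ≠ (w : ℕ) → j u ≤ (if h : u < n then Q ⟨u, h⟩ else 0)) := by
    refine forall_congr' fun u => imp_congr_right fun hu => ?_
    by_cases h : u < n
    · rw [dif_pos h, dif_pos h, Function.update_of_ne (fun he => hu (by rw [← he]))]
    · rw [dif_neg h, dif_neg h]
  rw [if_congr (and_congr_left' h2) rfl rfl, Function.update_self]
  generalize (∀ u, u ≠ (w : ℕ) → j u ≤ (if h : u < n then Q ⟨u, h⟩ else 0)) = P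
  by_cases h3 : P
  · simp only [h3, true_and]
    rcases lt_trichotomy (Q w) (j w - 1) with h | h | h
    · rw [if_neg (by omega), if_neg (by omega), if_neg (by omega)]; norm_num
    · rw [if_pos (by omega), if_neg (by omega), if_pos (by omega)]; norm_num
    · rw [if_pos (by omega), if_pos (by omega), if_neg (by omega)]; norm_num
  · simp only [h3, false_and, if_false, sub_zero]

theorem NB_lt {K : Finset (Fin d × ℕ × ℕ)} (hK : Valid n K) {v : ℕ} (hv : v < n) :
    ∀ u ∈ NB k K v, u < n := by
  intro u hu
  rcases mem_NB.1 hu with rfl | ⟨i, a, a', -, h, -⟩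
  · exact hv
  · exact hK.vertex_lt _ h

/-- An arrival at w depends on the tasks of the vertices v near w and on the queues in the
neighbourhoods of these v. Completeness at w makes all these neighbourhoods deterministic, so the
inclusion-exclusion formula applies with sets independent of the extension. -/
theorem arr_graphOf (hk : 0 < k) (hkn : k ∣ n) {K : Finset (Fin d × ℕ × ℕ)} (hK : Valid n K)
    {τ : Fin d → Equiv.Perm (Fin n)} (hτ : τ ∈ Ext n K) {w : Fin n} (hc : IsComplete k K w)
    {j : ℕ →₀ ℕ} (hj : ∀ b ∈ j.support, b < n) (hw : j w ≠ 0) (Q : Fin n → ℕ) :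
    arr (graphOf hk hkn τ) (vec n j) w Q =
      arrTerm k (fun j' _ => ind (vec n j') Q) K j w := by
  classical
  set s := State.mk (graphOf hk hkn τ) Q with hs
  set Q' : ℕ → ℕ := fun u => if h : u < n then Q ⟨u, h⟩ else 0 with hQ'
  have hQ'v : ∀ u : Fin n, Q' u = Q u := fun u => by simp only [hQ']; rw [dif_pos u.2]
  have hnb : ∀ v : Fin n, (v : ℕ) ∈ NB k K w → ∀ u : Fin n, u ∈ s.nbhd v ↔ (u : ℕ) ∈ NB k K v :=
    fun v hv u => mem_nbhd_graphOf hk hkn hK hτ (hc v hv) Q u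
  have hlt := NB_lt (k := k) hK w.2
  have hnbw : ∀ v : Fin n, w ∈ s.nbhd v ↔ (v : ℕ) ∈ NB k K w := fun v => by
    rw [mem_nbhd_comm, hnb w self_mem_NB]
  unfold arr arrTerm
  rw [← hs]
  have h1 : ∀ v : Fin n, v ∉ Finset.univ.filter (fun v : Fin n => (v : ℕ) ∈ NB k K w) →
      (if w ∈ s.shortest v then ((s.shortest v).card : ℝ)⁻¹ *
        (ind (vec n j) (Function.update Q w (Q w + 1)) - ind (vec n j) Q) else 0) = 0 := by
    intro v hv
    refine if_neg fun h => hv ?_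
    rw [Finset.mem_filter]
    exact ⟨Finset.mem_univ v, (hnbw v).1 ((mem_shortest_iff s v w).1 h).1⟩
  rw [← Finset.sum_subset (Finset.subset_univ _) (fun v _ hv => h1 v hv)]
  refine Finset.sum_bij (fun (v : Fin n) _ => (v : ℕ)) (fun v hv => (Finset.mem_filter.1 hv).2)
    (fun v _ v' _ h => Fin.ext h) (fun v hv => ⟨⟨v, hlt v hv⟩, by simpa using hv, rfl⟩) ?_
  intro v hv
  have hv := (Finset.mem_filter.1 hv).2
  have hwv : (w : ℕ) ∈ NB k K v := mem_NB_comm.1 hv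
  have hvlt := NB_lt (k := k) hK v.2
  have h2 : ∀ T T', ind (vec n (raise (NB k K v) j w T T')) Q =
      (if ∀ u, u ≠ (w : ℕ) → j u ≤ Q' u then 1 else 0) *
        (if ∀ u ∈ NB k K v, j w - 1 + (if u ∈ T' ∨ u ∉ T then 1 else 0) ≤ Q' u then 1 else 0) := by
    intro T T'
    rw [ind_vec, if_congr (raise_le_iff (Q := Q')) rfl rfl, ite_zero_mul_ite_zero, one_mul]
    intro b hb
    rcases Finset.mem_union.1 (support_raise _ _ _ _ _ hb) with h | h
    · exact hj b h
    · exact hvlt b h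
  have h3 : ∑ T ∈ (NB k K v).powerset.filter ((w : ℕ) ∈ ·), ∑ T' ∈ T.powerset,
      (-1 : ℝ) ^ T'.card * (T.card : ℝ)⁻¹ * ind (vec n (raise (NB k K v) j w T T')) Q =
      (if ∀ u, u ≠ (w : ℕ) → j u ≤ Q' u then 1 else 0) *
      if (∀ u ∈ NB k K v, Q' w ≤ Q' u) ∧ Q' w = j w - 1 then
        (((NB k K v).filter fun u => Q' u = j w - 1).card : ℝ)⁻¹ else 0 := by
    rw [← sum_powerset_mem _ hwv, Finset.mul_sum]
    refine Finset.sum_congr rfl fun T _ => ?_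
    rw [Finset.mul_sum]
    refine Finset.sum_congr rfl fun T' _ => ?_
    rw [h2]; ring
  rw [h3, ind_update_sub hj Q w hw]
  have h4 : w ∈ s.shortest v ↔ ∀ u ∈ NB k K v, Q' w ≤ Q' u := by
    rw [mem_shortest_iff, hnbw]
    constructor
    · rintro ⟨-, h⟩ u hu
      have := h ⟨u, hvlt u hu⟩ ((hnb v hv _).2 hu)
      rw [hQ'v w, show u = ((⟨u, hvlt u hu⟩ : Fin n) : ℕ) from rfl, hQ'v]
      exact this
    · intro h
      refine ⟨hv, fun u hu => ?_⟩
      have := h u ((hnb v hv u).1 hu)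
      rwa [hQ'v, hQ'v] at this
  by_cases hsh : ∀ u ∈ NB k K v, Q' w ≤ Q' u
  · rw [if_pos (h4.2 hsh)]
    by_cases hq : Q w = j w - 1
    · have hcard : (s.shortest v).card = ((NB k K v).filter fun u => Q' u = j w - 1).card := by
        refine Finset.card_bij (fun (u : Fin n) _ => (u : ℕ)) ?_ (fun u _ u' _ h => Fin.ext h) ?_
        · intro u hu
          rw [mem_shortest_iff] at hu
          rw [Finset.mem_filter]
          refine ⟨(hnb v hv u).1 hu.1, ?_⟩
          have h5 := hu.2 w ((hnb v hv w).2 hwv)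
          have h6 := hsh u ((hnb v hv u).1 hu.1)
          rw [hQ'v, hQ'v] at h6
          rw [hQ'v, ← hq]
          exact le_antisymm h5 h6
        · intro u hu
          rw [Finset.mem_filter] at hu
          refine ⟨⟨u, hvlt u hu.1⟩, ?_, rfl⟩
          rw [mem_shortest_iff]
          refine ⟨(hnb v hv _).2 hu.1, fun u' hu' => ?_⟩
          have h6 := hsh u' ((hnb v hv u').1 hu')
          rw [hQ'v, hQ'v, hq, ← hu.2] at h6
          have h7 := hQ'v ⟨u, hvlt u hu.1⟩
          simp only at h7
          rw [h7] at h6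
          exact h6
      rw [hcard]
      simp only [hQ'v w, hq, and_true]
      rw [hQ'v w] at hsh
      rw [hq] at hsh
      rw [if_pos hsh, mul_comm]
    · simp only [hQ'v w, hq, and_false, if_false, mul_zero]
  · simp only [h4, hsh, false_and, if_false, mul_zero]

/-! ### The hierarchy of equations for the averaged tail probabilities -/

theorem arr_relabel (G : Fin d → EqualPartition n k) (j Q : Fin n → ℕ) (σ : Equiv.Perm (Fin n))
    (w : Fin n) :
    arr (fun i => (G i).relabel σ) (j ∘ σ) w (Q ∘ σ) = arr G j (σ w) Q := by
  classical
  unfold arr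
  have h0 : ∀ Q' : Fin n → ℕ, ind (j ∘ σ) (Q' ∘ σ) = ind j Q' := fun Q' =>
    ind_congr (σ.forall_congr_right (q := fun u => j u ≤ Q' u))
  have h1 : Function.update (Q ∘ σ) w ((Q ∘ σ) w + 1) =
      Function.update Q (σ w) (Q (σ w) + 1) ∘ σ := by
    rw [Function.update_comp_eq_of_injective _ σ.injective]; rfl
  rw [h1, h0, h0]
  conv_rhs => rw [← Equiv.sum_comp σ]
  refine Finset.sum_congr rfl fun v _ => ?_
  have h2 := shortest_relabel σ (State.mk G Q) v
  rw [h2, Finset.card_map, show ((State.mk (fun i => (G i).relabel σ) (Q ∘ σ)).shortest v) =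
    ((State.mk G Q).relabel σ).shortest v from rfl]
  simp

theorem sum_vec {j : ℕ →₀ ℕ} (hj : ∀ b ∈ j.support, b < n) : ∑ v, vec n j v = j.degree := by
  rw [Finsupp.degree_apply]
  unfold vec
  rw [Fin.sum_univ_eq_sum_range (fun b => j b) n]
  refine (Finset.sum_subset (fun b hb => Finset.mem_range.2 (hj b hb)) fun b _ hb => ?_).symm
  exact Finsupp.notMem_support_iff.1 hb

theorem vec_add_single (j : ℕ →₀ ℕ) (b : Fin n) :
    vec n (j + Finsupp.single (b : ℕ) 1) = vec n j + Pi.single b 1 := by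
  ext u
  simp only [vec, Finsupp.add_apply, Pi.add_apply, Finsupp.single_apply, Pi.single_apply,
    Fin.ext_iff, eq_comm]

theorem sum_filter_vec {j : ℕ →₀ ℕ} (hj : ∀ b ∈ j.support, b < n) (F : ℕ → ℝ) :
    ∑ v ∈ Finset.univ.filter (fun v : Fin n => vec n j v ≠ 0), F v = ∑ b ∈ j.support, F b := by
  refine Finset.sum_bij (fun (v : Fin n) _ => (v : ℕ)) (fun v hv => ?_) (fun v _ v' _ h => Fin.ext h)
    (fun b hb => ⟨⟨b, hj b hb⟩, ?_, rfl⟩) fun _ _ => rfl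
  · exact Finsupp.mem_support_iff.2 (Finset.mem_filter.1 hv).2
  · exact Finset.mem_filter.2 ⟨Finset.mem_univ _, Finsupp.mem_support_iff.1 hb⟩

/-- Sum of the errors of the single revelations. The two invariances of X are those needed for fresh
slots and fresh vertices; vertices in J are excluded because X singles them out. -/
theorem Fresh.abs_avg_sub_le (hk : 0 < k) (hkn : k ∣ n) {col : ℕ → Bool} {c : Bool}
    {J : Finset ℕ} {l : ℕ} {K K' : Finset (Fin d × ℕ × ℕ)} (h : Fresh n k col c J l K K')
    (hK : Valid n K) {N : ℕ} (hN : K.card + l ≤ N) (hNn : 2 * N ≤ n)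
    {X : (Fin d → Equiv.Perm (Fin n)) → ℝ} {B : ℝ} (hB : 0 ≤ B) (hX : ∀ τ, |X τ| ≤ B)
    (hXl : ∀ τ i (θ : Equiv.Perm (Fin n)),
      (∀ a b, (θ a : ℕ) / k = (θ b : ℕ) / k ↔ (a : ℕ) / k = (b : ℕ) / k) → X (lmul τ i θ) = X τ)
    (hXr : ∀ τ (v w : Fin n), (v : ℕ) ∉ J → (w : ℕ) ∉ J →
      X (fun i => τ i * Equiv.swap v w) = X τ) :
    |avg n K X - avg n K' X| ≤ l * (4 * B * ((k + 1) * (N + J.card) : ℕ) / n) := by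
  have hstep : ∀ m : ℕ, m ≤ (k + 1) * (N + J.card) →
      4 * B * (m : ℝ) / n ≤ 4 * B * ((k + 1) * (N + J.card) : ℕ) / n := by
    intro m hm
    have : (m : ℝ) ≤ ((k + 1) * (N + J.card) : ℕ) := by exact_mod_cast hm
    gcongr
  induction h with
  | refl => simp
  | @slot l K K' h i b a hb ha hc hfb hfa ih =>
    have h1 := ih hK (by omega)
    have hv := (Fresh.slot h i b a hb ha hc hfb hfa).valid hK
    have hcard := h.card_le
    have h2 := abs_avg_insert_slot_le hk hkn (t := (i, b, a))
      (fun ht => hfb _ ht rfl rfl) hv hfa (by omega) hX hXl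
    have h3 := hstep (k * K'.card) (Nat.mul_le_mul (by omega) (by omega))
    have h4 := abs_sub_le (avg n K X) (avg n K' X) (avg n (insert (i, b, a) K') X)
    push_cast at *
    linarith
  | @vertex l K K' h i b a hb ha hc hfb hJ hfa hm ih =>
    have h1 := ih hK (by omega)
    have hv := (Fresh.vertex h i b a hb ha hc hfb hJ hfa hm).valid hK
    have hcard := h.card_le
    have h2 := abs_avg_insert_vertex_le (t := (i, b, a))
      (fun ht => hfb _ ht rfl) hv hfb hJ (by omega) hX hXr
    have h3 := hstep (K'.card + J.card) (by nlinarith)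
    have h4 := abs_sub_le (avg n K X) (avg n K' X) (avg n (insert (i, b, a) K') X)
    push_cast at *
    linarith

/-- The probability that the queue lengths are at least `j`, given the partial assignment `K`. -/
def tailProb (hk : 0 < k) (hkn : k ∣ n) (ν : (Fin d → EqualPartition n k) → Measure (Fin n → ℕ))
    (j : ℕ →₀ ℕ) (K : Finset (Fin d × ℕ × ℕ)) : ℝ :=
  avg n K fun τ => ∫ Q, ind (vec n j) Q ∂ν (graphOf hk hkn τ)

/-- The error by which the functional `V` fails to satisfy the equations of the hierarchy. -/
def residual (k : ℕ) (lam kap : ℝ) (V : (ℕ →₀ ℕ) → Finset (Fin d × ℕ × ℕ) → ℝ)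
    (Kb : ℕ → Finset (Fin d × ℕ × ℕ)) (j : ℕ →₀ ℕ) (K : Finset (Fin d × ℕ × ℕ)) : ℝ :=
  (j.support.card + 2 * kap * K.card) * V j K - ∑ b ∈ j.support, V (j + Finsupp.single b 1) K
    - 2 * kap * ∑ t ∈ K, V j (K.erase t) - lam * ∑ b ∈ j.support, arrTerm k V (Kb b) j b

/-! ### The conditional tail probabilities solve the hierarchy approximately. -/

section

variable {lam kap : ℝ} {ν : (Fin d → EqualPartition n k) → Measure (Fin n → ℕ)}
  (hν : IsLocalEquilibrium lam kap ν)

include hν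

theorem IsLocalEquilibrium.integrable {f : (Fin n → ℕ) → ℝ} {B : ℝ} (hf : ∀ Q, |f Q| ≤ B)
    (G : Fin d → EqualPartition n k) : Integrable f (ν G) := by
  have := hν.prob G
  exact Integrable.of_bound (Measurable.of_discrete).aestronglyMeasurable B (.of_forall hf)

theorem IsLocalEquilibrium.abs_ind_le {j : ℕ →₀ ℕ} (hj : ∀ b ∈ j.support, b < n)
    (G : Fin d → EqualPartition n k) :
    |∫ Q, ind (vec n j) Q ∂ν G| ≤ (1 / 8) ^ j.degree := by
  rw [abs_of_nonneg (integral_nonneg fun Q => ind_nonneg _ _), ← sum_vec hj]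
  exact hν.tail G _

theorem abs_tailProb_le (hk : 0 < k) (hkn : k ∣ n) {j : ℕ →₀ ℕ} (hj : ∀ b ∈ j.support, b < n)
    (K : Finset (Fin d × ℕ × ℕ)) : |tailProb hk hkn ν j K| ≤ (1 / 8) ^ j.degree :=
  abs_avg_le (by positivity) fun τ => hν.abs_ind_le hj _

theorem tailProb_zero (hk : 0 < k) (hkn : k ∣ n) {K : Finset (Fin d × ℕ × ℕ)} (hK : Valid n K) :
    tailProb hk hkn ν 0 K = 1 := by
  rw [← avg_const hK (1 : ℝ)]
  refine avg_congr fun τ _ => ?_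
  have := hν.prob (graphOf hk hkn τ)
  have h : ∀ Q : Fin n → ℕ, ind (vec n 0) Q = 1 := fun Q => ind_zero Q
  simp [h]

/-- The factor 8 is the price of the one unit of degree that an arrival may supply. -/
theorem IsLocalEquilibrium.integral_arr_le {j : ℕ →₀ ℕ} (hj : ∀ b ∈ j.support, b < n)
    {w : Fin n} (hw : j w ≠ 0) (G : Fin d → EqualPartition n k) :
    |∫ Q, arr G (vec n j) w Q ∂ν G| ≤ (1 + d * k : ℕ) * 8 * (1 / 8) ^ j.degree := by
  rw [abs_of_nonneg (integral_nonneg fun Q => arr_nonneg _ _ _ _)]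
  have h1 : ∫ Q, arr G (vec n j) w Q ∂ν G ≤
      ∫ Q, (1 + d * k : ℕ) * ind (vec n j - Pi.single w 1) Q ∂ν G :=
    integral_mono (hν.integrable (abs_arr_le G _ w) G)
      ((hν.integrable (Supermarket.abs_ind_le _) G).const_mul _) (arr_le G _ w)
  rw [integral_const_mul] at h1
  refine h1.trans ?_
  have h2 := hν.tail G (vec n j - Pi.single w 1)
  have h3 : ∑ v, (vec n j - Pi.single w 1 : Fin n → ℕ) v + 1 = j.degree := by
    rw [← sum_vec hj]
    have h4 : (vec n j - Pi.single w 1 : Fin n → ℕ) + Pi.single w 1 = vec n j := by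
      refine tsub_add_cancel_of_le fun u => ?_
      by_cases hu : u = w
      · subst hu
        rw [Pi.single_eq_same]
        exact Nat.one_le_iff_ne_zero.2 hw
      · simp [hu]
    conv_rhs => rw [← h4]
    simp only [Pi.add_apply, Finset.sum_add_distrib]
    simp
  rw [mul_assoc]
  refine mul_le_mul_of_nonneg_left (h2.trans ?_) (Nat.cast_nonneg _)
  rw [← h3, pow_succ]
  linarith

theorem arrTerm_tailProb (hk : 0 < k) (hkn : k ∣ n) {K : Finset (Fin d × ℕ × ℕ)}
    (hK : Valid n K) {w : Fin n} (hc : IsComplete k K w)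
    {j : ℕ →₀ ℕ} (hj : ∀ b ∈ j.support, b < n) (hw : j w ≠ 0) :
    arrTerm k (tailProb hk hkn ν) K j w =
      avg n K fun τ => ∫ Q, arr (graphOf hk hkn τ) (vec n j) w Q ∂ν (graphOf hk hkn τ) := by
  have h : ∀ τ ∈ Ext n K, ∫ Q, arr (graphOf hk hkn τ) (vec n j) w Q ∂ν (graphOf hk hkn τ) =
      arrTerm k (fun j' _ => ∫ Q, ind (vec n j') Q ∂ν (graphOf hk hkn τ)) K j w := by
    intro τ hτ
    simp only [arr_graphOf hk hkn hK hτ hc hj hw]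
    have hi : ∀ j', Integrable (fun Q => ind (vec n j') Q) (ν (graphOf hk hkn τ)) := fun j' =>
      hν.integrable (Supermarket.abs_ind_le _) _
    unfold arrTerm
    rw [integral_finsetSum _ fun v _ => integrable_finsetSum _ fun T _ =>
      integrable_finsetSum _ fun T' _ => (hi _).const_mul _]
    refine Finset.sum_congr rfl fun v _ => ?_
    rw [integral_finsetSum _ fun T _ =>
      integrable_finsetSum _ fun T' _ => (hi _).const_mul _]
    refine Finset.sum_congr rfl fun T _ => ?_
    rw [integral_finsetSum _ fun T' _ => (hi _).const_mul _]
    exact Finset.sum_congr rfl fun T' _ => integral_const_mul _ _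
  rw [avg_congr h]
  unfold arrTerm
  simp only [avg_sum, avg_mul]
  rfl

/-- Average the balance equation over the extensions of K. The swap terms become the forgetting of
triples up to O(1/n). The arrival terms are averages over K, and replacing K by its fresh extension
`Kb` costs O(1/n); over `Kb` they are expressible through tail probabilities. The error is
proportional to the total rate, support plus `kap`·|K|, so that division by that rate leaves a bound
free of `kap`. -/
theorem abs_residual_tailProb_le (hk : 0 < k) (hkn : k ∣ n) (hn : 0 < n) (hl : 0 ≤ lam)
    (hkap : 0 ≤ kap) (hsmall : lam * (1 + d * k : ℕ) * 8 ≤ 1) {j : ℕ →₀ ℕ}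
    (hj : ∀ b ∈ j.support, b < n) {K : Finset (Fin d × ℕ × ℕ)} (hK : Valid n K)
    {Kb : ℕ → Finset (Fin d × ℕ × ℕ)} {col : ℕ → Bool} {R : ℕ}
    (hKb : ∀ b ∈ j.support, ∃ l ≤ R, Fresh n k col (col b) j.support l K (Kb b))
    (hcomp : ∀ b ∈ j.support, IsComplete k (Kb b) b) (hR : 2 * (K.card + R) ≤ n) :
    |residual k lam kap (tailProb hk hkn ν) Kb j K| ≤
      ((6 + 4 * R * (k + 1) * (R + 1) : ℕ) : ℝ) / n * (j.support.card + kap * K.card) *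
        (j.degree + K.card + 1 : ℕ) * (1 / 8) ^ j.degree := by
  classical
  set X0 : (Fin d → Equiv.Perm (Fin n)) → ℝ :=
    fun τ => ∫ Q, ind (vec n j) Q ∂ν (graphOf hk hkn τ) with hX0
  set XA : ℕ → (Fin d → Equiv.Perm (Fin n)) → ℝ := fun b τ => if h : b < n then
    ∫ Q, arr (graphOf hk hkn τ) (vec n j) ⟨b, h⟩ Q ∂ν (graphOf hk hkn τ) else 0 with hXA
  set B : ℝ := (1 / 8) ^ j.degree with hBdef
  have hB : 0 ≤ B := by positivity
  have hX0B : ∀ τ, |X0 τ| ≤ B := fun τ => hν.abs_ind_le hj _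
  -- The balance equation in slot coordinates: a swap of half-edges is a transposition applied
  -- before looking up slots.
  have hbal : ∀ τ, (∑ b ∈ j.support, ((∫ Q, ind (vec n (j + Finsupp.single b 1)) Q
        ∂ν (graphOf hk hkn τ)) - X0 τ)) + lam * ∑ b ∈ j.support, XA b τ +
      kap * ((n : ℝ)⁻¹ * ∑ i : Fin d, ∑ v : Fin n, ∑ w : Fin n,
        (X0 (rmul τ i (Equiv.swap v w)) - X0 τ)) = 0 := by
    intro τ
    rw [← hν.balance (graphOf hk hkn τ) (vec n j), ← sum_filter_vec hj, ← sum_filter_vec hj]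
    congr 1
    · congr 1
      · refine Finset.sum_congr rfl fun v _ => ?_
        rw [vec_add_single]
      · congr 1
        refine Finset.sum_congr rfl fun v _ => ?_
        simp only [hXA]
        rw [dif_pos v.2]
    · congr 1
      simp only [Finset.mul_sum]
      rw [Finset.sum_comm]
      refine Finset.sum_congr rfl fun v _ => Finset.sum_congr rfl fun i _ =>
        Finset.sum_congr rfl fun w _ => ?_
      simp only [hX0]
      rw [graphOf_rmul_swap]
  have havg : (∑ b ∈ j.support, (tailProb hk hkn ν (j + Finsupp.single b 1) K
        - tailProb hk hkn ν j K)) + lam * ∑ b ∈ j.support, avg n K (XA b) +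
      kap * ((n : ℝ)⁻¹ * ∑ i : Fin d, ∑ v : Fin n, ∑ w : Fin n,
        (avg n K (fun τ => X0 (rmul τ i (Equiv.swap v w))) - avg n K X0)) = 0 := by
    have h := (avg_congr fun τ _ => hbal τ).trans (avg_const hK (0 : ℝ))
    rw [avg_add, avg_add, avg_mul, avg_mul, avg_mul, avg_sum, avg_sum, avg_sum] at h
    simp only [avg_sum, avg_sub] at h
    exact h
  have harr : ∀ b ∈ j.support, |lam * (avg n K (XA b) - arrTerm k (tailProb hk hkn ν) (Kb b) j b)|
      ≤ (4 * R * (k + 1) * (R + 1) : ℕ) / n * (j.degree + K.card + 1 : ℕ) * B := by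
    intro b hb
    obtain ⟨l, hlR, hF⟩ := hKb b hb
    have hbn := hj b hb
    have hb0 : j b ≠ 0 := Finsupp.mem_support_iff.1 hb
    have h1 := arrTerm_tailProb hν hk hkn (hF.valid hK) (w := ⟨b, hbn⟩) (hcomp b hb) hj hb0
    have h2 : arrTerm k (tailProb hk hkn ν) (Kb b) j b = avg n (Kb b) (XA b) := by
      rw [show arrTerm k (tailProb hk hkn ν) (Kb b) j b =
        arrTerm k (tailProb hk hkn ν) (Kb b) j ((⟨b, hbn⟩ : Fin n) : ℕ) from rfl, h1]
      refine avg_congr fun τ _ => ?_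
      simp only [hXA]
      rw [dif_pos hbn]
    set B' : ℝ := (1 + d * k : ℕ) * 8 * (1 / 8) ^ j.degree with hB'
    have hXl : ∀ τ i (θ : Equiv.Perm (Fin n)),
        (∀ a b, (θ a : ℕ) / k = (θ b : ℕ) / k ↔ (a : ℕ) / k = (b : ℕ) / k) →
          XA b (lmul τ i θ) = XA b τ := by
      intro τ i θ hθ
      simp only [hXA]
      rw [graphOf_lmul hk hkn τ i θ hθ]
    -- Exchangeability makes the arrival integral invariant under swapping vertices on which j
    -- vanishes. This is why fresh vertices must avoid the support of j.
    have hXr : ∀ τ (v w : Fin n), (v : ℕ) ∉ j.support → (w : ℕ) ∉ j.support →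
        XA b (fun i => τ i * Equiv.swap v w) = XA b τ := by
      intro τ v w hv hw
      simp only [hXA]
      rw [dif_pos hbn, dif_pos hbn]
      have hg : graphOf hk hkn (fun i => τ i * Equiv.swap v w) =
          fun i => (graphOf hk hkn τ i).relabel (Equiv.swap v w) := by
        funext i
        exact EqualPartition.relabel_mul _ _ _
      have hjs : vec n j ∘ Equiv.swap v w = vec n j := by
        funext u
        have hv0 : vec n j v = 0 := Finsupp.notMem_support_iff.1 hv
        have hw0 : vec n j w = 0 := Finsupp.notMem_support_iff.1 hw
        rcases eq_or_ne u v with rfl | huv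
        · simp [hv0, hw0]
        · rcases eq_or_ne u w with rfl | huw
          · simp [hv0, hw0]
          · simp [Equiv.swap_apply_of_ne_of_ne huv huw]
      have hbs : Equiv.swap v w ⟨b, hbn⟩ = ⟨b, hbn⟩ := by
        refine Equiv.swap_apply_of_ne_of_ne (fun h => hv ?_) (fun h => hw ?_)
        · rw [← h]; exact hb
        · rw [← h]; exact hb
      rw [hg, hν.exch _ _ _ ⟨_, abs_arr_le _ _ _⟩]
      refine integral_congr_ae (.of_forall fun Q => ?_)
      have := arr_relabel (graphOf hk hkn τ) (vec n j) Q (Equiv.swap v w) ⟨b, hbn⟩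
      rw [hjs, hbs] at this
      exact this
    have h3 := hF.abs_avg_sub_le hk hkn hK (N := K.card + R) (by omega) hR (B := B')
      (by positivity) (X := XA b) (fun τ => by
        simp only [hXA]
        rw [dif_pos hbn]
        exact hν.integral_arr_le hj hb0 _) hXl hXr
    rw [h2, abs_mul, abs_of_nonneg hl]
    have hlB : lam * B' ≤ B := by
      have := mul_le_mul_of_nonneg_right hsmall hB
      rw [hB']
      calc _ = lam * (1 + d * k : ℕ) * 8 * B := by rw [hBdef]; ring
        _ ≤ _ := this
        _ = B := one_mul _
    have hJ : j.support.card ≤ j.degree := by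
      rw [Finsupp.degree_apply, Finset.card_eq_sum_ones]
      exact Finset.sum_le_sum fun b hb => Nat.one_le_iff_ne_zero.2 (Finsupp.mem_support_iff.1 hb)
    -- The product form of the right-hand side separates the constants depending on d and k from the
    -- linear growth in the degree and |K|.
    have h4 : l * (k + 1) * (K.card + R + j.support.card) ≤
        R * (k + 1) * ((R + 1) * (j.degree + K.card + 1)) := by
      refine Nat.mul_le_mul (Nat.mul_le_mul_right _ hlR) ?_
      nlinarith
    have h4' : (l : ℝ) * (((k + 1) * (K.card + R + j.support.card) : ℕ)) ≤
        R * (k + 1) * ((R + 1) * (j.degree + K.card + 1 : ℕ)) := by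
      have : ((l * (k + 1) * (K.card + R + j.support.card) : ℕ) : ℝ) ≤
        (R * (k + 1) * ((R + 1) * (j.degree + K.card + 1)) : ℕ) := by exact_mod_cast h4
      push_cast at this ⊢
      linarith
    calc _ ≤ lam * (l * (4 * B' * ((k + 1) * (K.card + R + j.support.card) : ℕ) / n)) :=
          mul_le_mul_of_nonneg_left h3 hl
      _ = (lam * B') * (4 * (l * (((k + 1) * (K.card + R + j.support.card) : ℕ))) / n) := by ring
      _ ≤ B * (4 * (R * (k + 1) * ((R + 1) * (j.degree + K.card + 1 : ℕ))) / n) := by gcongr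
      _ = _ := by push_cast; ring
  have hmove : |kap * ((n : ℝ)⁻¹ * ∑ i : Fin d, ∑ v : Fin n, ∑ w : Fin n,
        (avg n K (fun τ => X0 (rmul τ i (Equiv.swap v w))) - avg n K X0)
      - 2 * ∑ t ∈ K, (avg n (K.erase t) X0 - avg n K X0))| ≤
      kap * (6 * B * K.card * K.card / n) := by
    rw [abs_mul, abs_of_nonneg hkap]
    refine mul_le_mul_of_nonneg_left ?_ hkap
    have hsum : ∀ F : Fin d × ℕ × ℕ → ℝ,
        ∑ t ∈ K, F t = ∑ i : Fin d, ∑ t ∈ K.filter (fun t => t.1 = i), F t := fun F =>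
      (Finset.sum_fiberwise _ _ _).symm
    have hcard : (K.card : ℝ) = ∑ i : Fin d, ((K.filter (fun t => t.1 = i)).card : ℝ) := by
      rw [← Nat.cast_sum, ← Finset.card_eq_sum_card_fiberwise (fun t _ => Finset.mem_univ _)]
    have hn' : (0 : ℝ) < n := by exact_mod_cast hn
    have h1 : (n : ℝ)⁻¹ * ∑ i : Fin d, ∑ v : Fin n, ∑ w : Fin n,
        (avg n K (fun τ => X0 (rmul τ i (Equiv.swap v w))) - avg n K X0)
      - 2 * ∑ t ∈ K, (avg n (K.erase t) X0 - avg n K X0) =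
        (n : ℝ)⁻¹ * ∑ i : Fin d, ((∑ v : Fin n, ∑ w : Fin n,
          (avg n K (fun τ => X0 (rmul τ i (Equiv.swap v w))) - avg n K X0)) -
          2 * n * ∑ t ∈ K.filter (fun t => t.1 = i), (avg n (K.erase t) X0 - avg n K X0)) := by
      have hAS : ∀ A S : Fin d → ℝ, (n : ℝ)⁻¹ * ∑ i, A i - 2 * ∑ i, S i =
          (n : ℝ)⁻¹ * ∑ i, (A i - 2 * n * S i) := fun A S => by
        rw [Finset.sum_sub_distrib, ← Finset.mul_sum]
        field_simp
      rw [hsum fun t => avg n (K.erase t) X0 - avg n K X0]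
      exact hAS _ _
    rw [h1, abs_mul, abs_of_nonneg (by positivity : (0 : ℝ) ≤ (n : ℝ)⁻¹), div_eq_inv_mul]
    refine mul_le_mul_of_nonneg_left ((Finset.abs_sum_le_sum_abs _ _).trans ?_) (by positivity)
    conv_rhs => rw [hcard, Finset.mul_sum]
    rw [← hcard]
    exact Finset.sum_le_sum fun i _ => abs_sum_moves_sub_le hK i hX0B
  have hres : residual k lam kap (tailProb hk hkn ν) Kb j K =
      (∑ b ∈ j.support, lam * (avg n K (XA b) - arrTerm k (tailProb hk hkn ν) (Kb b) j b)) +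
      kap * ((n : ℝ)⁻¹ * ∑ i : Fin d, ∑ v : Fin n, ∑ w : Fin n,
        (avg n K (fun τ => X0 (rmul τ i (Equiv.swap v w))) - avg n K X0)
      - 2 * ∑ t ∈ K, (avg n (K.erase t) X0 - avg n K X0)) := by
    have h0 : ∀ K', avg n K' X0 = tailProb hk hkn ν j K' := fun _ => rfl
    unfold residual
    simp only [h0] at havg ⊢
    rw [← Finset.mul_sum]
    generalize (∑ i : Fin d, ∑ v : Fin n, ∑ w : Fin n,
      (avg n K (fun τ => X0 (rmul τ i (Equiv.swap v w))) - tailProb hk hkn ν j K)) = M at havg ⊢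
    simp only [Finset.sum_sub_distrib, Finset.sum_const, nsmul_eq_mul] at havg ⊢
    linear_combination -havg
  rw [hres]
  refine (abs_add_le _ _).trans ?_
  have h1 := (Finset.abs_sum_le_sum_abs _ _).trans (Finset.sum_le_sum harr)
  rw [Finset.sum_const, nsmul_eq_mul] at h1
  have hKB : kap * (6 * B * K.card * K.card / n) ≤
      kap * (6 * B * K.card * (j.degree + K.card + 1 : ℕ) / n) := by
    gcongr
    omega
  -- These nonnegative cross terms are added only to write the bound as one product.
  have hrest : 0 ≤ (4 * R * (k + 1) * (R + 1) : ℕ) / (n : ℝ) * (kap * K.card) *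
      (j.degree + K.card + 1 : ℕ) * B := by positivity
  have hrest2 : 0 ≤ 6 / (n : ℝ) * j.support.card * (j.degree + K.card + 1 : ℕ) * B := by
    positivity
  refine (add_le_add h1 (hmove.trans hKB)).trans ?_
  rw [Nat.cast_add]
  calc _ ≤ _ + _ + _ := le_add_of_le_of_nonneg (le_add_of_nonneg_right hrest) hrest2
    _ = _ := by push_cast; ring

end

/-! ### Products of solutions of the hierarchy -/

section Product

variable {col : ℕ → Bool}

/-- The part of `j` on the vertices of colour `c`. -/
def colJ (col : ℕ → Bool) (c : Bool) (j : ℕ →₀ ℕ) : ℕ →₀ ℕ := j.filter fun b => col b = c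

theorem colJ_apply (c : Bool) (j : ℕ →₀ ℕ) (b : ℕ) :
    colJ col c j b = if col b = c then j b else 0 := Finsupp.filter_apply _ _ _

theorem support_colJ (c : Bool) (j : ℕ →₀ ℕ) :
    (colJ col c j).support = j.support.filter fun b => col b = c := Finsupp.support_filter _ _

theorem degree_colJ (c : Bool) (j : ℕ →₀ ℕ) :
    (colJ col c j).degree + (colJ col (!c) j).degree = j.degree := by
  rw [← map_add]
  congr 1
  ext b
  rw [Finsupp.add_apply, colJ_apply, colJ_apply]
  cases col b <;> cases c <;> simp

theorem sum_filter_col {ι : Type*} (S : Finset ι) (g : ι → Bool) (c : Bool) (F : ι → ℝ) :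
    ∑ x ∈ S, F x = ∑ x ∈ S.filter (fun x => g x = c), F x +
      ∑ x ∈ S.filter (fun x => g x = !c), F x := by
  rw [← Finset.sum_filter_add_sum_filter_not S (fun x => g x = c)]
  congr 2
  refine Finset.filter_congr fun x _ => ?_
  cases g x <;> cases c <;> simp

theorem card_filter_col {ι : Type*} (S : Finset ι) (g : ι → Bool) (c : Bool) :
    (S.card : ℝ) = (S.filter fun x => g x = c).card + (S.filter fun x => g x = !c).card := by
  have := sum_filter_col S g c fun _ => 1
  simpa using this

theorem colJ_add_single_self {c : Bool} (j : ℕ →₀ ℕ) {b : ℕ} (hb : col b = c) :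
    colJ col c (j + Finsupp.single b 1) = colJ col c j + Finsupp.single b 1 := by
  ext u
  rw [Finsupp.add_apply, colJ_apply, colJ_apply, Finsupp.add_apply]
  by_cases hu : u = b
  · subst hu; simp [hb]
  · simp [Ne.symm hu]

theorem colJ_add_single_of_ne {c : Bool} (j : ℕ →₀ ℕ) {b : ℕ} (hb : col b ≠ c) :
    colJ col c (j + Finsupp.single b 1) = colJ col c j := by
  ext u
  rw [colJ_apply, colJ_apply, Finsupp.add_apply]
  by_cases hu : u = b
  · subst hu; simp [hb]
  · simp [Ne.symm hu]

theorem colK_erase_self {c : Bool} {K : Finset (Fin d × ℕ × ℕ)} (t : Fin d × ℕ × ℕ) :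
    colK col c (K.erase t) = (colK col c K).erase t := Finset.filter_erase _ _ _

theorem colK_erase_of_ne {c : Bool} {K : Finset (Fin d × ℕ × ℕ)} {t : Fin d × ℕ × ℕ}
    (ht : col t.2.1 ≠ c) : colK col c (K.erase t) = colK col c K := by
  rw [colK_erase_self]
  exact Finset.erase_eq_of_notMem fun h => ht (mem_colK.1 h).2

theorem NB_colK {K : Finset (Fin d × ℕ × ℕ)} (hm : IsMono k col K) {c : Bool} {v : ℕ}
    (hv : col v = c) : NB k (colK col c K) v = NB k K v := by
  ext u
  rw [mem_NB, mem_NB]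
  refine or_congr_right ⟨?_, ?_⟩
  · rintro ⟨i, a, a', h1, h2, h3⟩
    exact ⟨i, a, a', colK_subset h1, colK_subset h2, h3⟩
  · rintro ⟨i, a, a', h1, h2, h3⟩
    exact ⟨i, a, a', mem_colK.2 ⟨h1, hv⟩,
      mem_colK.2 ⟨h2, (hm _ h1 _ h2 rfl h3).symm.trans hv⟩, h3⟩

theorem IsFull.colK {K : Finset (Fin d × ℕ × ℕ)} (hm : IsMono k col K) {c : Bool} {v : ℕ}
    (hv : col v = c) {i : Fin d} (h : IsFull k K i v) : IsFull k (colK col c K) i v := by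
  obtain ⟨a, h1, h2⟩ := h
  refine ⟨a, mem_colK.2 ⟨h1, hv⟩, fun a' ha' => ?_⟩
  obtain ⟨u, hu⟩ := h2 a' ha'
  exact ⟨u, mem_colK.2 ⟨hu, (hm _ hu _ h1 rfl ha').trans hv⟩⟩

theorem IsComplete.colK {K : Finset (Fin d × ℕ × ℕ)} (hm : IsMono k col K) {c : Bool} {w : ℕ}
    (hw : col w = c) (h : IsComplete k K w) : IsComplete k (colK col c K) w := by
  intro v hv i
  rw [NB_colK hm hw] at hv
  exact (h v hv i).colK hm ((hm.col_eq_of_mem_NB hv).trans hw)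

theorem colJ_raise_self {nb : Finset ℕ} {c : Bool} (hnb : ∀ u ∈ nb, col u = c) (j : ℕ →₀ ℕ)
    {w : ℕ} (hw : col w = c) (T T' : Finset ℕ) :
    colJ col c (raise nb j w T T') = raise nb (colJ col c j) w T T' := by
  ext u
  rw [colJ_apply]
  simp only [raise, Finsupp.sup_apply, Finsupp.indicator_apply, Finsupp.erase_apply, colJ_apply, hw,
    if_true]
  by_cases hu : u ∈ nb
  · simp [hu, hnb u hu]
  · simp only [hu, dif_neg, not_false_eq_true]
    split_ifs <;> simp

theorem colJ_raise_of_ne {nb : Finset ℕ} {c c' : Bool} (hc : c ≠ c') (hnb : ∀ u ∈ nb, col u = c)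
    (j : ℕ →₀ ℕ) {w : ℕ} (hw : col w = c) (T T' : Finset ℕ) :
    colJ col c' (raise nb j w T T') = colJ col c' j := by
  ext u
  rw [colJ_apply, colJ_apply]
  split_ifs with hu
  · have h1 : u ∉ nb := fun h => hc ((hnb u h).symm.trans hu)
    have h2 : u ≠ w := by rintro rfl; exact hc (hw.symm.trans hu)
    simp [raise, Finsupp.indicator_apply, h1, Finsupp.erase_ne h2]
  · rfl

/-- The product of the functional `V` for the two colours. -/
def prodFunctional (col : ℕ → Bool) (V : (ℕ →₀ ℕ) → Finset (Fin d × ℕ × ℕ) → ℝ) (j : ℕ →₀ ℕ)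
    (K : Finset (Fin d × ℕ × ℕ)) : ℝ :=
  V (colJ col false j) (colK col false K) * V (colJ col true j) (colK col true K)

theorem prodFunctional_eq (V : (ℕ →₀ ℕ) → Finset (Fin d × ℕ × ℕ) → ℝ) (c : Bool) (j : ℕ →₀ ℕ)
    (K : Finset (Fin d × ℕ × ℕ)) : prodFunctional col V j K =
      V (colJ col (!c) j) (colK col (!c) K) * V (colJ col c j) (colK col c K) := by
  cases c
  · exact mul_comm _ _
  · rfl

/-- All neighbourhoods involved have the colour of w, so only the factor of this colour is affected
and the other one can be pulled out. -/
theorem arrTerm_prodFunctional (V : (ℕ →₀ ℕ) → Finset (Fin d × ℕ × ℕ) → ℝ) {c : Bool}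
    {K : Finset (Fin d × ℕ × ℕ)} (hm : IsMono k col K) (j : ℕ →₀ ℕ) {w : ℕ} (hw : col w = c) :
    arrTerm k (prodFunctional col V) K j w =
      V (colJ col (!c) j) (colK col (!c) K) * arrTerm k V (colK col c K) (colJ col c j) w := by
  unfold arrTerm
  rw [NB_colK hm hw, Finset.mul_sum]
  refine Finset.sum_congr rfl fun v hv => ?_
  have hv := (hm.col_eq_of_mem_NB hv).trans hw
  rw [NB_colK hm hv, Finset.mul_sum]
  have hnb : ∀ u ∈ NB k K v, col u = c := fun u hu => (hm.col_eq_of_mem_NB hu).trans hv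
  refine Finset.sum_congr rfl fun T _ => ?_
  rw [Finset.mul_sum]
  refine Finset.sum_congr rfl fun T' _ => ?_
  rw [prodFunctional_eq V c, colJ_raise_self hnb j hw,
    colJ_raise_of_ne (by cases c <;> simp) hnb j hw]
  ring

/-- The functional `V` satisfies the equations of the hierarchy up to errors of order `C / n`. -/
def ApproxSolves (k n : ℕ) (col : ℕ → Bool) (R : ℕ) (lam kap C : ℝ)
    (V : (ℕ →₀ ℕ) → Finset (Fin d × ℕ × ℕ) → ℝ) : Prop :=
  ∀ (j : ℕ →₀ ℕ) (K : Finset (Fin d × ℕ × ℕ)) (Kb : ℕ → Finset (Fin d × ℕ × ℕ)),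
    (∀ b ∈ j.support, b < n) → Valid n K → IsMono k col K →
    (∀ b ∈ j.support, ∃ l ≤ R, Fresh n k col (col b) j.support l K (Kb b)) →
    (∀ b ∈ j.support, IsComplete k (Kb b) b) → 2 * (K.card + R) ≤ n →
    |residual k lam kap V Kb j K| ≤ C / n * (j.support.card + kap * K.card) *
      (j.degree + K.card + 1 : ℕ) * (1 / 8) ^ j.degree

/-- A Leibniz rule: the rates |supp j| and 2·`kap`·|K| are additive over the colours, and each
service, forgotten triple or arrival acts on one factor only. Monochromatic K is essential, since a
mixed hyperedge would couple the factors. -/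
theorem residual_prodFunctional {R : ℕ} (lam kap : ℝ)
    (V : (ℕ →₀ ℕ) → Finset (Fin d × ℕ × ℕ) → ℝ) {Kb : ℕ → Finset (Fin d × ℕ × ℕ)} {j : ℕ →₀ ℕ}
    {K : Finset (Fin d × ℕ × ℕ)} (hm : IsMono k col K)
    (hKb : ∀ b ∈ j.support, ∃ l ≤ R, Fresh n k col (col b) j.support l K (Kb b)) :
    residual k lam kap (prodFunctional col V) Kb j K =
      V (colJ col true j) (colK col true K) *
        residual k lam kap V (fun b => colK col false (Kb b)) (colJ col false j) (colK col false K)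
      + V (colJ col false j) (colK col false K) *
        residual k lam kap V (fun b => colK col true (Kb b)) (colJ col true j)
          (colK col true K) := by
  have h1 : ∀ c, ∑ b ∈ j.support.filter (fun b => col b = c),
      prodFunctional col V (j + Finsupp.single b 1) K = V (colJ col (!c) j) (colK col (!c) K) *
        ∑ b ∈ (colJ col c j).support, V (colJ col c j + Finsupp.single b 1) (colK col c K) := by
    intro c
    rw [Finset.mul_sum, support_colJ]
    refine Finset.sum_congr rfl fun b hb => ?_
    have hb := (Finset.mem_filter.1 hb).2
    rw [prodFunctional_eq V c, colJ_add_single_self j hb,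
      colJ_add_single_of_ne j (by rw [hb]; cases c <;> simp)]
  have h2 : ∀ c, ∑ t ∈ K.filter (fun t => col t.2.1 = c), prodFunctional col V j (K.erase t) =
      V (colJ col (!c) j) (colK col (!c) K) *
        ∑ t ∈ colK col c K, V (colJ col c j) ((colK col c K).erase t) := by
    intro c
    rw [Finset.mul_sum]
    refine Finset.sum_congr rfl fun t ht => ?_
    have ht := (Finset.mem_filter.1 ht).2
    rw [prodFunctional_eq V c, colK_erase_self (c := c),
      colK_erase_of_ne (c := !c) (by rw [ht]; cases c <;> simp)]
  have h3 : ∀ c, ∑ b ∈ j.support.filter (fun b => col b = c),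
      arrTerm k (prodFunctional col V) (Kb b) j b = V (colJ col (!c) j) (colK col (!c) K) *
        ∑ b ∈ (colJ col c j).support, arrTerm k V (colK col c (Kb b)) (colJ col c j) b := by
    intro c
    rw [Finset.mul_sum, support_colJ]
    refine Finset.sum_congr rfl fun b hb => ?_
    obtain ⟨hb, hbc⟩ := Finset.mem_filter.1 hb
    obtain ⟨l, -, hF⟩ := hKb b hb
    rw [arrTerm_prodFunctional V (hF.isMono hm) j hbc, hF.colK_of_ne (by rw [hbc]; cases c <;> simp)]
  have hs : ∀ c, (colJ col c j).support.card = (j.support.filter fun b => col b = c).card :=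
    fun c => by rw [support_colJ]
  have hKc : ∀ c, (colK col c K).card = (K.filter fun t => col t.2.1 = c).card := fun c => rfl
  unfold residual
  rw [sum_filter_col j.support col false fun b => prodFunctional col V (j + Finsupp.single b 1) K,
    sum_filter_col K (fun t => col t.2.1) false fun t => prodFunctional col V j (K.erase t),
    sum_filter_col j.support col false fun b => arrTerm k (prodFunctional col V) (Kb b) j b,
    card_filter_col j.support col false, card_filter_col K (fun t => col t.2.1) false]
  simp only [Bool.not_false]
  rw [h1, h1, h2, h2, h3, h3, hs, hs, hKc, hKc]
  simp only [Bool.not_false, Bool.not_true, prodFunctional]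
  ring

theorem Valid.of_le {m : ℕ} {K : Finset (Fin d × ℕ × ℕ)} (hK : Valid n K) (h : n ≤ m) :
    Valid m K :=
  ⟨fun t ht => (hK.vertex_lt t ht).trans_le h, fun t ht => (hK.slot_lt t ht).trans_le h, hK.inj⟩

/-- By the Leibniz rule the residual of each colour is multiplied by a tail of the other, and the
geometric bounds recombine to the full degree. The factors may come from a larger system m, whose
errors C/m are at most C/n. -/
theorem ApproxSolves.prodFunctional {R m : ℕ} {lam kap C : ℝ}
    {V : (ℕ →₀ ℕ) → Finset (Fin d × ℕ × ℕ) → ℝ} (h : ApproxSolves k m col R lam kap C V)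
    (hC : 0 ≤ C) (hkap : 0 ≤ kap) (hn : 0 < n) (hnm : n ≤ m)
    (hV : ∀ j K, (∀ b ∈ j.support, b < m) → |V j K| ≤ (1 / 8) ^ j.degree) :
    ApproxSolves k n col R lam kap C (prodFunctional col V) := by
  intro j K Kb hj hK hm hKb hcomp hR
  rw [residual_prodFunctional lam kap V hm hKb]
  have hjc : ∀ c, ∀ b ∈ (colJ col c j).support, b < m := fun c b hb => by
    rw [support_colJ] at hb
    exact (hj b (Finset.mem_filter.1 hb).1).trans_le hnm
  have hKcard : ∀ c, (colK col c K).card ≤ K.card := fun c => Finset.card_le_card colK_subset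
  have hdeg : ∀ c, (colJ col c j).degree ≤ j.degree := fun c => by
    have := degree_colJ (col := col) c j; omega
  have hpart : ∀ c, |V (colJ col (!c) j) (colK col (!c) K) *
      residual k lam kap V (fun b => colK col c (Kb b)) (colJ col c j) (colK col c K)| ≤
      C / n * ((colJ col c j).support.card + kap * (colK col c K).card) *
        (j.degree + K.card + 1 : ℕ) * (1 / 8) ^ j.degree := by
    intro c
    have h1 := h (colJ col c j) (colK col c K) (fun b => colK col c (Kb b)) (hjc c)
      ((hK.mono colK_subset).of_le hnm) (hm.mono colK_subset) (by
        intro b hb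
        rw [support_colJ] at hb ⊢
        obtain ⟨hb, hbc⟩ := Finset.mem_filter.1 hb
        obtain ⟨l, hl, hF⟩ := hKb b hb
        rw [hbc] at hF ⊢
        exact ⟨l, hl, (hF.of_le hnm).colK_self⟩) (by
        intro b hb
        rw [support_colJ] at hb
        obtain ⟨hb, hbc⟩ := Finset.mem_filter.1 hb
        obtain ⟨l, hl, hF⟩ := hKb b hb
        exact (hcomp b hb).colK (hF.isMono hm) hbc) (by have := hKcard c; omega)
    have h2 := hV (colJ col (!c) j) (colK col (!c) K) (hjc _)
    rw [abs_mul]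
    calc _ ≤ (1 / 8 : ℝ) ^ (colJ col (!c) j).degree * (C / m *
          ((colJ col c j).support.card + kap * (colK col c K).card) *
          ((colJ col c j).degree + (colK col c K).card + 1 : ℕ) * (1 / 8) ^ (colJ col c j).degree) :=
          mul_le_mul h2 h1 (abs_nonneg _) (by positivity)
      _ = C / m * ((colJ col c j).support.card + kap * (colK col c K).card) *
          ((colJ col c j).degree + (colK col c K).card + 1 : ℕ) * (1 / 8) ^ j.degree := by
          rw [← degree_colJ c j, pow_add]; ring
      _ ≤ _ := by
          have h3 := hKcard c
          have h4 := hdeg c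
          have hn' : (0 : ℝ) < n := by exact_mod_cast hn
          gcongr
  refine (abs_add_le _ _).trans ((add_le_add (hpart false) (hpart true)).trans_eq ?_)
  rw [card_filter_col j.support col false, card_filter_col K (fun t => col t.2.1) false,
    support_colJ, support_colJ]
  simp only [Bool.not_false, colK]
  ring

end Product

/-! ### Uniqueness of approximate solutions -/

/-- With D = 1 + d·k there are at most D vertices v, 2^D sets T and 2^D sets T'; the remaining
factor 4 is the loss of one unit of degree. -/
theorem abs_arrTerm_le (hk : 0 < k) {V : (ℕ →₀ ℕ) → Finset (Fin d × ℕ × ℕ) → ℝ}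
    {K : Finset (Fin d × ℕ × ℕ)} (hK : Valid n K) {j : ℕ →₀ ℕ} (hj : ∀ b ∈ j.support, b < n)
    {w : ℕ} (hw : w < n) {s : ℝ} (hs : 0 ≤ s)
    (hV : ∀ j' : ℕ →₀ ℕ, (∀ b ∈ j'.support, b < n) → |V j' K| ≤ s * (1 / 4) ^ j'.degree) :
    |arrTerm k V K j w| ≤ (4 * (1 + d * k) * 4 ^ (1 + d * k) : ℕ) * (s * (1 / 4) ^ j.degree) := by
  set D := 1 + d * k with hD
  have hnb : ∀ v, (NB k K v).card ≤ D := fun v => card_NB_le hk hK v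
  set A : ℝ := 4 * (s * (1 / 4) ^ j.degree) with hA
  have hA0 : 0 ≤ A := by positivity
  have hterm : ∀ v ∈ NB k K w, ∀ T ∈ (NB k K v).powerset.filter (w ∈ ·), ∀ T' ∈ T.powerset,
      |(-1 : ℝ) ^ T'.card * (T.card : ℝ)⁻¹ * V (raise (NB k K v) j w T T') K| ≤ A := by
    intro v hv T hT T' _
    have hwv : w ∈ NB k K v := mem_NB_comm.1 hv
    rw [abs_mul, abs_mul, abs_pow, abs_neg, abs_one, one_pow, one_mul, abs_inv, Nat.abs_cast]
    have h1 : ((T.card : ℝ))⁻¹ ≤ 1 := Nat.cast_inv_le_one _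
    have h2 := hV (raise (NB k K v) j w T T') (by
      intro b hb
      rcases Finset.mem_union.1 (support_raise _ _ _ _ _ hb) with h | h
      · exact hj b h
      · exact NB_lt hK (NB_lt hK hw v hv) b h)
    have h3 := degree_le_degree_raise j hwv T T'
    have h4 : (1 / 4 : ℝ) ^ ((raise (NB k K v) j w T T').degree + 1) ≤ (1 / 4) ^ j.degree :=
      pow_le_pow_of_le_one (by norm_num) (by norm_num) h3
    rw [pow_succ] at h4
    have h5 : s * (1 / 4 : ℝ) ^ (raise (NB k K v) j w T T').degree ≤ A := by
      have : (1 / 4 : ℝ) ^ (raise (NB k K v) j w T T').degree ≤ 4 * (1 / 4) ^ j.degree := by linarith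
      have := mul_le_mul_of_nonneg_left this hs
      rw [hA]; linarith
    calc _ ≤ 1 * A := mul_le_mul h1 (h2.trans h5) (abs_nonneg _) zero_le_one
      _ = A := one_mul _
  have hpow : ∀ v, ((2 : ℝ) ^ (NB k K v).card) ≤ 2 ^ D := fun v =>
    pow_le_pow_right₀ (by norm_num) (hnb v)
  have h1 : ∀ v ∈ NB k K w, |∑ T ∈ (NB k K v).powerset.filter (w ∈ ·), ∑ T' ∈ T.powerset,
      (-1 : ℝ) ^ T'.card * (T.card : ℝ)⁻¹ * V (raise (NB k K v) j w T T') K| ≤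
        2 ^ D * (2 ^ D * A) := by
    intro v hv
    refine (Finset.abs_sum_le_sum_abs _ _).trans ?_
    have h2 : ∀ T ∈ (NB k K v).powerset.filter (w ∈ ·), |∑ T' ∈ T.powerset,
        (-1 : ℝ) ^ T'.card * (T.card : ℝ)⁻¹ * V (raise (NB k K v) j w T T') K| ≤ 2 ^ D * A := by
      intro T hT
      refine (Finset.abs_sum_le_sum_abs _ _).trans
        ((Finset.sum_le_sum fun T' hT' => hterm v hv T hT T' hT').trans ?_)
      rw [Finset.sum_const, Finset.card_powerset, nsmul_eq_mul]
      refine mul_le_mul_of_nonneg_right ?_ hA0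
      push_cast
      refine le_trans ?_ (hpow v)
      exact pow_le_pow_right₀ (by norm_num)
        (Finset.card_le_card (Finset.mem_powerset.1 (Finset.mem_filter.1 hT).1))
    refine (Finset.sum_le_sum h2).trans ?_
    rw [Finset.sum_const, nsmul_eq_mul]
    refine mul_le_mul_of_nonneg_right ?_ (by positivity)
    refine le_trans ?_ (hpow v)
    have := Finset.card_filter_le (NB k K v).powerset (w ∈ ·)
    rw [Finset.card_powerset] at this
    exact_mod_cast this
  refine (Finset.abs_sum_le_sum_abs _ _).trans ((Finset.sum_le_sum h1).trans ?_)
  rw [Finset.sum_const, nsmul_eq_mul]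
  have h3 : ((NB k K w).card : ℝ) ≤ D := by exact_mod_cast hnb w
  calc _ ≤ (D : ℝ) * (2 ^ D * (2 ^ D * A)) := mul_le_mul_of_nonneg_right h3 (by positivity)
    _ = _ := by
      rw [hA, show (4 : ℕ) = 2 * 2 by norm_num, mul_pow]
      push_cast
      ring

theorem residual_sub (lam kap : ℝ) (V V' : (ℕ →₀ ℕ) → Finset (Fin d × ℕ × ℕ) → ℝ)
    (Kb : ℕ → Finset (Fin d × ℕ × ℕ)) (j : ℕ →₀ ℕ) (K : Finset (Fin d × ℕ × ℕ)) :
    residual k lam kap (fun j K => V j K - V' j K) Kb j K =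
      residual k lam kap V Kb j K - residual k lam kap V' Kb j K := by
  unfold residual arrTerm
  simp only [mul_sub, Finset.sum_sub_distrib]
  ring

theorem add_one_mul_inv_two_pow_le (x : ℕ) : ((x + 1 : ℕ) : ℝ) * (1 / 2) ^ x ≤ 1 := by
  have : ((x + 1 : ℕ) : ℝ) ≤ 2 ^ x := by exact_mod_cast Nat.lt_two_pow_self
  rw [one_div, inv_pow, ← div_eq_mul_inv]
  exact div_le_one_of_le₀ this (by positivity)

/-- In the norm with weight 4^(-|j|) 2^|K| the equation for the difference is a contraction by 1/2.
Divided by the total rate S + 2κ, services give S/4, arrivals give S/4 by the smallness of `lam`,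
and forgetting gives 2κ·(1/2) because it halves the weight. So κ, and with it `kap`, drops out. The
a priori bound starts the iteration, and its limit is the error level. -/
theorem abs_sub_le_of_approxSolves (hk : 0 < k) (hkn : k ∣ n) (hn : 0 < n) {col : ℕ → Bool}
    (hcol : ∀ c, ∃ f : ℕ → ℕ, Function.Injective f ∧ ∀ x, col (f x) = c ∧ f x ≤ 2 * x + 1)
    {lam kap C : ℝ} (hl : 0 ≤ lam) (hkap : 0 ≤ kap) (hC : 0 ≤ C)
    (hsmall : lam * (4 * (1 + d * k) * 4 ^ (1 + d * k) : ℕ) * 2 ^ stepBound d k ≤ 1 / 4)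
    {V V' : (ℕ →₀ ℕ) → Finset (Fin d × ℕ × ℕ) → ℝ}
    (h : ApproxSolves k n col (stepBound d k) lam kap C V)
    (h' : ApproxSolves k n col (stepBound d k) lam kap C V')
    (hV : ∀ j K, (∀ b ∈ j.support, b < n) → |V j K| ≤ (1 / 8) ^ j.degree)
    (hV' : ∀ j K, (∀ b ∈ j.support, b < n) → |V' j K| ≤ (1 / 8) ^ j.degree)
    (h0 : ∀ K, Valid n K → V 0 K = V' 0 K)
    {j : ℕ →₀ ℕ} {K : Finset (Fin d × ℕ × ℕ)} (hj : ∀ b ∈ j.support, b < n) (hK : Valid n K)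
    (hm : IsMono k col K) :
    |V j K - V' j K| ≤ 4 * (C + ((k + 2) * (stepBound d k + 1) : ℕ)) / n *
      ((1 / 4) ^ j.degree * 2 ^ K.card) := by
  set R := stepBound d k with hR
  set c₀ := (k + 2) * (R + 1) with hc₀
  set E : ℝ := 4 * (C + (c₀ : ℕ)) / n with hE
  have hn' : (0 : ℝ) < n := by exact_mod_cast hn
  have hE0 : 0 ≤ E := by positivity
  -- The gap between the a priori decay 8^(-|j|) and the weight leaves a spare factor 2^(-|j|-|K|),
  -- which absorbs the linear factor of the residual bound.
  have hw8 : ∀ (j : ℕ →₀ ℕ) (K : Finset (Fin d × ℕ × ℕ)), (1 / 8 : ℝ) ^ j.degree =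
      (1 / 4) ^ j.degree * 2 ^ K.card * (1 / 2) ^ (j.degree + K.card) := by
    intro j K
    have h1 : (2 : ℝ) ^ K.card * (1 / 2) ^ K.card = 1 := by rw [← mul_pow]; norm_num
    rw [show (1 / 8 : ℝ) = 1 / 4 * (1 / 2) by norm_num, mul_pow, pow_add]
    linear_combination -((1 / 4 : ℝ) ^ j.degree * (1 / 2) ^ j.degree) * h1
  have hstep : ∀ s : ℝ, 0 ≤ s → (∀ (j : ℕ →₀ ℕ) (K : Finset (Fin d × ℕ × ℕ)),
      (∀ b ∈ j.support, b < n) → Valid n K → IsMono k col K →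
        |V j K - V' j K| ≤ s * ((1 / 4) ^ j.degree * 2 ^ K.card)) →
      ∀ (j : ℕ →₀ ℕ) (K : Finset (Fin d × ℕ × ℕ)),
      (∀ b ∈ j.support, b < n) → Valid n K → IsMono k col K →
        |V j K - V' j K| ≤ (s / 2 + E / 2) * ((1 / 4) ^ j.degree * 2 ^ K.card) := by
    intro s hs hind j K hj hK hm
    set W : ℝ := (1 / 4) ^ j.degree * 2 ^ K.card with hW
    have hW0 : 0 ≤ W := by positivity
    have hx := add_one_mul_inv_two_pow_le (j.degree + K.card)
    rcases eq_or_ne j 0 with rfl | hj0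
    · rw [h0 K hK, sub_self, abs_zero]; positivity
    -- Fresh extensions need n to be large compared with the degree and |K|. If it is not, the spare
    -- factor is itself of order 1/n and the a priori bounds suffice.
    by_cases hbig : c₀ * (j.degree + K.card + 1) ≤ n
    swap
    · rw [not_le] at hbig
      have h1 : |V j K - V' j K| ≤ 2 * (W * (1 / 2) ^ (j.degree + K.card)) := by
        have h2 := hV j K hj
        have h3 := hV' j K hj
        rw [hw8 j K] at h2 h3
        refine (abs_sub _ _).trans ?_
        linarith
      refine h1.trans ?_
      have h2 : (1 / 2 : ℝ) ^ (j.degree + K.card) ≤ c₀ / n := by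
        rw [le_div_iff₀ hn']
        have h3 : (n : ℝ) ≤ c₀ * (j.degree + K.card + 1 : ℕ) := by exact_mod_cast hbig.le
        calc _ ≤ (1 / 2 : ℝ) ^ (j.degree + K.card) * (c₀ * (j.degree + K.card + 1 : ℕ)) := by gcongr
          _ = c₀ * ((j.degree + K.card + 1 : ℕ) * (1 / 2) ^ (j.degree + K.card)) := by ring
          _ ≤ c₀ * 1 := by gcongr
          _ = c₀ := mul_one _
      have h3 : 2 * (c₀ / n : ℝ) ≤ E / 2 := by
        have : E / 2 = 2 * C / n + 2 * (c₀ / n : ℝ) := by rw [hE]; ring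
        rw [this]
        have : 0 ≤ 2 * C / n := by positivity
        linarith
      calc 2 * (W * (1 / 2) ^ (j.degree + K.card)) ≤ 2 * (W * (c₀ / n)) := by gcongr
        _ = W * (2 * (c₀ / n)) := by ring
        _ ≤ W * (E / 2) := by gcongr
        _ ≤ (s / 2 + E / 2) * W := by nlinarith
    have hJ : j.support.card ≤ j.degree := by
      rw [Finsupp.degree_apply, Finset.card_eq_sum_ones]
      exact Finset.sum_le_sum fun b hb => Nat.one_le_iff_ne_zero.2 (Finsupp.mem_support_iff.1 hb)
    have hbig' : (k + 2) * (K.card + R + j.support.card + 1) ≤ n := by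
      refine le_trans ?_ hbig
      rw [hc₀, mul_assoc]
      refine Nat.mul_le_mul_left _ ?_
      nlinarith
    -- Both functionals are compared along the same extensions, so that the residual is linear in
    -- the difference. Outside the support the choice is arbitrary.
    have hex : ∀ b, ∃ K', b ∈ j.support → (∃ l ≤ R, Fresh n k col (col b) j.support l K K') ∧
        IsComplete k K' b := by
      intro b
      by_cases hb : b ∈ j.support
      · obtain ⟨l, hl, K', hF, hc⟩ := Fresh.exists_isComplete (J := j.support) hk hkn hcol hK hm
          (hj b hb) rfl hbig'
        exact ⟨K', fun _ => ⟨⟨l, hl, hF⟩, hc⟩⟩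
      · exact ⟨∅, fun h => absurd h hb⟩
    choose Kb hKb using hex
    have hR2 : 2 * (K.card + R) ≤ n := by nlinarith
    have e1 := h j K Kb hj hK hm (fun b hb => (hKb b hb).1) (fun b hb => (hKb b hb).2) hR2
    have e2 := h' j K Kb hj hK hm (fun b hb => (hKb b hb).1) (fun b hb => (hKb b hb).2) hR2
    set Δ : (ℕ →₀ ℕ) → Finset (Fin d × ℕ × ℕ) → ℝ := fun j K => V j K - V' j K with hΔ
    have hres : |residual k lam kap Δ Kb j K| ≤
        2 * (C / n * (j.support.card + kap * K.card) * W) := by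
      rw [hΔ, residual_sub]
      refine (abs_sub _ _).trans ?_
      have h3 : C / n * (j.support.card + kap * K.card) * (j.degree + K.card + 1 : ℕ) *
          (1 / 8 : ℝ) ^ j.degree ≤ C / n * (j.support.card + kap * K.card) * W := by
        rw [hw8 j K]
        calc _ = C / n * (j.support.card + kap * K.card) * W *
              ((j.degree + K.card + 1 : ℕ) * (1 / 2) ^ (j.degree + K.card)) := by ring
          _ ≤ C / n * (j.support.card + kap * K.card) * W * 1 := by gcongr
          _ = _ := mul_one _
      linarith
    have hA : |∑ b ∈ j.support, Δ (j + Finsupp.single b 1) K| ≤ j.support.card * (s * W / 4) := by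
      refine (Finset.abs_sum_le_sum_abs _ _).trans ((Finset.sum_le_sum fun b hb => ?_).trans_eq
        (by rw [Finset.sum_const, nsmul_eq_mul]))
      refine (hind _ K (fun u hu => ?_) hK hm).trans_eq ?_
      · rcases Finset.mem_union.1 (Finsupp.support_add hu) with hu | hu
        · exact hj u hu
        · rw [Finset.mem_singleton.1 (Finsupp.support_single_subset hu)]; exact hj b hb
      · rw [map_add, Finsupp.degree_single, pow_succ, hW]; ring
    have hM : |∑ t ∈ K, Δ j (K.erase t)| ≤ K.card * (s * W / 2) := by
      refine (Finset.abs_sum_le_sum_abs _ _).trans ((Finset.sum_le_sum fun t ht => ?_).trans_eq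
        (by rw [Finset.sum_const, nsmul_eq_mul]))
      refine (hind j _ hj (hK.mono (Finset.erase_subset _ _))
        (hm.mono (Finset.erase_subset _ _))).trans_eq ?_
      have h1 := Finset.card_erase_add_one ht
      rw [hW, ← h1, pow_succ]; ring
    have hArr : |lam * ∑ b ∈ j.support, arrTerm k Δ (Kb b) j b| ≤
        j.support.card * (s * W / 4) := by
      rw [Finset.mul_sum]
      refine (Finset.abs_sum_le_sum_abs _ _).trans ((Finset.sum_le_sum fun b hb => ?_).trans_eq
        (by rw [Finset.sum_const, nsmul_eq_mul]))
      obtain ⟨⟨l, hlR, hF⟩, -⟩ := hKb b hb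
      have h1 := abs_arrTerm_le (V := Δ) hk (hF.valid hK) hj (hj b hb)
        (s := s * 2 ^ (Kb b).card) (by positivity) (fun j' hj' =>
          (hind j' _ hj' (hF.valid hK) (hF.isMono hm)).trans_eq (by ring))
      rw [abs_mul, abs_of_nonneg hl]
      -- Revealing up to R triples inflates the weight by 2^R; this is the reason for the power of
      -- two in `hsmall'`.
      have h2 : (2 : ℝ) ^ (Kb b).card ≤ 2 ^ K.card * 2 ^ R := by
        rw [← pow_add]
        exact pow_le_pow_right₀ (by norm_num) (hF.card_le.trans (by omega))
      calc _ ≤ lam * ((4 * (1 + d * k) * 4 ^ (1 + d * k) : ℕ) *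
            (s * (2 ^ K.card * 2 ^ R) * (1 / 4) ^ j.degree)) := by
            refine mul_le_mul_of_nonneg_left (h1.trans ?_) hl
            gcongr
        _ = (lam * (4 * (1 + d * k) * 4 ^ (1 + d * k) : ℕ) * 2 ^ R) * (s * W) := by rw [hW]; ring
        _ ≤ 1 / 4 * (s * W) := by gcongr
        _ = _ := by ring
    set S : ℝ := (j.support.card : ℝ) with hS
    set κ : ℝ := kap * K.card with hκ
    have hS1 : 1 ≤ S := by
      have : 0 < j.support.card := Finset.card_pos.2 (Finsupp.support_nonempty_iff.2 hj0)
      rw [hS]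
      exact_mod_cast this
    have hκ0 : 0 ≤ κ := by positivity
    have hM' : |2 * kap * ∑ t ∈ K, Δ j (K.erase t)| ≤ 2 * κ * (s * W / 2) := by
      rw [abs_mul, abs_of_nonneg (by positivity : 0 ≤ 2 * kap)]
      calc _ ≤ 2 * kap * (K.card * (s * W / 2)) := by gcongr
        _ = _ := by rw [hκ]; ring
    have hkey : (S + 2 * κ) * Δ j K = residual k lam kap Δ Kb j K +
        ∑ b ∈ j.support, Δ (j + Finsupp.single b 1) K + 2 * kap * ∑ t ∈ K, Δ j (K.erase t) +
        lam * ∑ b ∈ j.support, arrTerm k Δ (Kb b) j b := by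
      unfold residual; rw [hκ, hS]; ring
    have hbound : (S + 2 * κ) * |Δ j K| ≤ (S + 2 * κ) * ((s / 2 + E / 2) * W) := by
      rw [← abs_of_pos (by linarith : 0 < S + 2 * κ), ← abs_mul, hkey,
        abs_of_pos (by linarith : 0 < S + 2 * κ)]
      have h1 := abs_add_le (residual k lam kap Δ Kb j K +
        ∑ b ∈ j.support, Δ (j + Finsupp.single b 1) K + 2 * kap * ∑ t ∈ K, Δ j (K.erase t))
        (lam * ∑ b ∈ j.support, arrTerm k Δ (Kb b) j b)
      have h2 := abs_add_three (residual k lam kap Δ Kb j K)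
        (∑ b ∈ j.support, Δ (j + Finsupp.single b 1) K) (2 * kap * ∑ t ∈ K, Δ j (K.erase t))
      have h3 : 2 * (C / n * (S + κ) * W) ≤ (S + 2 * κ) * (E / 2 * W) := by
        have h4 : 2 * (C / n) ≤ E / 2 := by
          have : E / 2 = 2 * (C / n) + 2 * c₀ / n := by rw [hE]; ring
          rw [this]
          have : (0 : ℝ) ≤ 2 * c₀ / n := by positivity
          linarith
        calc _ = (S + κ) * (2 * (C / n) * W) := by ring
          _ ≤ (S + 2 * κ) * (E / 2 * W) := by
            gcongr
            linarith
      linarith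
    exact le_of_mul_le_mul_left hbound (by linarith)
  -- E is the fixed point of s ↦ s/2 + E/2, and the initial excess 2 is halved at every iteration.
  have hiter : ∀ N : ℕ, ∀ (j : ℕ →₀ ℕ) (K : Finset (Fin d × ℕ × ℕ)),
      (∀ b ∈ j.support, b < n) → Valid n K → IsMono k col K →
        |V j K - V' j K| ≤ (2 * (1 / 2) ^ N + E) * ((1 / 4) ^ j.degree * 2 ^ K.card) := by
    intro N
    induction N with
    | zero =>
      intro j K hj _ _
      have h2 := hV j K hj
      have h3 := hV' j K hj
      have h4 : (1 / 8 : ℝ) ^ j.degree ≤ (1 / 4) ^ j.degree * 2 ^ K.card := by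
        rw [hw8 j K]
        exact mul_le_of_le_one_right (by positivity) (pow_le_one₀ (by norm_num) (by norm_num))
      have h5 := abs_sub (V j K) (V' j K)
      have h6 : 0 ≤ E * ((1 / 4) ^ j.degree * 2 ^ K.card) := by positivity
      rw [pow_zero]
      linarith
    | succ N ih =>
      intro j K hj hK hm
      refine (hstep _ (by positivity) ih j K hj hK hm).trans_eq ?_
      rw [pow_succ]; ring
  have hlim : Filter.Tendsto (fun N : ℕ => (2 * (1 / 2 : ℝ) ^ N + E) *
      ((1 / 4) ^ j.degree * 2 ^ K.card)) Filter.atTop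
      (nhds ((2 * 0 + E) * ((1 / 4) ^ j.degree * 2 ^ K.card))) :=
    (((tendsto_pow_atTop_nhds_zero_of_lt_one (by norm_num) (by norm_num)).const_mul 2).add_const
      E).mul_const _
  rw [mul_zero, zero_add] at hlim
  exact ge_of_tendsto' hlim fun N => hiter N j K hj hK hm

/-! ### One-point and two-point tail probabilities at stationarity -/

/-- Uniform slot permutations induce uniform partitions. Sum over all pairs of partitions G and
permutations in two ways: for fixed G the relabelled sums are those of the slot partitions, for
fixed permutations the relabelling is a bijection of the partitions. -/
theorem avg_empty_graphOf (hk : 0 < k) (hkn : k ∣ n) (F : (Fin d → EqualPartition n k) → ℝ) :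
    avg n ∅ (fun τ => F (graphOf hk hkn τ)) =
      (∑ G, F G) / Fintype.card (Fin d → EqualPartition n k) := by
  classical
  have hE : Ext n (∅ : Finset (Fin d × ℕ × ℕ)) = Finset.univ := by
    ext τ; simp [mem_Ext]
  have h1 : ∀ G : Fin d → EqualPartition n k,
      ∑ τ : Fin d → Equiv.Perm (Fin n), F (fun i => (G i).relabel (τ i)) =
        ∑ τ, F (graphOf hk hkn τ) := by
    intro G
    choose ρ hρ using fun i => exists_eq_slotPartition_relabel hk hkn (G i)
    conv_rhs => rw [← Equiv.sum_comp (Equiv.mulLeft ρ)]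
    refine Finset.sum_congr rfl fun τ _ => ?_
    congr 1
    funext i
    rw [hρ i]
    rfl
  have h2 : ∀ τ : Fin d → Equiv.Perm (Fin n),
      ∑ G : Fin d → EqualPartition n k, F (fun i => (G i).relabel (τ i)) = ∑ G, F G := fun τ =>
    Equiv.sum_comp (Equiv.piCongrRight fun i => EqualPartition.relabelEquiv (k := k) (τ i)) F
  have h3 : (Fintype.card (Fin d → EqualPartition n k) : ℝ) * ∑ τ, F (graphOf hk hkn τ) =
      Fintype.card (Fin d → Equiv.Perm (Fin n)) * ∑ G, F G := by
    rw [← nsmul_eq_mul, ← nsmul_eq_mul, Fintype.card, ← Finset.sum_const, Fintype.card,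
      ← Finset.sum_const, ← Finset.sum_congr rfl fun G _ => h1 G,
      ← Finset.sum_congr rfl fun τ _ => h2 τ, Finset.sum_comm]
  have h4 : (0 : ℝ) < Fintype.card (Fin d → EqualPartition n k) := by
    have : Nonempty (Fin d → EqualPartition n k) := ⟨graphOf hk hkn 1⟩
    exact_mod_cast Fintype.card_pos
  have h5 : (0 : ℝ) < Fintype.card (Fin d → Equiv.Perm (Fin n)) := by
    exact_mod_cast Fintype.card_pos
  rw [avg, hE, Finset.card_univ, div_eq_div_iff h5.ne' h4.ne']
  linarith

theorem exists_perm_apply_eq {x : ℕ} {v w : Fin x → Fin n} (hv : Function.Injective v)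
    (hw : Function.Injective w) : ∃ σ : Equiv.Perm (Fin n), ∀ i, σ (v i) = w i := by
  have := Equiv.Perm.isMultiplyPretransitive (Fin n) x
  obtain ⟨σ, hσ⟩ := MulAction.exists_smul_eq (Equiv.Perm (Fin n))
    (⟨v, hv⟩ : Fin x ↪ Fin n) ⟨w, hw⟩
  exact ⟨σ, fun i => DFunLike.congr_fun hσ i⟩

theorem injective_pair {v w : Fin n} (h : v ≠ w) : Function.Injective ![v, w] := by
  intro a b hab
  fin_cases a <;> fin_cases b <;> simp_all

theorem integral_ind_queue (π : Measure (State d k n)) (j : Fin n → ℕ) :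
    ∫ s, ind j s.queue ∂π = π.real {s | j ≤ s.queue} := by
  classical
  rw [← integral_indicator_one MeasurableSet.of_discrete]
  refine integral_congr_ae (.of_forall fun s => ?_)
  simp [ind, Set.indicator_apply]

/-- The colouring of the vertices by parity. -/
def parity (b : ℕ) : Bool := decide (b % 2 = 1)

theorem exists_injective_parity (c : Bool) :
    ∃ f : ℕ → ℕ, Function.Injective f ∧ ∀ x, parity (f x) = c ∧ f x ≤ 2 * x + 1 := by
  cases c
  · exact ⟨fun x => 2 * x, fun x y h => by simpa using h, fun x => ⟨by simp [parity], by simp⟩⟩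
  · exact ⟨fun x => 2 * x + 1, fun x y h => by simpa using h,
      fun x => ⟨by simp [parity, Nat.add_mod], le_rfl⟩⟩

/-- The constant in the bounds on the one-point and two-point tail probabilities. -/
def tailConst (d k : ℕ) : ℝ :=
  4 * ((6 + 4 * stepBound d k * (k + 1) * (stepBound d k + 1) : ℕ) +
    ((k + 2) * (stepBound d k + 1) : ℕ))

theorem valid_empty : Valid n (∅ : Finset (Fin d × ℕ × ℕ)) :=
  ⟨by simp, by simp, by simp⟩

theorem isMono_empty {col : ℕ → Bool} : IsMono k col (∅ : Finset (Fin d × ℕ × ℕ)) := by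
  intro t ht
  simp at ht

/-- Both sides approximately solve the hierarchy on parity-monochromatic partial assignments and
agree at j = 0. With m = n and one vertex of each parity it expresses pairwise decorrelation; with m
≥ n and a single vertex it compares the one-point tails of two system sizes. -/
theorem abs_tailProb_sub_prod_le (hk : 0 < k) (hkn : k ∣ n) (hn : 0 < n) {m : ℕ} (hkm : k ∣ m)
    (hnm : n ≤ m) {lam kap : ℝ} (hl : 0 ≤ lam) (hkap : 0 ≤ kap)
    (hsmall : lam * (1 + d * k : ℕ) * 8 ≤ 1)
    (hsmall' : lam * (4 * (1 + d * k) * 4 ^ (1 + d * k) : ℕ) * 2 ^ stepBound d k ≤ 1 / 4)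
    {ν : (Fin d → EqualPartition n k) → Measure (Fin n → ℕ)} (hν : IsLocalEquilibrium lam kap ν)
    {ν' : (Fin d → EqualPartition m k) → Measure (Fin m → ℕ)}
    (hν' : IsLocalEquilibrium lam kap ν') {j : ℕ →₀ ℕ} (hj : ∀ b ∈ j.support, b < n) :
    |tailProb hk hkn ν j ∅ - tailProb hk hkm ν' (colJ parity false j) ∅ *
      tailProb hk hkm ν' (colJ parity true j) ∅| ≤ tailConst d k / n * (1 / 4) ^ j.degree := by
  have hsol : ∀ {n : ℕ} (hkn : k ∣ n) (_ : 0 < n)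
      {ν : (Fin d → EqualPartition n k) → Measure (Fin n → ℕ)} (_ : IsLocalEquilibrium lam kap ν),
      ApproxSolves k n parity (stepBound d k) lam kap
        ((6 + 4 * stepBound d k * (k + 1) * (stepBound d k + 1) : ℕ) : ℝ) (tailProb hk hkn ν) := by
    intro n hkn hn ν hν j K Kb hj hK _ hKb hc hR
    exact abs_residual_tailProb_le hν hk hkn hn hl hkap hsmall hj hK hKb hc hR
  have hV' : ∀ j K, (∀ b ∈ j.support, b < m) →
      |tailProb hk hkm ν' j K| ≤ (1 / 8) ^ j.degree := fun j K hj =>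
    abs_tailProb_le hν' hk hkm hj K
  have hs : ∀ c (j : ℕ →₀ ℕ), (∀ b ∈ j.support, b < n) →
      ∀ b ∈ (colJ parity c j).support, b < m := fun c j hj b hb => by
    rw [support_colJ] at hb
    exact (hj b (Finset.mem_filter.1 hb).1).trans_le hnm
  have h := abs_sub_le_of_approxSolves hk hkn hn exists_injective_parity hl hkap
    (Nat.cast_nonneg _) hsmall' (hsol hkn hn hν)
    ((hsol hkm (hn.trans_le hnm) hν').prodFunctional (Nat.cast_nonneg _) hkap hn hnm hV')
    (fun j K hj => abs_tailProb_le hν hk hkn hj K) (fun j K hj => by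
      unfold prodFunctional
      rw [abs_mul, ← degree_colJ (col := parity) false j, pow_add]
      exact mul_le_mul (hV' _ _ (hs _ j hj)) (hV' _ _ (hs _ j hj)) (abs_nonneg _) (by positivity))
    (fun K hK => by
      have h0 : ∀ c, colJ parity c 0 = 0 := fun c => Finsupp.filter_zero _
      rw [prodFunctional, h0, h0, tailProb_zero hν hk hkn hK,
        tailProb_zero hν' hk hkm ((hK.mono colK_subset).of_le hnm),
        tailProb_zero hν' hk hkm ((hK.mono colK_subset).of_le hnm), one_mul])
    hj valid_empty isMono_empty
  rw [Finset.card_empty, pow_zero, mul_one] at h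
  exact h

theorem colJ_single_self {col : ℕ → Bool} {c : Bool} {b a : ℕ} (h : col b = c) :
    colJ col c (Finsupp.single b a) = Finsupp.single b a :=
  Finsupp.filter_single_of_pos _ h

theorem colJ_single_of_ne {col : ℕ → Bool} {c : Bool} {b a : ℕ} (h : col b ≠ c) :
    colJ col c (Finsupp.single b a) = 0 :=
  Finsupp.filter_single_of_neg _ h

theorem vec_single (b : Fin n) (a : ℕ) : vec n (Finsupp.single (b : ℕ) a) = Pi.single b a := by
  ext u
  simp only [vec, Finsupp.single_apply, Pi.single_apply, Fin.ext_iff, eq_comm]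

theorem vec_add (j j' : ℕ →₀ ℕ) : vec n (j + j') = vec n j + vec n j' := rfl

theorem single_le_iff {v : Fin n} {a : ℕ} {Q : Fin n → ℕ} : Pi.single v a ≤ Q ↔ a ≤ Q v := by
  constructor
  · intro h
    simpa using h v
  · intro h u
    rcases eq_or_ne u v with rfl | hu
    · simpa using h
    · simp [hu]

theorem single_add_single_le_iff {v w : Fin n} (hvw : v ≠ w) {a : ℕ} {Q : Fin n → ℕ} :
    Pi.single v a + Pi.single w a ≤ Q ↔ a ≤ Q v ∧ a ≤ Q w := by
  constructor
  · intro h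
    have h1 := h v
    have h2 := h w
    simp [hvw, hvw.symm] at h1 h2
    exact ⟨h1, h2⟩
  · rintro ⟨h1, h2⟩ u
    rcases eq_or_ne u v with rfl | hu
    · simpa [hvw] using h1
    · rcases eq_or_ne u w with rfl | hu'
      · simpa [hu] using h2
      · simp [hu, hu']

/-- A law of states whose queue lengths are exchangeable, with one-point tail probabilities `p` and
almost independent queue lengths. -/
structure IsAsympIndep (C : ℝ) (p : ℕ → ℝ) (π : Measure (State d k n)) : Prop where
  exch : ∀ (σ : Equiv.Perm (Fin n)) (f : (Fin n → ℕ) → ℝ), (∃ B : ℝ, ∀ Q, |f Q| ≤ B) →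
    ∫ s, f (s.queue ∘ σ) ∂π = ∫ s, f s.queue ∂π
  tail : ∀ v a, π.real {s | a ≤ s.queue v} = p a
  tail_le : ∀ a, p a ≤ (1 / 8) ^ a
  pair : ∀ v w a, v ≠ w →
    |π.real {s | a ≤ s.queue v ∧ a ≤ s.queue w} - p a ^ 2| ≤ C / n * (1 / 4) ^ a

/-- Vertices 0 and 1 have different parity, so their queues are nearly independent; exchangeability
transfers this to every pair. -/
theorem exists_stationary_family (d : ℕ) (hk : 0 < k) {lam kap : ℝ} (hl : 0 ≤ lam)
    (hkap : 0 ≤ kap) (hsmall : lam * (1 + d * k : ℕ) * 8 ≤ 7 / 8)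
    (hsmall' : lam * (4 * (1 + d * k) * 4 ^ (1 + d * k) : ℕ) * 2 ^ stepBound d k ≤ 1 / 4) :
    ∃ (π : ∀ n, Measure (State d k n)) (p : ℕ → ℕ → ℝ), ∀ n, 0 < n → k ∣ n →
      IsStationaryLaw lam kap (π n) ∧ IsAsympIndep (tailConst d k) (p n) (π n) ∧
      ∀ m, n ≤ m → k ∣ m → ∀ a, |p n a - p m a| ≤ tailConst d k / n * (1 / 4) ^ a := by
  classical
  have hex : ∀ n, ∃ (π : Measure (State d k n))
      (ν : (Fin d → EqualPartition n k) → Measure (Fin n → ℕ)), k ∣ n →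
      (IsStationaryLaw lam kap π ∧ IsLocalEquilibrium lam kap ν ∧
      (∀ f : (Fin n → ℕ) → ℝ, (∃ B : ℝ, ∀ Q, |f Q| ≤ B) → ∫ s, f s.queue ∂π =
        (∑ G : Fin d → EqualPartition n k, ∫ Q, f Q ∂ν G) /
          Fintype.card (Fin d → EqualPartition n k)) ∧
      (∀ (σ : Equiv.Perm (Fin n)) (f : State d k n → ℝ), (∃ B : ℝ, ∀ s, |f s| ≤ B) →
        ∫ s, f (s.relabel σ) ∂π = ∫ s, f s ∂π)) := by
    intro n
    by_cases hkn : k ∣ n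
    · have : Nonempty (EqualPartition n k) := ⟨slotPartition hk hkn⟩
      obtain ⟨π, ν, h⟩ := exists_localEquilibrium (d := d) (n := n) (k := k) hl hkap hsmall
      exact ⟨π, ν, fun _ => h⟩
    · exact ⟨0, 0, fun h => absurd h hkn⟩
  choose π ν h using hex
  have hsmall1 : lam * (1 + d * k : ℕ) * 8 ≤ 1 := hsmall.trans (by norm_num)
  have hexp : ∀ n (hkn : k ∣ n) (j : ℕ →₀ ℕ),
      (π n).real {s | vec n j ≤ s.queue} = tailProb hk hkn (ν n) j ∅ := by
    intro n hkn j
    rw [← integral_ind_queue, (h n hkn).2.2.1 _ ⟨1, abs_ind_le _⟩]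
    exact (avg_empty_graphOf hk hkn fun G => ∫ Q, ind (vec n j) Q ∂ν n G).symm
  have hexch : ∀ n, k ∣ n → ∀ (σ : Equiv.Perm (Fin n)) (f : (Fin n → ℕ) → ℝ),
      (∃ B : ℝ, ∀ Q, |f Q| ≤ B) → ∫ s, f (s.queue ∘ σ) ∂π n = ∫ s, f s.queue ∂π n :=
    fun n hkn σ f ⟨B, hB⟩ => (h n hkn).2.2.2 σ (fun s => f s.queue) ⟨B, fun s => hB _⟩
  set p : ℕ → ℕ → ℝ := fun n a =>
    if hkn : k ∣ n then tailProb hk hkn (ν n) (Finsupp.single 0 a) ∅ else 0 with hp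
  have hp' : ∀ n (hkn : k ∣ n) a, p n a = tailProb hk hkn (ν n) (Finsupp.single 0 a) ∅ :=
    fun n hkn a => dif_pos hkn
  have htail : ∀ n, k ∣ n → ∀ (v : Fin n) a, (π n).real {s | a ≤ s.queue v} = p n a := by
    intro n hkn v a
    have hn : 0 < n := v.pos
    have h1 := hexch n hkn (Equiv.swap ⟨0, hn⟩ v) (ind (Pi.single ⟨0, hn⟩ a)) ⟨1, abs_ind_le _⟩
    have h2 := integral_ind_queue (π n) (Pi.single v a)
    have h3 := hexp n hkn (Finsupp.single 0 a)
    rw [show vec n (Finsupp.single 0 a) = Pi.single ⟨0, hn⟩ a from vec_single ⟨0, hn⟩ a,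
      ← integral_ind_queue, ← h1] at h3
    rw [hp' n hkn, ← h3]
    simp only [single_le_iff] at h2
    rw [← h2]
    refine integral_congr_ae (.of_forall fun s => ind_congr ?_)
    rw [single_le_iff, single_le_iff, Function.comp_apply, Equiv.swap_apply_left]
  have hsupp : ∀ n, 0 < n → ∀ a, ∀ b ∈ (Finsupp.single 0 a : ℕ →₀ ℕ).support, b < n := by
    intro n hn a b hb
    rw [Finset.mem_singleton.1 (Finsupp.support_single_subset hb)]
    exact hn
  have hpar0 : parity 0 = false := rfl
  have hpar1 : parity 1 = true := rfl
  refine ⟨π, p, fun n hn hkn => ⟨(h n hkn).1, ⟨hexch n hkn, htail n hkn, fun a => ?_, ?_⟩, ?_⟩⟩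
  · have h1 := abs_tailProb_le (h n hkn).2.1 hk hkn (hsupp n hn a) ∅
    rw [Finsupp.degree_single] at h1
    rw [hp' n hkn]
    exact (le_abs_self _).trans h1
  · intro v w a hvw
    have hn1 : 1 < n := by
      by_contra hlt
      have hv := v.2
      have hw := w.2
      exact hvw (Fin.ext (by omega))
    -- The estimate is available for vertices of different colour only; a permutation carries 0 and
    -- 1 to an arbitrary pair.
    obtain ⟨σ, hσ⟩ := exists_perm_apply_eq (v := ![(⟨0, hn⟩ : Fin n), ⟨1, hn1⟩]) (w := ![v, w])
      (injective_pair (by simp)) (injective_pair hvw)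
    have hσ0 : σ ⟨0, hn⟩ = v := hσ 0
    have hσ1 : σ ⟨1, hn1⟩ = w := hσ 1
    have h01 : (⟨0, hn⟩ : Fin n) ≠ ⟨1, hn1⟩ := by simp
    have h1 := hexch n hkn σ (ind (Pi.single ⟨0, hn⟩ a + Pi.single ⟨1, hn1⟩ a)) ⟨1, abs_ind_le _⟩
    have h2 := integral_ind_queue (π n) (Pi.single v a + Pi.single w a)
    have h3 := hexp n hkn (Finsupp.single 0 a + Finsupp.single 1 a)
    rw [vec_add, show vec n (Finsupp.single 0 a) = Pi.single ⟨0, hn⟩ a from vec_single ⟨0, hn⟩ a,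
      show vec n (Finsupp.single 1 a) = Pi.single ⟨1, hn1⟩ a from vec_single ⟨1, hn1⟩ a,
      ← integral_ind_queue, ← h1] at h3
    simp only [single_add_single_le_iff hvw] at h2
    have h4 : tailProb hk hkn (ν n) (Finsupp.single 1 a) ∅ = p n a := by
      rw [← htail n hkn ⟨1, hn1⟩ a, ← hexp n hkn,
        show vec n (Finsupp.single 1 a) = Pi.single ⟨1, hn1⟩ a from vec_single ⟨1, hn1⟩ a]
      simp only [single_le_iff]
    have h5 := abs_tailProb_sub_prod_le hk hkn hn hkn le_rfl hl hkap hsmall1 hsmall'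
      (h n hkn).2.1 (h n hkn).2.1 (j := Finsupp.single 0 a + Finsupp.single 1 a) (by
        intro b hb
        rcases Finset.mem_union.1 (Finsupp.support_add hb) with hb | hb
        · exact hsupp n hn a b hb
        · rw [Finset.mem_singleton.1 (Finsupp.support_single_subset hb)]; exact hn1)
    have hadd : ∀ c (j j' : ℕ →₀ ℕ), colJ parity c (j + j') = colJ parity c j + colJ parity c j' :=
      fun c j j' => Finsupp.filter_add
    rw [hadd, hadd, colJ_single_self hpar0, colJ_single_of_ne (by rw [hpar1]; simp),
      colJ_single_of_ne (by rw [hpar0]; simp), colJ_single_self hpar1, add_zero, zero_add, h4,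
      ← hp' n hkn, ← sq, ← h3, map_add, Finsupp.degree_single, Finsupp.degree_single, pow_add]
      at h5
    rw [← h2]
    have h6 : ∫ s, ind (Pi.single v a + Pi.single w a) s.queue ∂π n =
        ∫ s, ind (Pi.single ⟨0, hn⟩ a + Pi.single ⟨1, hn1⟩ a) (s.queue ∘ σ) ∂π n := by
      refine integral_congr_ae (.of_forall fun s => ind_congr ?_)
      rw [single_add_single_le_iff hvw, single_add_single_le_iff h01, Function.comp_apply,
        Function.comp_apply, hσ0, hσ1]
    rw [h6]
    refine h5.trans (mul_le_mul_of_nonneg_left ?_ (by unfold tailConst; positivity))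
    exact mul_le_of_le_one_left (by positivity) (pow_le_one₀ (by norm_num) (by norm_num))
  · intro m hnm hkm a
    have h5 := abs_tailProb_sub_prod_le hk hkn hn hkm hnm hl hkap hsmall1 hsmall'
      (h n hkn).2.1 (h m hkm).2.1 (hsupp n hn a)
    rw [colJ_single_self hpar0, colJ_single_of_ne (by rw [hpar0]; simp),
      tailProb_zero (h m hkm).2.1 hk hkm valid_empty, mul_one, ← hp' n hkn, ← hp' m hkm,
      Finsupp.degree_single] at h5
    exact h5

/-! ### Mixtures of product measures -/

theorem integrable_of_bound {α : Type*} [MeasurableSpace α] [DiscreteMeasurableSpace α]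
    {μ : Measure α} [IsFiniteMeasure μ] {f : α → ℝ} {B : ℝ} (hf : ∀ s, |f s| ≤ B) :
    Integrable f μ :=
  Integrable.of_bound (Measurable.of_discrete).aestronglyMeasurable B (.of_forall hf)

/-- The iterated integral of `F` with respect to `ρ`. -/
def iterInt (ρ : Measure ℕ) : (x : ℕ) → ((Fin x → ℕ) → ℝ) → ℝ
  | 0, F => F default
  | x + 1, F => ∫ y, iterInt ρ x (fun z => F (Fin.cons y z)) ∂ρ

theorem abs_iterInt_le (ρ : Measure ℕ) [IsProbabilityMeasure ρ] (x : ℕ) {F : (Fin x → ℕ) → ℝ}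
    {B : ℝ} (hF : ∀ z, |F z| ≤ B) : |iterInt ρ x F| ≤ B := by
  induction x with
  | zero => exact hF _
  | succ x ih => exact abs_integral_le_of_abs_le fun y => ih fun z => hF _

theorem iterInt_eq_integral_pi (η : Measure ℕ) [IsProbabilityMeasure η] (x : ℕ)
    {F : (Fin x → ℕ) → ℝ} {B : ℝ} (hF : ∀ z, |F z| ≤ B) :
    iterInt η x F = ∫ z, F z ∂Measure.pi fun _ => η := by
  induction x with
  | zero =>
    rw [Measure.pi_of_empty (fun _ : Fin 0 => η) default, integral_dirac]
    rfl
  | succ x ih =>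
    have h := (measurePreserving_piFinSuccAbove (fun _ : Fin (x + 1) => η) 0).symm
    rw [← h.integral_comp', integral_prod]
    · refine integral_congr_ae (.of_forall fun y => ?_)
      show iterInt η x (fun z => F (Fin.cons y z)) = _
      rw [ih fun z => hF _]
      refine integral_congr_ae (.of_forall fun z => ?_)
      simp [MeasurableEquiv.piFinSuccAbove, Fin.insertNthEquiv, MeasurableEquiv.symm]
    · exact integrable_of_bound fun z => hF _

/-- Replace one coordinate at a time; each replacement costs B·D. -/
theorem abs_iterInt_sub_le {ρ η : Measure ℕ} [IsProbabilityMeasure ρ] [IsProbabilityMeasure η]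
    {D : ℝ} (hD : ∀ (f : ℕ → ℝ) (B : ℝ), (∀ y, |f y| ≤ B) →
      |∫ y, f y ∂ρ - ∫ y, f y ∂η| ≤ B * D) (x : ℕ) {F : (Fin x → ℕ) → ℝ} {B : ℝ}
    (hF : ∀ z, |F z| ≤ B) : |iterInt ρ x F - iterInt η x F| ≤ x * (B * D) := by
  induction x with
  | zero => simp [iterInt]
  | succ x ih =>
    have hg : ∀ y, |iterInt ρ x fun z => F (Fin.cons y z)| ≤ B := fun y =>
      abs_iterInt_le ρ x fun z => hF _
    have hh : ∀ y, |iterInt η x fun z => F (Fin.cons y z)| ≤ B := fun y =>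
      abs_iterInt_le η x fun z => hF _
    have h1 : iterInt ρ (x + 1) F - iterInt η (x + 1) F =
        ∫ y, ((iterInt ρ x fun z => F (Fin.cons y z)) - iterInt η x fun z => F (Fin.cons y z)) ∂ρ +
        (∫ y, (iterInt η x fun z => F (Fin.cons y z)) ∂ρ -
          ∫ y, (iterInt η x fun z => F (Fin.cons y z)) ∂η) := by
      rw [integral_sub (integrable_of_bound hg) (integrable_of_bound hh)]
      simp only [iterInt]
      ring
    rw [h1]
    have h2 := abs_integral_le_of_abs_le (μ := ρ) fun y => ih (F := fun z => F (Fin.cons y z))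
      fun z => hF _
    have h3 := hD _ B hh
    refine (abs_add_le _ _).trans ((add_le_add h2 h3).trans_eq ?_)
    push_cast
    ring

/-- Replacing coordinates one by one for each ω would cost x times the mean of D, only of order
n^(-1/2). Averaging over ω first cancels the linear fluctuation up to the bias e. What is left are
products of two fluctuations, at most x² times the mean square of D. -/
theorem abs_integral_iterInt_sub_le {Ω : Type*} [MeasurableSpace Ω] [DiscreteMeasurableSpace Ω]
    [Countable Ω] {μ : Measure Ω} [IsProbabilityMeasure μ] {ρ : Ω → Measure ℕ}
    [∀ ω, IsProbabilityMeasure (ρ ω)] {η : Measure ℕ} [IsProbabilityMeasure η] {D : Ω → ℝ}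
    {e M : ℝ} (hD0 : ∀ ω, 0 ≤ D ω) (hDM : ∀ ω, D ω ≤ M)
    (hD : ∀ ω (f : ℕ → ℝ) (B : ℝ), (∀ y, |f y| ≤ B) →
      |∫ y, f y ∂ρ ω - ∫ y, f y ∂η| ≤ B * D ω)
    (he : ∀ (f : ℕ → ℝ) (B : ℝ), (∀ y, |f y| ≤ B) →
      |∫ ω, ∫ y, f y ∂ρ ω ∂μ - ∫ y, f y ∂η| ≤ B * e) (x : ℕ) {F : (Fin x → ℕ) → ℝ} {B : ℝ}
    (hF : ∀ z, |F z| ≤ B) :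
    |∫ ω, iterInt (ρ ω) x F ∂μ - iterInt η x F| ≤ B * (x * e + x ^ 2 * ∫ ω, D ω ^ 2 ∂μ) := by
  have hE0 : 0 ≤ ∫ ω, D ω ^ 2 ∂μ := integral_nonneg fun ω => sq_nonneg _
  induction x with
  | zero =>
    have hB : 0 ≤ B := (abs_nonneg _).trans (hF default)
    simp [iterInt]
  | succ x ih =>
    have hB : 0 ≤ B := (abs_nonneg _).trans (hF 0)
    set g : Ω → ℕ → ℝ := fun ω y => iterInt (ρ ω) x fun z => F (Fin.cons y z) with hg
    set h : ℕ → ℝ := fun y => iterInt η x fun z => F (Fin.cons y z) with hh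
    have hgB : ∀ ω y, |g ω y| ≤ B := fun ω y => abs_iterInt_le (ρ ω) x fun z => hF _
    have hhB : ∀ y, |h y| ≤ B := fun y => abs_iterInt_le η x fun z => hF _
    have hghB : ∀ ω y, |g ω y - h y| ≤ 2 * B := fun ω y => by
      have h1 := abs_sub (g ω y) (h y)
      have h2 := hgB ω y
      have h3 := hhB y
      linarith
    have hghD : ∀ ω y, |g ω y - h y| ≤ x * (B * D ω) := fun ω y =>
      abs_iterInt_sub_le (hD ω) x fun z => hF _
    -- Peeling off the first coordinate: T1 averages the error of the others against η and is
    -- bounded by induction after exchanging the integrals. T2 pairs two fluctuations and is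
    -- quadratic in D. T3 involves only the first coordinate and is controlled by the bias.
    set T1 : Ω → ℝ := fun ω => ∫ y, (g ω y - h y) ∂η with hT1
    set T2 : Ω → ℝ := fun ω => ∫ y, (g ω y - h y) ∂ρ ω - ∫ y, (g ω y - h y) ∂η with hT2
    set T3 : Ω → ℝ := fun ω => ∫ y, h y ∂ρ ω with hT3
    have hT1B : ∀ ω, |T1 ω| ≤ 2 * B := fun ω => abs_integral_le_of_abs_le (hghB ω)
    have hT2B : ∀ ω, |T2 ω| ≤ x * B * D ω ^ 2 := fun ω => by
      have := hD ω _ _ (hghD ω)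
      refine this.trans_eq (by ring)
    have hD2 : ∀ ω, |D ω ^ 2| ≤ M ^ 2 := fun ω => by
      rw [abs_of_nonneg (sq_nonneg _)]
      exact pow_le_pow_left₀ (hD0 ω) (hDM ω) 2
    have hT2M : ∀ ω, |T2 ω| ≤ x * B * M ^ 2 := fun ω => (hT2B ω).trans
      (mul_le_mul_of_nonneg_left ((le_abs_self _).trans (hD2 ω)) (by positivity))
    have hT3B : ∀ ω, |T3 ω| ≤ B := fun ω => abs_integral_le_of_abs_le hhB
    have hsplit : ∀ ω, iterInt (ρ ω) (x + 1) F = T1 ω + T2 ω + T3 ω := by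
      intro ω
      have h1 : ∫ y, (g ω y - h y) ∂ρ ω = ∫ y, g ω y ∂ρ ω - ∫ y, h y ∂ρ ω :=
        integral_sub (integrable_of_bound (hgB ω)) (integrable_of_bound hhB)
      show ∫ y, g ω y ∂ρ ω = _
      simp only [hT1, hT2, hT3]
      rw [h1]
      ring
    have hint : ∫ ω, iterInt (ρ ω) (x + 1) F ∂μ = ∫ ω, T1 ω ∂μ + ∫ ω, T2 ω ∂μ + ∫ ω, T3 ω ∂μ := by
      rw [← integral_add (integrable_of_bound hT1B) (integrable_of_bound hT2M),
        ← integral_add (f := fun ω => T1 ω + T2 ω) ((integrable_of_bound hT1B).add (integrable_of_bound hT2M))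
          (integrable_of_bound hT3B)]
      exact integral_congr_ae (.of_forall hsplit)
    have h1 : |∫ ω, T1 ω ∂μ| ≤ B * (x * e + x ^ 2 * ∫ ω, D ω ^ 2 ∂μ) := by
      have hswap : ∫ ω, T1 ω ∂μ = ∫ y, ∫ ω, (g ω y - h y) ∂μ ∂η :=
        integral_integral_swap (f := fun ω y => g ω y - h y)
          (integrable_of_bound fun p : Ω × ℕ => hghB p.1 p.2)
      rw [hswap]
      refine abs_integral_le_of_abs_le fun y => ?_
      rw [integral_sub (integrable_of_bound fun ω => hgB ω y) (integrable_const _),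
        integral_const, probReal_univ, one_smul]
      exact ih fun z => hF _
    have h2 : |∫ ω, T2 ω ∂μ| ≤ x * B * ∫ ω, D ω ^ 2 ∂μ := by
      rw [← integral_const_mul]
      refine (abs_integral_le_integral_abs).trans (integral_mono ?_ ?_ hT2B)
      · exact (integrable_of_bound hT2M).abs
      · exact (integrable_of_bound hD2).const_mul _
    have h3 : |∫ ω, T3 ω ∂μ - ∫ y, h y ∂η| ≤ B * e := he h B hhB
    have h4 : iterInt η (x + 1) F = ∫ y, h y ∂η := rfl
    rw [hint, h4, show ∫ ω, T1 ω ∂μ + ∫ ω, T2 ω ∂μ + ∫ ω, T3 ω ∂μ - ∫ y, h y ∂η =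
      ∫ ω, T1 ω ∂μ + ∫ ω, T2 ω ∂μ + (∫ ω, T3 ω ∂μ - ∫ y, h y ∂η) by ring]
    refine (abs_add_three _ _ _).trans ((add_le_add (add_le_add h1 h2) h3).trans ?_)
    have : 0 ≤ B * (x + 1) * ∫ ω, D ω ^ 2 ∂μ := by positivity
    push_cast
    nlinarith

/-- Summation by parts: the truncated sum is the integral of f(min y N), which differs from f only
beyond N. -/
theorem integral_tail_decomp (ρ : Measure ℕ) [IsProbabilityMeasure ρ] {f : ℕ → ℝ} {B : ℝ}
    (hf : ∀ y, |f y| ≤ B) (N : ℕ) :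
    |∫ y, f y ∂ρ - (f 0 + ∑ a ∈ Finset.range N, (f (a + 1) - f a) * ρ.real (Set.Ici (a + 1)))| ≤
      2 * B * ρ.real (Set.Ici (N + 1)) := by
  classical
  have hind : ∀ a, ∫ y, (Set.Ici a).indicator (1 : ℕ → ℝ) y ∂ρ = ρ.real (Set.Ici a) := fun a =>
    integral_indicator_one MeasurableSet.of_discrete
  have hi : ∀ a, Integrable ((Set.Ici a).indicator (1 : ℕ → ℝ)) ρ := fun a =>
    integrable_of_bound (B := 1) fun y => by
      by_cases h : y ∈ Set.Ici a <;> simp [h]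
  have hpt : ∀ (N y : ℕ), f 0 + ∑ a ∈ Finset.range N,
      (f (a + 1) - f a) * (Set.Ici (a + 1)).indicator (1 : ℕ → ℝ) y = f (min y N) := by
    intro N y
    induction N with
    | zero => simp
    | succ N ih =>
      rw [Finset.sum_range_succ, ← add_assoc, ih]
      by_cases h : N + 1 ≤ y
      · rw [Set.indicator_of_mem (Set.mem_Ici.2 h), min_eq_right h, min_eq_right (by omega)]
        simp
      · rw [Set.indicator_of_notMem (by simpa using h), min_eq_left (by omega),
          min_eq_left (by omega)]
        simp
  have hmain : f 0 + ∑ a ∈ Finset.range N, (f (a + 1) - f a) * ρ.real (Set.Ici (a + 1)) =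
      ∫ y, f (min y N) ∂ρ := by
    rw [← integral_congr_ae (.of_forall (hpt N)), integral_add (integrable_const _)
      (integrable_finsetSum _ fun a _ => (hi _).const_mul _), integral_const, probReal_univ,
      one_smul, integral_finsetSum _ fun a _ => (hi _).const_mul _]
    congr 1
    refine Finset.sum_congr rfl fun a _ => ?_
    rw [integral_const_mul, hind]
  rw [hmain, ← integral_sub (integrable_of_bound hf) (integrable_of_bound fun y => hf _), ← hind,
    ← integral_const_mul]
  have hB : 0 ≤ B := (abs_nonneg _).trans (hf 0)
  have hle : ∀ y, |f y - f (min y N)| ≤ 2 * B * (Set.Ici (N + 1)).indicator (1 : ℕ → ℝ) y := by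
    intro y
    by_cases h : N + 1 ≤ y
    · rw [Set.indicator_of_mem (Set.mem_Ici.2 h), Pi.one_apply]
      have h1 := abs_sub (f y) (f (min y N))
      have h2 := hf y
      have h3 := hf (min y N)
      linarith
    · rw [Set.indicator_of_notMem (by simpa using h), min_eq_left (by omega)]
      simp
  refine abs_integral_le_integral_abs.trans (integral_mono ?_ ((hi _).const_mul _) hle)
  refine (integrable_of_bound (B := 2 * B) fun y => ?_).abs
  have h1 := abs_sub (f y) (f (min y N))
  have h2 := hf y
  have h3 := hf (min y N)
  linarith

/-- Two laws are close once their tails are. The tail of ρ beyond N is exchanged for that of η,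
which adds the last summand and makes the factor 4. -/
theorem abs_integral_sub_le_tails (ρ η : Measure ℕ) [IsProbabilityMeasure ρ]
    [IsProbabilityMeasure η] {f : ℕ → ℝ} {B : ℝ} (hf : ∀ y, |f y| ≤ B) (N : ℕ) :
    |∫ y, f y ∂ρ - ∫ y, f y ∂η| ≤ B * (2 * ∑ a ∈ Finset.range (N + 1),
      |ρ.real (Set.Ici (a + 1)) - η.real (Set.Ici (a + 1))| + 4 * η.real (Set.Ici (N + 1))) := by
  have hB : 0 ≤ B := (abs_nonneg _).trans (hf 0)
  have h1 := integral_tail_decomp ρ hf N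
  have h2 := integral_tail_decomp η hf N
  have h3 : |(f 0 + ∑ a ∈ Finset.range N, (f (a + 1) - f a) * ρ.real (Set.Ici (a + 1))) -
      (f 0 + ∑ a ∈ Finset.range N, (f (a + 1) - f a) * η.real (Set.Ici (a + 1)))| ≤
      ∑ a ∈ Finset.range N,
        2 * B * |ρ.real (Set.Ici (a + 1)) - η.real (Set.Ici (a + 1))| := by
    rw [add_sub_add_left_eq_sub, ← Finset.sum_sub_distrib]
    refine (Finset.abs_sum_le_sum_abs _ _).trans (Finset.sum_le_sum fun a _ => ?_)
    rw [← mul_sub, abs_mul]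
    refine mul_le_mul_of_nonneg_right ?_ (abs_nonneg _)
    have h4 := abs_sub (f (a + 1)) (f a)
    have h5 := hf (a + 1)
    have h6 := hf a
    linarith
  rw [← Finset.mul_sum] at h3
  have h4 : ρ.real (Set.Ici (N + 1)) ≤ |ρ.real (Set.Ici (N + 1)) - η.real (Set.Ici (N + 1))| +
      η.real (Set.Ici (N + 1)) := by
    have := le_abs_self (ρ.real (Set.Ici (N + 1)) - η.real (Set.Ici (N + 1)))
    linarith
  have h5 := mul_le_mul_of_nonneg_left h4 (by linarith : 0 ≤ 2 * B)
  rw [Finset.sum_range_succ]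
  rw [abs_le] at h1 h2 h3 ⊢
  constructor <;> nlinarith [h1.1, h1.2, h2.1, h2.2, h3.1, h3.2]

/-! ### Sampling from the empirical measure -/

/-- The empirical measure of the queue lengths. -/
def empirical (Q : Fin n → ℕ) : Measure ℕ := (n : ENNReal)⁻¹ • ∑ v, Measure.dirac (Q v)

theorem isProbabilityMeasure_empirical (hn : 0 < n) (Q : Fin n → ℕ) :
    IsProbabilityMeasure (empirical Q) := by
  constructor
  simp only [empirical, Measure.smul_apply, Measure.finsetSum_apply, measure_univ, Finset.sum_const,
    Finset.card_univ, Fintype.card_fin, nsmul_eq_mul, mul_one, smul_eq_mul]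
  exact ENNReal.inv_mul_cancel (by exact_mod_cast hn.ne') (ENNReal.natCast_ne_top n)

theorem integral_empirical (Q : Fin n → ℕ) {f : ℕ → ℝ} {B : ℝ} (hf : ∀ y, |f y| ≤ B) :
    ∫ y, f y ∂empirical Q = (n : ℝ)⁻¹ * ∑ v, f (Q v) := by
  rw [empirical, integral_smul_measure, integral_finsetSum_measure fun v _ =>
    integrable_of_bound hf]
  simp

theorem iterInt_empirical (Q : Fin n → ℕ) (x : ℕ) {F : (Fin x → ℕ) → ℝ} {B : ℝ}
    (hF : ∀ z, |F z| ≤ B) (hn : 0 < n) :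
    iterInt (empirical Q) x F = ((n : ℝ) ^ x)⁻¹ * ∑ w : Fin x → Fin n, F fun i => Q (w i) := by
  have := isProbabilityMeasure_empirical hn Q
  induction x with
  | zero =>
    simp only [iterInt, pow_zero, inv_one, one_mul, Finset.univ_unique, Finset.sum_singleton]
    congr 1
    exact Subsingleton.elim _ _
  | succ x ih =>
    have h1 := integral_empirical Q (f := fun y => iterInt (empirical Q) x fun z => F (Fin.cons y z))
      fun y => abs_iterInt_le _ x fun z => hF _
    show ∫ y, iterInt (empirical Q) x (fun z => F (Fin.cons y z)) ∂empirical Q = _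
    rw [h1, ← (Fin.consEquiv fun _ => Fin n).sum_comp, Fintype.sum_prod_type, pow_succ', mul_inv,
      mul_assoc]
    congr 1
    rw [Finset.mul_sum]
    refine Finset.sum_congr rfl fun v _ => ?_
    rw [ih fun z => hF _]
    congr 1
    refine Finset.sum_congr rfl fun w _ => ?_
    congr 1
    funext i
    refine Fin.cases ?_ (fun i => ?_) i <;> rfl

theorem empirical_real_Ici (Q : Fin n → ℕ) (a : ℕ) :
    (empirical Q).real (Set.Ici a) =
      (n : ℝ)⁻¹ * ∑ v, (Set.Ici a).indicator (1 : ℕ → ℝ) (Q v) := by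
  rw [← integral_indicator_one MeasurableSet.of_discrete]
  refine integral_empirical Q (B := 1) fun y => ?_
  by_cases h : y ∈ Set.Ici a <;> simp [h]

/-- Falling factorials are at least (n - x)^x, and Bernoulli's inequality bounds the deficit. -/
theorem card_not_injective_le {x : ℕ} (hx : x ≤ n) (hn : 0 < n) :
    ((Finset.univ.filter fun w : Fin x → Fin n => ¬ Function.Injective w).card : ℝ) ≤
      (n : ℝ) ^ x * ((x : ℝ) ^ 2 / n) := by
  classical
  have hn' : (0 : ℝ) < n := by exact_mod_cast hn
  have h1 : (Finset.univ.filter fun w : Fin x → Fin n => Function.Injective w).card =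
      n.descFactorial x := by
    rw [← Fintype.card_subtype, Fintype.card_congr
      (Equiv.subtypeInjectiveEquivEmbedding (Fin x) (Fin n)), Fintype.card_embedding_eq]
    simp
  have h2 := Finset.card_filter_add_card_filter_not (s := (Finset.univ : Finset (Fin x → Fin n)))
    (fun w => Function.Injective w)
  rw [h1, Finset.card_univ, Fintype.card_fun, Fintype.card_fin, Fintype.card_fin] at h2
  have h3 : (n.descFactorial x : ℝ) +
      ((Finset.univ.filter fun w : Fin x → Fin n => ¬ Function.Injective w).card : ℝ) =
      (n : ℝ) ^ x := by exact_mod_cast h2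
  have h4 : ((n : ℝ) - x) ^ x ≤ n.descFactorial x := by
    have h5 : (n - x) ^ x ≤ n.descFactorial x :=
      (Nat.pow_le_pow_left (by omega) x).trans (Nat.pow_sub_le_descFactorial n x)
    rw [← Nat.cast_sub hx]
    exact_mod_cast h5
  have hxn : (x : ℝ) ≤ n := by exact_mod_cast hx
  have hb : (-2 : ℝ) ≤ -((x : ℝ) / n) := by
    have := div_le_one_of_le₀ hxn hn'.le
    linarith
  have h5 := one_add_mul_le_pow hb x
  have h6 : ((n : ℝ) - x) ^ x = (n : ℝ) ^ x * (1 + -((x : ℝ) / n)) ^ x := by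
    rw [← mul_pow]
    congr 1
    field_simp
    ring
  have h7 := mul_le_mul_of_nonneg_left h5 (by positivity : (0 : ℝ) ≤ (n : ℝ) ^ x)
  have h8 : (n : ℝ) ^ x * (1 + x * -((x : ℝ) / n)) =
      (n : ℝ) ^ x - (n : ℝ) ^ x * ((x : ℝ) ^ 2 / n) := by ring
  linarith

/-! ### From asymptotic pairwise independence to chaoticity. -/

section

variable {C : ℝ} {p : ℕ → ℝ} {π : Measure (State d k n)}
  (hπ : IsAsympIndep C p π)

include hπ

theorem IsAsympIndep.integral_comp_eq {x : ℕ} {v w : Fin x → Fin n} (hv : Function.Injective v)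
    (hw : Function.Injective w) {F : (Fin x → ℕ) → ℝ} {B : ℝ} (hF : ∀ z, |F z| ≤ B) :
    ∫ s, F (fun i => s.queue (w i)) ∂π = ∫ s, F (fun i => s.queue (v i)) ∂π := by
  obtain ⟨σ, hσ⟩ := exists_perm_apply_eq hv hw
  rw [← hπ.exch σ (fun Q => F fun i => Q (v i)) ⟨B, fun Q => hF _⟩]
  simp only [Function.comp_apply, hσ]

variable [IsProbabilityMeasure π]

/-- Sampling with replacement averages over all maps of indices. Injective maps all give the same
expectation by exchangeability, and the others have proportion at most x²/n. -/
theorem IsAsympIndep.abs_integral_sub_iterInt_le (hn : 0 < n) {x : ℕ} (v : Fin x ↪ Fin n)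
    {F : (Fin x → ℕ) → ℝ} (hF0 : ∀ z, 0 ≤ F z) (hF1 : ∀ z, F z ≤ 1) :
    |∫ s, F (fun i => s.queue (v i)) ∂π - ∫ s, iterInt (empirical s.queue) x F ∂π| ≤
      (x : ℝ) ^ 2 / n := by
  classical
  have hF : ∀ z, |F z| ≤ 1 := fun z => by rw [abs_of_nonneg (hF0 z)]; exact hF1 z
  have hn' : (0 : ℝ) < n := by exact_mod_cast hn
  have hx : x ≤ n := by simpa using Fintype.card_le_of_embedding v
  set θ := ∫ s, F (fun i => s.queue (v i)) ∂π with hθ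
  have hint : ∀ w : Fin x → Fin n, Integrable (fun s : State d k n => F fun i => s.queue (w i)) π :=
    fun w => integrable_of_bound fun s => hF _
  have h1 : ∫ s, iterInt (empirical s.queue) x F ∂π =
      ((n : ℝ) ^ x)⁻¹ * ∑ w : Fin x → Fin n, ∫ s, F (fun i => s.queue (w i)) ∂π := by
    rw [← integral_finsetSum _ fun w _ => hint w, ← integral_const_mul]
    exact integral_congr_ae (.of_forall fun s => iterInt_empirical s.queue x hF hn)
  have h01 : ∀ w : Fin x → Fin n, 0 ≤ ∫ s, F (fun i => s.queue (w i)) ∂π ∧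
      ∫ s, F (fun i => s.queue (w i)) ∂π ≤ 1 := fun w =>
    ⟨integral_nonneg fun s => hF0 _, (le_abs_self _).trans
      (abs_integral_le_of_abs_le fun s => hF _)⟩
  have h2 : θ - ∫ s, iterInt (empirical s.queue) x F ∂π = ((n : ℝ) ^ x)⁻¹ *
      ∑ w ∈ Finset.univ.filter (fun w : Fin x → Fin n => ¬ Function.Injective w),
        (θ - ∫ s, F (fun i => s.queue (w i)) ∂π) := by
    have h3 : ∑ w : Fin x → Fin n, (θ - ∫ s, F (fun i => s.queue (w i)) ∂π) =
        ∑ w ∈ Finset.univ.filter (fun w : Fin x → Fin n => ¬ Function.Injective w),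
          (θ - ∫ s, F (fun i => s.queue (w i)) ∂π) := by
      refine (Finset.sum_subset (Finset.filter_subset _ _) fun w _ hw => ?_).symm
      have hw : Function.Injective w := by simpa using hw
      rw [hπ.integral_comp_eq v.injective hw hF, sub_self]
    rw [h1, ← h3, Finset.sum_sub_distrib, Finset.sum_const, Finset.card_univ, Fintype.card_fun,
      Fintype.card_fin, Fintype.card_fin, nsmul_eq_mul, mul_sub]
    push_cast
    rw [inv_mul_cancel_left₀ (by positivity)]
  rw [h2, abs_mul, abs_of_nonneg (by positivity)]
  have h4 : |∑ w ∈ Finset.univ.filter (fun w : Fin x → Fin n => ¬ Function.Injective w),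
        (θ - ∫ s, F (fun i => s.queue (w i)) ∂π)| ≤ (n : ℝ) ^ x * ((x : ℝ) ^ 2 / n) := by
    refine (Finset.abs_sum_le_sum_abs _ _).trans (le_trans ?_ (card_not_injective_le hx hn))
    rw [Finset.card_eq_sum_ones, Nat.cast_sum]
    refine Finset.sum_le_sum fun w _ => ?_
    have h5 := h01 v
    have h6 := h01 w
    rw [Nat.cast_one, abs_le]
    constructor <;> linarith [h5.1, h5.2, h6.1, h6.2]
  calc _ ≤ ((n : ℝ) ^ x)⁻¹ * ((n : ℝ) ^ x * ((x : ℝ) ^ 2 / n)) := by gcongr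
    _ = _ := inv_mul_cancel_left₀ (by positivity) _

/-- Expand the variance into pairs: the diagonal contributes at most p(a)/n and each off-diagonal
covariance is O(1/n). The decay in a makes the bounds summable over thresholds. -/
theorem IsAsympIndep.integral_empirical_sub_sq_le (hn : 0 < n) (hC : 0 ≤ C) (a : ℕ) :
    ∫ s, ((empirical s.queue).real (Set.Ici a) - p a) ^ 2 ∂π ≤ (1 + C) / n * (1 / 4) ^ a := by
  classical
  have hn' : (0 : ℝ) < n := by exact_mod_cast hn
  set I : State d k n → Fin n → ℝ := fun s v => (Set.Ici a).indicator (1 : ℕ → ℝ) (s.queue v)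
    with hI
  have hI1 : ∀ s v, |I s v| ≤ 1 := fun s v => by
    by_cases h : s.queue v ∈ Set.Ici a <;> simp [hI, h]
  have hIint : ∀ v, ∫ s, I s v ∂π = p a := fun v => by
    rw [← hπ.tail v a, ← integral_indicator_one MeasurableSet.of_discrete]
    rfl
  have hII : ∀ v w, |∫ s, I s v * I s w ∂π - p a ^ 2| ≤ (if v = w then p a else 0) +
      C / n * (1 / 4) ^ a := by
    intro v w
    have hpos : 0 ≤ C / n * (1 / 4 : ℝ) ^ a := by positivity
    have hp0 : 0 ≤ p a := by rw [← hπ.tail v a]; exact measureReal_nonneg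
    have hp1 : p a ≤ 1 := by rw [← hπ.tail v a]; exact measureReal_le_one
    by_cases hvw : v = w
    · subst hvw
      have h1 : ∀ s, I s v * I s v = I s v := fun s => by
        by_cases h : s.queue v ∈ Set.Ici a <;> simp [hI, h]
      simp only [h1, hIint, if_true]
      rw [abs_of_nonneg (by nlinarith)]
      nlinarith
    · rw [if_neg hvw, zero_add]
      refine le_of_eq_of_le ?_ (hπ.pair v w a hvw)
      congr 2
      rw [← integral_indicator_one MeasurableSet.of_discrete]
      refine integral_congr_ae (.of_forall fun s => ?_)
      by_cases h : a ≤ s.queue v <;> by_cases h' : a ≤ s.queue w <;> simp [hI, h, h']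
  have hprod : ∀ v w, Integrable (fun s => I s v * I s w) π := fun v w =>
    integrable_of_bound (B := 1) fun s => by
      rw [abs_mul]
      exact mul_le_one₀ (hI1 s v) (abs_nonneg _) (hI1 s w)
  have hexp : ∀ s : State d k n, ((empirical s.queue).real (Set.Ici a) - p a) ^ 2 =
      ((n : ℝ)⁻¹) ^ 2 * ∑ v, ∑ w, ((I s v * I s w) - p a * I s v - p a * I s w + p a ^ 2) := by
    intro s
    have h1 : (empirical s.queue).real (Set.Ici a) - p a =
        (n : ℝ)⁻¹ * ∑ v, (I s v - p a) := by
      rw [empirical_real_Ici, Finset.sum_sub_distrib, Finset.sum_const, Finset.card_univ,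
        Fintype.card_fin, nsmul_eq_mul, mul_sub, inv_mul_cancel_left₀ hn'.ne']
    rw [h1, mul_pow, sq (∑ v, (I s v - p a)), Finset.sum_mul_sum]
    congr 1
    refine Finset.sum_congr rfl fun v _ => Finset.sum_congr rfl fun w _ => ?_
    ring
  have hIi : ∀ v, Integrable (fun s => I s v) π := fun v => integrable_of_bound fun s => hI1 s v
  have hterm : ∀ v w, Integrable
      (fun s => I s v * I s w - p a * I s v - p a * I s w + p a ^ 2) π := fun v w =>
    (((hprod v w).sub ((hIi v).const_mul _)).sub ((hIi w).const_mul _)).add (integrable_const _)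
  have hcalc : ∫ s, ((empirical s.queue).real (Set.Ici a) - p a) ^ 2 ∂π =
      ((n : ℝ)⁻¹) ^ 2 * ∑ v, ∑ w, (∫ s, I s v * I s w ∂π - p a ^ 2) := by
    rw [integral_congr_ae (.of_forall hexp), integral_const_mul,
      integral_finsetSum _ fun v _ => integrable_finsetSum _ fun w _ => hterm v w]
    congr 1
    refine Finset.sum_congr rfl fun v _ => ?_
    rw [integral_finsetSum _ fun w _ => hterm v w]
    refine Finset.sum_congr rfl fun w _ => ?_
    have hv := (hIi v).const_mul (p a)
    have hw := (hIi w).const_mul (p a)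
    rw [integral_add (f := fun s => I s v * I s w - p a * I s v - p a * I s w)
        (((hprod v w).sub hv).sub hw) (integrable_const _),
      integral_sub (f := fun s => I s v * I s w - p a * I s v) ((hprod v w).sub hv) hw,
      integral_sub (hprod v w) hv, integral_const_mul, integral_const_mul,
      hIint, hIint, integral_const, probReal_univ, one_smul]
    ring
  have hpa : p a ≤ (1 / 4) ^ a := (hπ.tail_le a).trans
    (pow_le_pow_left₀ (by norm_num) (by norm_num) a)
  rw [hcalc]
  calc _ ≤ ((n : ℝ)⁻¹) ^ 2 * ∑ v : Fin n, ∑ w : Fin n,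
        ((if v = w then p a else 0) + C / n * (1 / 4) ^ a) := by
        refine mul_le_mul_of_nonneg_left (Finset.sum_le_sum fun v _ => Finset.sum_le_sum fun w _ =>
          (le_abs_self _).trans (hII v w)) (by positivity)
    _ = (p a + C * (1 / 4) ^ a) / n := by
        simp only [Finset.sum_add_distrib, Finset.sum_ite_eq, Finset.mem_univ, if_true,
          Finset.sum_const, Finset.card_univ, Fintype.card_fin, nsmul_eq_mul]
        field_simp
    _ ≤ ((1 / 4) ^ a + C * (1 / 4) ^ a) / n := by gcongr
    _ = _ := by ring

/-- The distance D between the empirical measure and η is measured by tails. Its mean square is at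
most (48 + 32·C)/n and the bias at most (2·C + 4)/n; their sum is the constant. -/
theorem IsAsympIndep.integral_iterInt_sub_le (hn : 0 < n) (hC : 0 ≤ C) {η : Measure ℕ}
    [IsProbabilityMeasure η]
    (hη : ∀ a, |p a - η.real (Set.Ici a)| ≤ C / n * (1 / 4) ^ a)
    (hη0 : Filter.Tendsto (fun a => η.real (Set.Ici a)) Filter.atTop (nhds 0)) (x : ℕ)
    {F : (Fin x → ℕ) → ℝ} (hF : ∀ z, |F z| ≤ 1) :
    |∫ s, iterInt (empirical s.queue) x F ∂π - iterInt η x F| ≤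
      (52 + 34 * C) * ((x : ℝ) ^ 2 / n) := by
  have hn' : (0 : ℝ) < n := by exact_mod_cast hn
  have hemp : ∀ s : State d k n, IsProbabilityMeasure (empirical s.queue) := fun s =>
    isProbabilityMeasure_empirical hn _
  -- The truncation level may depend on n, because no later estimate depends on N except for
  -- integrability.
  obtain ⟨N, hN⟩ : ∃ N, η.real (Set.Ici (N + 1)) ≤ 1 / n := by
    have := ((Filter.tendsto_add_atTop_iff_nat 1).2 hη0).eventually
      (ge_mem_nhds (by positivity : (0 : ℝ) < 1 / n))
    exact this.exists
  set u := η.real (Set.Ici (N + 1)) with hu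
  have hu0 : 0 ≤ u := measureReal_nonneg
  have hu1 : u ≤ 1 := measureReal_le_one
  set Y : State d k n → ℕ → ℝ := fun s a =>
    |(empirical s.queue).real (Set.Ici (a + 1)) - η.real (Set.Ici (a + 1))| with hY
  have hY0 : ∀ s a, 0 ≤ Y s a := fun s a => abs_nonneg _
  have hY1 : ∀ s a, Y s a ≤ 1 := fun s a => by
    have h1 : 0 ≤ (empirical s.queue).real (Set.Ici (a + 1)) := measureReal_nonneg
    have h2 : (empirical s.queue).real (Set.Ici (a + 1)) ≤ 1 := measureReal_le_one
    have h3 : 0 ≤ η.real (Set.Ici (a + 1)) := measureReal_nonneg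
    have h4 : η.real (Set.Ici (a + 1)) ≤ 1 := measureReal_le_one
    simp only [hY]
    rw [abs_le]
    constructor <;> linarith
  have hgeom : ∑ a ∈ Finset.range (N + 1), (1 / 4 : ℝ) ^ (a + 1) ≤ 1 := by
    have : ∀ M : ℕ, ∑ a ∈ Finset.range M, (1 / 4 : ℝ) ^ (a + 1) ≤ 1 - (1 / 4) ^ M := by
      intro M
      induction M with
      | zero => simp
      | succ M ih =>
        rw [Finset.sum_range_succ, pow_succ]
        have : (0 : ℝ) < (1 / 4) ^ M := by positivity
        linarith
    have h1 := this (N + 1)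
    have h2 : (0 : ℝ) < (1 / 4) ^ (N + 1) := by positivity
    linarith
  have hgeom2 : ∀ M : ℕ, ∑ a ∈ Finset.range M, (1 / 2 : ℝ) ^ a ≤ 2 := by
    have : ∀ M : ℕ, ∑ a ∈ Finset.range M, (1 / 2 : ℝ) ^ a = 2 - 2 * (1 / 2) ^ M := by
      intro M
      induction M with
      | zero => simp
      | succ M ih => rw [Finset.sum_range_succ, ih, pow_succ]; ring
    intro M
    rw [this]
    have : (0 : ℝ) < (1 / 2) ^ M := by positivity
    linarith
  set D : State d k n → ℝ := fun s => 2 * ∑ a ∈ Finset.range (N + 1), Y s a + 4 * u with hDdef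
  have hD0 : ∀ s, 0 ≤ D s := fun s => by
    have := Finset.sum_nonneg fun a (_ : a ∈ Finset.range (N + 1)) => hY0 s a
    simp only [hDdef]
    linarith
  have hDM : ∀ s, D s ≤ 2 * (N + 1 : ℕ) + 4 := fun s => by
    have h1 : ∑ a ∈ Finset.range (N + 1), Y s a ≤ (N + 1 : ℕ) := by
      refine (Finset.sum_le_sum fun a _ => hY1 s a).trans_eq ?_
      simp
    simp only [hDdef]
    linarith
  have hD : ∀ (s : State d k n) (f : ℕ → ℝ) (B : ℝ), (∀ y, |f y| ≤ B) →
      |∫ y, f y ∂empirical s.queue - ∫ y, f y ∂η| ≤ B * D s := fun s f B hf =>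
    abs_integral_sub_le_tails _ _ hf N
  have he : ∀ (f : ℕ → ℝ) (B : ℝ), (∀ y, |f y| ≤ B) →
      |∫ s, ∫ y, f y ∂empirical s.queue ∂π - ∫ y, f y ∂η| ≤ B * ((2 * C + 4) / n) := by
    intro f B hf
    have hB : 0 ≤ B := (abs_nonneg _).trans (hf 0)
    set v : Fin n := ⟨0, hn⟩
    have hm : Measurable fun s : State d k n => s.queue v := Measurable.of_discrete
    have hmap : IsProbabilityMeasure (π.map fun s => s.queue v) :=
      Measure.isProbabilityMeasure_map hm.aemeasurable
    have h1 : ∫ s, ∫ y, f y ∂empirical s.queue ∂π = ∫ y, f y ∂π.map fun s => s.queue v := by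
      rw [integral_map hm.aemeasurable (Measurable.of_discrete).aestronglyMeasurable,
        integral_congr_ae (.of_forall fun s : State d k n => integral_empirical s.queue hf),
        integral_const_mul, integral_finsetSum _ fun w _ => integrable_of_bound fun s => hf _]
      have h2 : ∀ w, ∫ s, f (s.queue w) ∂π = ∫ s, f (s.queue v) ∂π := fun w =>
        hπ.integral_comp_eq (x := 1) (v := fun _ => v) (w := fun _ => w)
          (Function.injective_of_subsingleton _) (Function.injective_of_subsingleton _)
          (F := fun z => f (z 0)) fun z => hf _
      rw [Finset.sum_congr rfl fun w _ => h2 w, Finset.sum_const, Finset.card_univ,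
        Fintype.card_fin, nsmul_eq_mul, inv_mul_cancel_left₀ hn'.ne']
    have h3 : ∀ a, (π.map fun s => s.queue v).real (Set.Ici a) = p a := fun a => by
      rw [map_measureReal_apply hm MeasurableSet.of_discrete, ← hπ.tail v a]
      rfl
    rw [h1]
    refine (abs_integral_sub_le_tails _ η hf N).trans (mul_le_mul_of_nonneg_left ?_ hB)
    simp only [h3]
    have h4 : ∑ a ∈ Finset.range (N + 1), |p (a + 1) - η.real (Set.Ici (a + 1))| ≤ C / n := by
      refine (Finset.sum_le_sum fun a _ => hη (a + 1)).trans ?_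
      rw [← Finset.mul_sum]
      exact mul_le_of_le_one_right (by positivity) hgeom
    have h5 : (2 * C + 4) / n = 2 * (C / n) + 4 * (1 / n : ℝ) := by ring
    rw [h5, ← hu]
    linarith
  have hYsq : ∀ a, ∫ s, Y s a ^ 2 ∂π ≤ (2 + 4 * C) / n * (1 / 4) ^ (a + 1) := by
    intro a
    have h1 := hπ.integral_empirical_sub_sq_le hn hC (a + 1)
    -- The difference is at most 1, so its square is at most itself; a linear bound in 1/n is all
    -- that is needed.
    have h2 : (p (a + 1) - η.real (Set.Ici (a + 1))) ^ 2 ≤ C / n * (1 / 4) ^ (a + 1) := by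
      have h3 := hη (a + 1)
      have hp0 : 0 ≤ p (a + 1) := by rw [← hπ.tail ⟨0, hn⟩]; exact measureReal_nonneg
      have hp1 : p (a + 1) ≤ 1 := by rw [← hπ.tail ⟨0, hn⟩]; exact measureReal_le_one
      have h5 : 0 ≤ η.real (Set.Ici (a + 1)) := measureReal_nonneg
      have h6 : η.real (Set.Ici (a + 1)) ≤ 1 := measureReal_le_one
      have h4 : |p (a + 1) - η.real (Set.Ici (a + 1))| ≤ 1 := by
        rw [abs_le]; constructor <;> linarith
      rw [← sq_abs]
      have h7 := abs_nonneg (p (a + 1) - η.real (Set.Ici (a + 1)))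
      nlinarith
    have hb : ∀ s : State d k n,
        |((empirical s.queue).real (Set.Ici (a + 1)) - p (a + 1)) ^ 2| ≤ 1 := fun s => by
      have hp0 : 0 ≤ p (a + 1) := by rw [← hπ.tail ⟨0, hn⟩]; exact measureReal_nonneg
      have hp1 : p (a + 1) ≤ 1 := by rw [← hπ.tail ⟨0, hn⟩]; exact measureReal_le_one
      have h5 : 0 ≤ (empirical s.queue).real (Set.Ici (a + 1)) := measureReal_nonneg
      have h6 : (empirical s.queue).real (Set.Ici (a + 1)) ≤ 1 := measureReal_le_one
      rw [abs_of_nonneg (sq_nonneg _), sq_le_one_iff_abs_le_one, abs_le]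
      constructor <;> linarith
    have h8 : ∫ s, Y s a ^ 2 ∂π ≤
        ∫ s, (2 * ((empirical s.queue).real (Set.Ici (a + 1)) - p (a + 1)) ^ 2 +
          2 * (p (a + 1) - η.real (Set.Ici (a + 1))) ^ 2) ∂π := by
      refine integral_mono (integrable_of_bound (B := 1) fun s => ?_)
        (((integrable_of_bound hb).const_mul 2).add (integrable_const _)) fun s => ?_
      · rw [abs_of_nonneg (sq_nonneg _)]
        exact pow_le_one₀ (hY0 s a) (hY1 s a)
      · simp only [hY, sq_abs]
        nlinarith [sq_nonneg (((empirical s.queue).real (Set.Ici (a + 1)) - p (a + 1)) -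
          (p (a + 1) - η.real (Set.Ici (a + 1))))]
    rw [integral_add ((integrable_of_bound hb).const_mul 2) (integrable_const _),
      integral_const_mul, integral_const, probReal_univ, one_smul] at h8
    refine h8.trans ((add_le_add (mul_le_mul_of_nonneg_left h1 (by norm_num))
      (mul_le_mul_of_nonneg_left h2 (by norm_num))).trans_eq (by ring))
  have hYi : ∀ a, Integrable (fun s => Y s a ^ 2) π := fun a =>
    integrable_of_bound (B := 1) fun s => by
      rw [abs_of_nonneg (sq_nonneg _)]
      exact pow_le_one₀ (hY0 s a) (hY1 s a)
  -- Cauchy–Schwarz with weights 2^(-a): their sum is at most 2, and the inverse weights 2^a are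
  -- outweighed by the decay 4^(-a) of the variances. So the bound does not grow with N.
  have hDsq : ∀ s, D s ^ 2 ≤ 16 * ∑ a ∈ Finset.range (N + 1), 2 ^ a * Y s a ^ 2 + 32 * u := by
    intro s
    have h1 := Finset.sum_sq_le_sum_mul_sum_of_sq_le_mul (Finset.range (N + 1))
      (r := Y s) (f := fun a => (1 / 2 : ℝ) ^ a) (g := fun a => 2 ^ a * Y s a ^ 2)
      (fun a _ => by positivity) (fun a _ => by positivity) (fun a _ => by
        refine le_of_eq ?_
        rw [← mul_assoc, ← mul_pow]; norm_num)
    have h2 : 0 ≤ ∑ a ∈ Finset.range (N + 1), 2 ^ a * Y s a ^ 2 :=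
      Finset.sum_nonneg fun a _ => by positivity
    have h3 := h1.trans (mul_le_mul_of_nonneg_right (hgeom2 (N + 1)) h2)
    simp only [hDdef]
    nlinarith [sq_nonneg (∑ a ∈ Finset.range (N + 1), Y s a - 2 * u)]
  have hE : ∫ s, D s ^ 2 ∂π ≤ (48 + 32 * C) / n := by
    have hsumi : Integrable (fun s => ∑ a ∈ Finset.range (N + 1), 2 ^ a * Y s a ^ 2) π :=
      integrable_finsetSum _ fun a _ => (hYi a).const_mul _
    have h1 : ∫ s, D s ^ 2 ∂π ≤
        ∫ s, (16 * ∑ a ∈ Finset.range (N + 1), 2 ^ a * Y s a ^ 2 + 32 * u) ∂π := by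
      refine integral_mono (integrable_of_bound (B := (2 * (N + 1 : ℕ) + 4) ^ 2) fun s => ?_)
        ((hsumi.const_mul _).add (integrable_const _)) hDsq
      rw [abs_of_nonneg (sq_nonneg _)]
      exact pow_le_pow_left₀ (hD0 s) (hDM s) 2
    rw [integral_add (hsumi.const_mul _) (integrable_const _), integral_const_mul,
      integral_finsetSum _ fun a _ => (hYi a).const_mul _, integral_const, probReal_univ,
      one_smul] at h1
    have h2 : ∑ a ∈ Finset.range (N + 1), ∫ s, 2 ^ a * Y s a ^ 2 ∂π ≤ (1 + 2 * C) / n := by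
      calc _ ≤ ∑ a ∈ Finset.range (N + 1), (1 / 2 + C) / n * (1 / 2 : ℝ) ^ a := by
            refine Finset.sum_le_sum fun a _ => ?_
            rw [integral_const_mul]
            refine (mul_le_mul_of_nonneg_left (hYsq a) (by positivity)).trans_eq ?_
            have h3 : (2 : ℝ) ^ a * (1 / 4) ^ a = (1 / 2) ^ a := by rw [← mul_pow]; norm_num
            rw [pow_succ]
            linear_combination ((2 + 4 * C) / n / 4) * h3
        _ ≤ (1 / 2 + C) / n * 2 := by
            rw [← Finset.mul_sum]
            exact mul_le_mul_of_nonneg_left (hgeom2 _) (by positivity)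
        _ = _ := by ring
    have h3 : (48 + 32 * C) / n = 16 * ((1 + 2 * C) / n) + 32 * (1 / n : ℝ) := by ring
    rw [h3]
    linarith
  have hmain := abs_integral_iterInt_sub_le (μ := π) hD0 hDM
    hD he x hF
  refine hmain.trans ?_
  rw [one_mul]
  have hx : (x : ℝ) ≤ (x : ℝ) ^ 2 := by
    have : x ≤ x ^ 2 := Nat.le_self_pow (by norm_num) x
    exact_mod_cast this
  calc _ ≤ (x : ℝ) ^ 2 * ((2 * C + 4) / n) + (x : ℝ) ^ 2 * ((48 + 32 * C) / n) := by gcongr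
    _ = _ := by ring

/-- The extra 1 in the constant is the cost of passing from sampling without replacement to sampling
with replacement. -/
theorem IsAsympIndep.tvDist_le (hn : 0 < n) (hC : 0 ≤ C) {η : Measure ℕ}
    [IsProbabilityMeasure η]
    (hη : ∀ a, |p a - η.real (Set.Ici a)| ≤ C / n * (1 / 4) ^ a)
    (hη0 : Filter.Tendsto (fun a => η.real (Set.Ici a)) Filter.atTop (nhds 0)) {x : ℕ}
    (v : Fin x ↪ Fin n) :
    tvDist (π.map fun s i => s.queue (v i)) (Measure.pi fun _ : Fin x => η) ≤
      (53 + 34 * C) * ((x : ℝ) ^ 2 / n) := by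
  classical
  have : Nonempty {A : Set (Fin x → ℕ) // MeasurableSet A} := ⟨⟨∅, MeasurableSet.empty⟩⟩
  refine ciSup_le fun A => ?_
  have hm : Measurable fun (s : State d k n) (i : Fin x) => s.queue (v i) := Measurable.of_discrete
  set F : (Fin x → ℕ) → ℝ := A.1.indicator 1 with hF
  have hF0 : ∀ z, 0 ≤ F z := fun z => by by_cases h : z ∈ A.1 <;> simp [hF, h]
  have hF1 : ∀ z, F z ≤ 1 := fun z => by by_cases h : z ∈ A.1 <;> simp [hF, h]
  have hFa : ∀ z, |F z| ≤ 1 := fun z => by rw [abs_of_nonneg (hF0 z)]; exact hF1 z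
  have h1 : (π.map fun s i => s.queue (v i)).real A.1 = ∫ s, F (fun i => s.queue (v i)) ∂π := by
    rw [← integral_indicator_one A.2, integral_map hm.aemeasurable
      (Measurable.of_discrete).aestronglyMeasurable]
  have h2 : (Measure.pi fun _ : Fin x => η).real A.1 = iterInt η x F := by
    rw [← integral_indicator_one A.2, iterInt_eq_integral_pi η x hFa]
  rw [h1, h2]
  have h3 := hπ.abs_integral_sub_iterInt_le hn v hF0 hF1
  have h4 := hπ.integral_iterInt_sub_le hn hC hη hη0 x hFa
  refine (abs_sub_le _ (∫ s, iterInt (empirical s.queue) x F ∂π) _).trans ?_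
  linarith

end

/-! ### The limit law -/

/-- A probability law on `ℕ` with given tail probabilities. -/
theorem exists_measure_of_tail {u : ℕ → ℝ} (hu : Antitone u) (h0 : u 0 = 1)
    (hlim : Filter.Tendsto u Filter.atTop (nhds 0)) :
    ∃ η : Measure ℕ, IsProbabilityMeasure η ∧ (∀ a, η.real (Set.Ici a) = u a) ∧
      ∀ a, η.real {a} = u a - u (a + 1) := by
  have hw : ∀ a, 0 ≤ u a - u (a + 1) := fun a => sub_nonneg.2 (hu a.le_succ)
  have hsum : HasSum (fun a => u a - u (a + 1)) 1 := by
    rw [hasSum_iff_tendsto_nat_of_nonneg hw]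
    have : ∀ N, ∑ a ∈ Finset.range N, (u a - u (a + 1)) = 1 - u N := fun N => by
      rw [Finset.sum_range_sub', h0]
    simp only [this]
    simpa using hlim.const_sub 1
  have hsum' : ∑' a, ENNReal.ofReal (u a - u (a + 1)) = 1 := by
    rw [← ENNReal.ofReal_tsum_of_nonneg hw hsum.summable, hsum.tsum_eq, ENNReal.ofReal_one]
  set q : PMF ℕ := ⟨fun a => ENNReal.ofReal (u a - u (a + 1)), by
    rw [← hsum']; exact ENNReal.summable.hasSum⟩ with hq
  have hsing : ∀ a, q.toMeasure.real {a} = u a - u (a + 1) := fun a => by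
    rw [Measure.real, PMF.toMeasure_apply_singleton _ _ (MeasurableSet.singleton a)]
    exact ENNReal.toReal_ofReal (hw a)
  refine ⟨q.toMeasure, inferInstance, fun a => ?_, hsing⟩
  induction a with
  | zero =>
    rw [h0, show Set.Ici 0 = (Set.univ : Set ℕ) from by ext; simp, probReal_univ]
  | succ a ih =>
    have h1 : Set.Ici (a + 1) = Set.Ici a \ {a} := by
      ext y
      simp only [Set.mem_Ici, Set.mem_sdiff, Set.mem_singleton_iff]
      omega
    rw [h1, measureReal_sdiff (by simp) MeasurableSet.of_discrete, ih, hsing]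
    ring

/-- The comparison between sizes is a Cauchy estimate along the positive multiples of k, and it
survives the limit of the larger size with the same rate. -/
theorem exists_limit_tail (hk : 0 < k) {C : ℝ} (hC : 0 ≤ C) {p : ℕ → ℕ → ℝ}
    (hp : ∀ n, 0 < n → k ∣ n → ∀ m, n ≤ m → k ∣ m → ∀ a,
      |p n a - p m a| ≤ C / n * (1 / 4) ^ a) :
    ∃ u : ℕ → ℝ, (∀ a, Filter.Tendsto (fun N => p (k * (N + 1)) a) Filter.atTop (nhds (u a))) ∧
      ∀ n, 0 < n → k ∣ n → ∀ a, |p n a - u a| ≤ C / n * (1 / 4) ^ a := by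
  have hkN : ∀ N, N ≤ k * (N + 1) := fun N => by nlinarith
  have hcau : ∀ a, CauchySeq fun N => p (k * (N + 1)) a := by
    intro a
    refine cauchySeq_of_le_tendsto_0' (fun N => C / (N + 1 : ℕ)) (fun N M hNM => ?_) ?_
    · rw [Real.dist_eq]
      refine (hp _ (by positivity) (dvd_mul_right _ _) _ (Nat.mul_le_mul_left k (by omega))
        (dvd_mul_right _ _) a).trans ?_
      have h1 : (1 / 4 : ℝ) ^ a ≤ 1 := pow_le_one₀ (by norm_num) (by norm_num)
      have h2 : ((N + 1 : ℕ) : ℝ) ≤ (k * (N + 1) : ℕ) := by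
        exact_mod_cast Nat.le_mul_of_pos_left (N + 1) hk
      calc _ ≤ C / (k * (N + 1) : ℕ) * 1 := by gcongr
        _ ≤ _ := by rw [mul_one]; gcongr
    · have := (tendsto_const_div_atTop_nhds_zero_nat C)
      exact (Filter.tendsto_add_atTop_iff_nat 1).2 this
  choose u hu using fun a => cauchySeq_tendsto_of_complete (hcau a)
  refine ⟨u, hu, fun n hn hkn a => ?_⟩
  refine le_of_tendsto ((hu a).const_sub (p n a)).abs ?_
  filter_upwards [Filter.eventually_ge_atTop n] with N hN
  exact hp n hn hkn _ (hN.trans (hkN N)) (dvd_mul_right _ _) a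

/-- The limits of the tails are again tails of a probability law, since the uniform bound 8^(-a)
prevents loss of mass at infinity. -/
theorem exists_limit_law (hk : 0 < k) {C : ℝ} (hC : 0 ≤ C) {π : ∀ n, Measure (State d k n)}
    {p : ℕ → ℕ → ℝ}
    (hprob : ∀ n, 0 < n → k ∣ n → IsProbabilityMeasure (π n))
    (hind : ∀ n, 0 < n → k ∣ n → IsAsympIndep C (p n) (π n))
    (hp : ∀ n, 0 < n → k ∣ n → ∀ m, n ≤ m → k ∣ m → ∀ a,
      |p n a - p m a| ≤ C / n * (1 / 4) ^ a) :
    ∃ η : Measure ℕ, IsProbabilityMeasure η ∧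
      (∀ n, 0 < n → k ∣ n → ∀ (v : Fin n) (j : ℕ),
        |(π n).real {s | s.queue v = j} - η.real {j}| ≤ 2 * C / n) ∧
      ∀ n, 0 < n → k ∣ n → ∀ (x : ℕ) (v : Fin x ↪ Fin n),
        tvDist ((π n).map fun s i => s.queue (v i)) (Measure.pi fun _ : Fin x => η) ≤
          (53 + 34 * C) * ((x : ℝ) ^ 2 / n) := by
  obtain ⟨u, hu, hpu⟩ := exists_limit_tail hk hC hp
  have hpos : ∀ N : ℕ, 0 < k * (N + 1) := fun N => by positivity
  have hdvd : ∀ N : ℕ, k ∣ k * (N + 1) := fun N => dvd_mul_right _ _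
  have hmono : Antitone u := by
    intro a b hab
    refine le_of_tendsto_of_tendsto' (hu b) (hu a) fun N => ?_
    have hN := hind _ (hpos N) (hdvd N)
    have := hprob _ (hpos N) (hdvd N)
    rw [← hN.tail ⟨0, hpos N⟩, ← hN.tail ⟨0, hpos N⟩]
    exact measureReal_mono fun s (hs : b ≤ _) => hab.trans hs
  have h0 : u 0 = 1 := by
    refine tendsto_nhds_unique (hu 0) ?_
    have h1 : ∀ N, p (k * (N + 1)) 0 = 1 := fun N => by
      have hN := hind _ (hpos N) (hdvd N)
      have := hprob _ (hpos N) (hdvd N)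
      rw [← hN.tail ⟨0, hpos N⟩ 0]
      simp
    simp only [h1]
    exact tendsto_const_nhds
  have hle : ∀ a, u a ≤ (1 / 8) ^ a := fun a =>
    le_of_tendsto' (hu a) fun N => (hind _ (hpos N) (hdvd N)).tail_le a
  have hnn : ∀ a, 0 ≤ u a := fun a => by
    refine ge_of_tendsto' (hu a) fun N => ?_
    rw [← (hind _ (hpos N) (hdvd N)).tail ⟨0, hpos N⟩]
    exact measureReal_nonneg
  have hlim : Filter.Tendsto u Filter.atTop (nhds 0) :=
    squeeze_zero hnn hle (tendsto_pow_atTop_nhds_zero_of_lt_one (by norm_num) (by norm_num))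
  obtain ⟨η, hη, hIci, hsing⟩ := exists_measure_of_tail hmono h0 hlim
  refine ⟨η, hη, fun n hn hkn v j => ?_, fun n hn hkn x v => ?_⟩
  · have := hprob n hn hkn
    have hN := hind n hn hkn
    have h1 : {s : State d k n | s.queue v = j} =
        {s | j ≤ s.queue v} \ {s | j + 1 ≤ s.queue v} := by
      ext s
      simp only [Set.mem_ofPred_eq, Set.mem_sdiff]
      omega
    have h2 : (π n).real {s | s.queue v = j} = p n j - p n (j + 1) := by
      have hsub : {s : State d k n | j + 1 ≤ s.queue v} ⊆ {s | j ≤ s.queue v} :=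
        fun s (hs : j + 1 ≤ s.queue v) => (Nat.le_succ j).trans hs
      rw [h1, measureReal_sdiff hsub MeasurableSet.of_discrete, hN.tail, hN.tail]
    have h3 := hpu n hn hkn j
    have h4 := hpu n hn hkn (j + 1)
    have h5 : ∀ a : ℕ, C / n * (1 / 4 : ℝ) ^ a ≤ C / n := fun a =>
      mul_le_of_le_one_right (by positivity) (pow_le_one₀ (by norm_num) (by norm_num))
    have h6 := h3.trans (h5 j)
    have h7 := h4.trans (h5 (j + 1))
    have h8 : 2 * C / n = C / n + C / n := by ring
    rw [h2, hsing, h8]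
    rw [abs_le] at h6 h7 ⊢
    constructor <;> linarith [h6.1, h6.2, h7.1, h7.2]
  · have := hprob n hn hkn
    refine (hind n hn hkn).tvDist_le hn hC (fun a => ?_) ?_ v
    · rw [hIci]; exact hpu n hn hkn a
    · simpa only [hIci] using hlim

end Supermarket

end

/-! ### Choice of the threshold and conclusion. -/

theorem mainTheorem2 (d r : ℕ) (hd : 1 ≤ d) (hr : 1 ≤ r) :
    ∃ lam₀ : ℝ, 0 < lam₀ ∧ ∀ lam : ℝ, 0 < lam → lam ≤ lam₀ →
    ∃ C : ℝ, ∀ kap : ℝ, 0 ≤ kap →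
    ∃ (Pi : (n : ℕ) → Measure (Supermarket.State d (2 * r) n)) (η : Measure ℕ),
      -- for every admissible `n`, `Pi n` is the unique stationary law
      (∀ n : ℕ, 0 < n → 2 * r ∣ n →
        Supermarket.IsStationaryLaw lam kap (Pi n) ∧
        ∀ μ : Measure (Supermarket.State d (2 * r) n),
          Supermarket.IsStationaryLaw lam kap μ → μ = Pi n) ∧
      -- `η` is a probability law, the pointwise limit of the stationary law of a queue
      IsProbabilityMeasure η ∧
      (∀ j : ℕ, ∀ ε : ℝ, 0 < ε → ∃ n₀ : ℕ, ∀ n : ℕ, n₀ ≤ n → 0 < n → 2 * r ∣ n → ∀ v : Fin n,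
        |(Pi n).real {s | s.queue v = j} - η.real {j}| ≤ ε) ∧
      -- the joint law of any `x` distinct queues is close to the product law
      (∀ n : ℕ, 0 < n → 2 * r ∣ n → ∀ (x : ℕ) (v : Fin x ↪ Fin n),
        Supermarket.tvDist ((Pi n).map fun s i => s.queue (v i))
            (Measure.pi fun _ : Fin x => η)
          ≤ C * ((x : ℝ) ^ 2 / (n : ℝ))) := by
  have hk : 0 < 2 * r := by omega
  set A : ℝ := (1 + d * (2 * r) : ℕ) * 8 with hA
  set B : ℝ := (4 * (1 + d * (2 * r)) * 4 ^ (1 + d * (2 * r)) : ℕ) *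
    2 ^ Supermarket.stepBound d (2 * r) with hB
  have hA0 : 0 < A := by positivity
  have hB0 : 0 < B := by positivity
  have hC : 0 ≤ Supermarket.tailConst d (2 * r) := by
    unfold Supermarket.tailConst; positivity
  -- The first constraint propagates the tail bound, the second makes the hierarchy contract.
  -- Neither they nor the constant involve `kap` or n.
  refine ⟨min (7 / 8 / A) (1 / 4 / B), by positivity, fun lam hl hlam =>
    ⟨53 + 34 * Supermarket.tailConst d (2 * r), fun kap hkap => ?_⟩⟩
  have hsmall : lam * (1 + d * (2 * r) : ℕ) * 8 ≤ 7 / 8 := by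
    have := (le_div_iff₀ hA0).1 (hlam.trans (min_le_left _ _))
    rwa [hA, ← mul_assoc] at this
  have hsmall' : lam * (4 * (1 + d * (2 * r)) * 4 ^ (1 + d * (2 * r)) : ℕ) *
      2 ^ Supermarket.stepBound d (2 * r) ≤ 1 / 4 := by
    have := (le_div_iff₀ hB0).1 (hlam.trans (min_le_right _ _))
    rwa [hB, ← mul_assoc] at this
  obtain ⟨π, p, h⟩ := Supermarket.exists_stationary_family d hk hl.le hkap hsmall hsmall'
  obtain ⟨η, hη, hpt, htv⟩ := Supermarket.exists_limit_law hk hC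
    (fun n hn hkn => (h n hn hkn).1.isProbabilityMeasure) (fun n hn hkn => (h n hn hkn).2.1)
    (fun n hn hkn => (h n hn hkn).2.2)
  refine ⟨π, η, fun n hn hkn => ⟨(h n hn hkn).1, fun μ hμ =>
    Supermarket.stationary_unique hl.le hkap hk hkn hn μ (π n) hμ (h n hn hkn).1⟩, hη,
    fun j ε hε => ?_, htv⟩
  obtain ⟨N, hN⟩ := exists_nat_ge (2 * Supermarket.tailConst d (2 * r) / ε)
  refine ⟨N, fun n hNn hn hkn v => (hpt n hn hkn v j).trans ?_⟩
  have hn' : (0 : ℝ) < n := by exact_mod_cast hn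
  rw [div_le_iff₀ hn', mul_comm ε]
  exact (div_le_iff₀ hε).1 (hN.trans (by exact_mod_cast hNn))
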